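/- Let $\mathsf X$ be a Polish space with its Borel $\sigma$-algebra and let $\nu$ be a $\sigma$-finite measure on $\mathsf X$. Consider a hidden Markov model with initial law $\chi$, transition kernel $M(x,dx')=m(x,x')\,\nu(dx')$ ($m\ge 0$ jointly measurable, $\int m(x,x')\nu(dx')=1$), and, for fixed observations, measurable likelihood functions $g_t:\mathsf X\to[0,\infty)$. Fix a finite horizon $T\ge 0$. For bounded measurable $h:\mathsf X^{T+1}\to\mathbb R$ and $0\le t\le T$ put $$L_{t,T}(x_{0:t},h)=\int\!\cdots\!\int \prod_{u=t+1}^{T} M(x_{u-1},dx_u)\,g_u(x_u)\; h(x_{0:T}),\qquad L_{T,T}(x_{0:T},h)=h(x_{0:T}),$$ $$\phi_{0:T|T}(h)=\frac{\int\chi(dx_0)\,g_0(x_0)\,L_{0,T}(x_0,h)}{\int\chi(dx_0)\,g_0(x_0)\,L_{0,T}(x_0,\mathbf 1)},$$ and let $\phi_s=\gamma_s/\gamma_s(\mathbf 1)$ be the filters, where $\gamma_0(f)=\chi(g_0f)$ and $\gamma_s(f)=\gamma_{s-1}M(g_sf)$. For a probability measure $\eta$ let $B_\eta(x,f)=\int\eta(dx')m(x',x)f(x')\big/\int\eta(dx')m(x',x)$,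 and define $$F_{t,T}(x_t,h)=\int\!\cdots\!\int B_{\phi_{t-1}}(x_t,dx_{t-1})\cdots B_{\phi_0}(x_1,dx_0)\,L_{t,T}(x_{0:t},h),\qquad G_{t,T}(x,h)=F_{t,T}\bigl(x,h-\phi_{0:T|T}(h)\bigr).$$ *Algorithm (auxiliary particle filter and backward simulation, FFBSi).* Let $\rho_0$ be a probability measure with $\chi\ll\rho_0$ and, for $1\le t\le T$, let $\vartheta_t>0$ be a measurable function and $P_t(x,dx')=p_t(x,x')\nu(dx')$ a Markov kernel with $p_t\ge0$ jointly measurable and $m(x,x')=0$ whenever $p_t(x,x')=0$. Put $$\omega_0(x)=\frac{d\chi}{d\rho_0}(x)\,g_0(x),\qquad \omega_t(x,x')=\frac{m(x,x')\,g_t(x')}{\vartheta_t(x)\,p_t(x,x')}\quad(t\ge1).$$ For each $N$, the particles $\xi_0^1,\dots,\xi_0^N$ are i.i.d. with law $\rho_0$ and have weights $\omega_0^i=\omega_0(\xi_0^i)$. For $1\le t\le T$, conditionally on the particles and weights up to time $t-1$, the pairs $(I_t^i,\xi_t^i)$, $1\le i\le N$, are i.i.d. on $\{1,\dots,N\}\times\mathsf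 X$ with law proportional to $\omega_{t-1}^k\,\vartheta_t(\xi_{t-1}^k)\,P_t(\xi_{t-1}^k,dx)$, and $\omega_t^i=\omega_t(\xi_{t-1}^{I_t^i},\xi_t^i)$. Finally, conditionally on all particles and weights, the index paths $J^1_{0:T},\dots,J^N_{0:T}$ are i.i.d. in $\{1,\dots,N\}^{T+1}$ with $$\mathbb P(J_{0:T}=j_{0:T})=\frac{\omega_T^{j_T}}{\sum_{\ell}\omega_T^{\ell}}\prod_{t=0}^{T-1}\frac{\omega_t^{j_t}\,m(\xi_t^{j_t},\xi_{t+1}^{j_{t+1}})}{\sum_{\ell}\omega_t^{\ell}\,m(\xi_t^{\ell},\xi_{t+1}^{j_{t+1}})}.$$ (These conditional laws are prescribed on the event that the total weights $\sum_i\omega_s^i$ obtained so far are all positive; off this event the variables may be chosen arbitrarily.) The FFBSi estimator is $$\tilde\phi_{0:T|T}(h)=N^{-1}\sum_{\ell=1}^N h\bigl(\xi_0^{J_0^\ell},\dots,\xi_T^{J_T^\ell}\bigr).$$ **Corollary (CLT for FFBSi).** Assume that (1) $g_t>0$ for $0\le t\le T$ and $\sup_{0\le t\le T}\|g_t\|_\infty<\infty$;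 (2) $\sup_{1\le t\le T}\|\vartheta_t\|_\infty<\infty$ and $\sup_{0\le t\le T}\|\omega_t\|_\infty<\infty$ (for $t=0$, $\rho_0$-essential supremum); (3) $\|m\|_\infty<\infty$ and $\sup_{1\le t\le T}\|p_t\|_\infty<\infty$. Then, for every bounded measurable $h:\mathsf X^{T+1}\to\mathbb R$, as $N\to\infty$, $$\sqrt N\bigl(\tilde\phi_{0:T|T}(h)-\phi_{0:T|T}(h)\bigr)\ \xrightarrow{\ \mathcal D\ }\ \mathcal N\Bigl(0,\ \phi_{0:T|T}\bigl[(h-\phi_{0:T|T}(h))^2\bigr]+\Gamma_{0:T|T}\bigl[h-\phi_{0:T|T}(h)\bigr]\Bigr),$$ where $$\Gamma_{0:T|T}[h]=\frac{\rho_0\bigl[\omega_0^2\,G_{0,T}^2(\cdot,h)\bigr]}{\bigl(\rho_0[\omega_0\,F_{0,T}(\cdot,\mathbf 1)]\bigr)^2}+\sum_{t=1}^T\frac{\phi_{t-1}[\upsilon_{t,T}(\cdot,h)]\ \phi_{t-1}(\vartheta_t)}{\bigl(\phi_{t-1}[F_{t-1,T}(\cdot,\mathbf 1)]\bigr)^2},\qquad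 \upsilon_{t,T}(x,h)=\vartheta_t(x)\int P_t(x,dx')\,\omega_t^2(x,x')\,G_{t,T}^2(x',h).$$ -/

import Mathlib

open MeasureTheory ProbabilityTheory Filter

noncomputable section

/-- A fully dominated hidden Markov model with fixed observations: reference measure `ν`, Markov
transition density `m` with respect to `ν`, initial law `χ`, and for every time `t` the likelihood
`g t` of the state at time `t` given the (fixed) observation at time `t`. -/
structure DominatedHMM (X : Type*) [MeasurableSpace X] where
  ν : Measure X
  sigmaFinite_ν : SigmaFinite ν
  m : X → X → ℝ
  measurable_m : Measurable (Function.uncurry m)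
  m_nonneg : ∀ x x', 0 ≤ m x x'
  lintegral_m : ∀ x, ∫⁻ x', ENNReal.ofReal (m x x') ∂ν = 1
  χ : Measure X
  isProbabilityMeasure_χ : IsProbabilityMeasure χ
  g : ℕ → X → ℝ
  measurable_g : ∀ t, Measurable (g t)
  g_nonneg : ∀ t x, 0 ≤ g t x

attribute [instance] DominatedHMM.sigmaFinite_ν DominatedHMM.isProbabilityMeasure_χ

namespace DominatedHMM

variable {X : Type*} [MeasurableSpace X] (H : DominatedHMM X)

/-- The transition kernel `M(x, dx') = m(x, x') ν(dx')`. -/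
def M : Kernel X X :=
  Kernel.withDensity (Kernel.const X H.ν) (fun x x' => ENNReal.ofReal (H.m x x'))

/-- Unnormalised filter: `γ_0(f) = χ(g_0 f)`, `γ_{s+1}(f) = γ_s M(g_{s+1} f)`. -/
def unfilt : ℕ → Measure X
  | 0 => H.χ.withDensity (fun x => ENNReal.ofReal (H.g 0 x))
  | s + 1 => ((unfilt s).bind H.M).withDensity (fun x => ENNReal.ofReal (H.g (s + 1) x))

/-- The filtering distribution `φ_s = γ_s / γ_s(1)`. -/
def filt (s : ℕ) : Measure X := (H.unfilt s Set.univ)⁻¹ • H.unfilt s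

/-- The backward kernel `B_η(x, f) = ∫ η(dx') m(x', x) f(x') / ∫ η(dx') m(x', x)`. -/
def BK (η : Measure X) (x : X) (f : X → ℝ) : ℝ :=
  (∫ x', H.m x' x * f x' ∂η) / ∫ x', H.m x' x ∂η

/-- `H.fwd n t f x` integrates the coordinates `x_{t+1}, …, x_{t+n}` of the path `x` out of `f`
against `∏_{u = t+1}^{t+n} M(x_{u-1}, dx_u) g_u(x_u)`. -/
def fwd : ℕ → ℕ → ((ℕ → X) → ℝ) → (ℕ → X) → ℝ
  | 0, _, f, x => f x
  | n + 1, t, f, x =>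
      ∫ z, H.g (t + 1) z * fwd n (t + 1) f (Function.update x (t + 1) z) ∂(H.M (x t))

/-- `H.bwd t f x` integrates the coordinates `x_{t-1}, …, x_0` of the path `x` out of `f`
against `B_{φ_{t-1}}(x_t, dx_{t-1}) ⋯ B_{φ_0}(x_1, dx_0)`. -/
def bwd : ℕ → ((ℕ → X) → ℝ) → (ℕ → X) → ℝ
  | 0, f, x => f x
  | t + 1, f, x => H.BK (H.filt t) (x (t + 1)) (fun z => bwd t f (Function.update x t z))

/-- `L_{t,T}(x_{0:t}, h)` for `t ≤ T`. It depends on the path `x` only through `x_0, …, x_t`. -/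
def L (T t : ℕ) (h : (Fin (T + 1) → X) → ℝ) (x : ℕ → X) : ℝ :=
  H.fwd (T - t) t (fun y => h (fun i => y i)) x

/-- The joint smoothing distribution `φ_{0:T|T}` applied to `h`:
`∫ χ(dx_0) g_0(x_0) ∏_{u=1}^T M(x_{u-1}, dx_u) g_u(x_u) h(x_{0:T})`, normalised by the same
integral with `h = 1`. -/
def smooth (T : ℕ) (h : (Fin (T + 1) → X) → ℝ) : ℝ :=
  (∫ x, H.g 0 x * H.L T 0 h (fun _ => x) ∂H.χ) /
    ∫ x, H.g 0 x * H.L T 0 (fun _ => 1) (fun _ => x) ∂H.χ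

/-- The limiting kernel `F_{t,T}(x_t, h)`, that is
`∫ B_{φ_{t-1}}(x_t, dx_{t-1}) ⋯ B_{φ_0}(x_1, dx_0) L_{t,T}(x_{0:t}, h)`.
The integrals on the right are evaluated at a path whose `t`-th coordinate is `x`; the other
coordinates of that path are all integrated out. -/
def F (T t : ℕ) (x : X) (h : (Fin (T + 1) → X) → ℝ) : ℝ :=
  H.bwd t (H.L T t h) (fun _ => x)

/-- `G_{t,T}(x, h) = F_{t,T}(x, h - φ_{0:T|T}(h))`. -/
def G (T t : ℕ) (x : X) (h : (Fin (T + 1) → X) → ℝ) : ℝ :=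
  H.F T t x (fun y => h y - H.smooth T h)

/-- The likelihoods up to time `T` are positive and uniformly bounded. -/
def BoundedLikelihood (T : ℕ) : Prop :=
  (∀ t ≤ T, ∀ x, 0 < H.g t x) ∧ ∃ C : ℝ, ∀ t ≤ T, ∀ x, H.g t x ≤ C

end DominatedHMM

/-- Ingredients of an auxiliary particle filter for the model `H`: instrumental initial law `ρ₀`
dominating `χ`, and for every time `t ≥ 1` positive adjustment multipliers `ϑ t` and a Markov
proposal density `p t` with respect to `ν` that dominates `m` (the values at `t = 0` are unused). -/
structure APF {X : Type*} [MeasurableSpace X] (H : DominatedHMM X) where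
  ρ₀ : Measure X
  isProbabilityMeasure_ρ₀ : IsProbabilityMeasure ρ₀
  χ_ac : H.χ ≪ ρ₀
  ϑ : ℕ → X → ℝ
  measurable_ϑ : ∀ t, Measurable (ϑ t)
  ϑ_pos : ∀ t x, 0 < ϑ t x
  p : ℕ → X → X → ℝ
  measurable_p : ∀ t, Measurable (Function.uncurry (p t))
  p_nonneg : ∀ t x x', 0 ≤ p t x x'
  lintegral_p : ∀ t x, ∫⁻ x', ENNReal.ofReal (p t x x') ∂H.ν = 1
  p_dominates : ∀ t x x', p t x x' = 0 → H.m x x' = 0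

attribute [instance] APF.isProbabilityMeasure_ρ₀

namespace APF

variable {X : Type*} [MeasurableSpace X] {H : DominatedHMM X} (A : APF H)

/-- The proposal kernel `P_t(x, dx') = p_t(x, x') ν(dx')`. -/
def proposal (t : ℕ) : Kernel X X :=
  Kernel.withDensity (Kernel.const X H.ν) (fun x x' => ENNReal.ofReal (A.p t x x'))

/-- The importance weight function at time `0`: `(dχ/dρ₀)(x) g_0(x)`. -/
def w₀ (x : X) : ℝ := (H.χ.rnDeriv A.ρ₀ x).toReal * H.g 0 x

/-- The importance weight function at time `t ≥ 1`. -/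
def w (t : ℕ) (x x' : X) : ℝ := H.m x x' * H.g t x' / (A.ϑ t x * A.p t x x')

/-- `υ_{t,T}(x, h) = ϑ_t(x) ∫ P_t(x, dx') w_t(x, x')² G_{t,T}(x', h)²`. -/
def upsilon (T t : ℕ) (x : X) (h : (Fin (T + 1) → X) → ℝ) : ℝ :=
  A.ϑ t x * ∫ x', A.w t x x' ^ 2 * H.G T t x' h ^ 2 ∂(A.proposal t x)

/-- The asymptotic variance `Γ_{0:T|T}[h]` of the FFBS estimator. -/
def asymVar (T : ℕ) (h : (Fin (T + 1) → X) → ℝ) : ℝ :=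
  (∫ x, A.w₀ x ^ 2 * H.G T 0 x h ^ 2 ∂A.ρ₀) / (∫ x, A.w₀ x * H.F T 0 x (fun _ => 1) ∂A.ρ₀) ^ 2 +
    ∑ t ∈ Finset.Icc 1 T,
      (∫ x, A.upsilon T t x h ∂(H.filt (t - 1))) * (∫ x, A.ϑ t x ∂(H.filt (t - 1))) /
        (∫ x, H.F T (t - 1) x (fun _ => 1) ∂(H.filt (t - 1))) ^ 2

/-- The adjustment multipliers and the importance weight functions up to time `T` are uniformly
bounded. As the Radon-Nikodym derivative `dχ/dρ₀` is only defined up to `ρ₀`-null sets,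
boundedness of the weight function at time `0` is required `ρ₀`-almost everywhere. -/
def BoundedWeights (T : ℕ) : Prop :=
  (∃ C : ℝ, ∀ t, 1 ≤ t → t ≤ T → ∀ x, A.ϑ t x ≤ C) ∧
  (∃ C : ℝ, ∀ᵐ x ∂A.ρ₀, A.w₀ x ≤ C) ∧
  (∃ C : ℝ, ∀ t, 1 ≤ t → t ≤ T → ∀ x x', A.w t x x' ≤ C)

/-- The transition density and the proposal densities up to time `T` are uniformly bounded. -/
def BoundedDensities (T : ℕ) : Prop :=
  (∃ C : ℝ, ∀ x x', H.m x x' ≤ C) ∧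
  (∃ C : ℝ, ∀ t, 1 ≤ t → t ≤ T → ∀ x x', A.p t x x' ≤ C)

end APF

/-- The random variables of a run of the FFBSi algorithm with `N` particles and horizon `T`:
particles `ξ t i`, ancestor indices `I t i` (`t ≥ 1`; `I 0` is unused), and backward index paths
`J ℓ`. Only times `t ≤ T` matter. -/
structure ParticleArray (Ω X : Type*) (T N : ℕ) where
  ξ : ℕ → Fin N → Ω → X
  I : ℕ → Fin N → Ω → Fin N
  J : Fin N → Fin (T + 1) → Ω → Fin N

namespace ParticleArray

variable {Ω X : Type*} [MeasurableSpace X] {H : DominatedHMM X} {T N : ℕ}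
  (S : ParticleArray Ω X T N) (A : APF H)

/-- The importance weights `ω_t^i`. -/
def weight : ℕ → Fin N → Ω → ℝ
  | 0, i, ω => A.w₀ (S.ξ 0 i ω)
  | t + 1, i, ω => A.w (t + 1) (S.ξ t (S.I (t + 1) i ω) ω) (S.ξ (t + 1) i ω)

/-- The total weight at time `t`. -/
def sumWeight (t : ℕ) (ω : Ω) : ℝ := ∑ i, S.weight A t i ω

/-- The weighted samples at times `0, …, t` all have positive total weight, so that they can be
normalised. -/
def Nondegenerate (t : ℕ) (ω : Ω) : Prop := ∀ s ≤ t, 0 < S.sumWeight A s ω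

/-- The σ-algebra generated by the particles and weights up to time `t`. -/
@[reducible]
def past (t : ℕ) : MeasurableSpace Ω :=
  ⨆ s ∈ Finset.range (t + 1), ⨆ i : Fin N,
    MeasurableSpace.comap (S.ξ s i) inferInstance ⊔
      MeasurableSpace.comap (S.weight A s i) inferInstance

/-- The instrumental distribution on `{1, …, N} × X` from which the pairs (ancestor index,
particle) at time `t + 1` are drawn: proportional to `ω_t^k ϑ_{t+1}(ξ_t^k) P_{t+1}(ξ_t^k, ·)`. -/
def instrumental (t : ℕ) (ω : Ω) : Measure (Fin N × X) :=
  ∑ k, ENNReal.ofReal (S.weight A t k ω * A.ϑ (t + 1) (S.ξ t k ω) /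
      ∑ l, S.weight A t l ω * A.ϑ (t + 1) (S.ξ t l ω)) •
    (Measure.dirac k).prod (A.proposal (t + 1) (S.ξ t k ω))

/-- The backward transition matrix `Λ_t(i, j)`. -/
def Λ (t : ℕ) (ω : Ω) (i j : Fin N) : ℝ :=
  S.weight A t j ω * H.m (S.ξ t j ω) (S.ξ (t + 1) i ω) /
    ∑ l, S.weight A t l ω * H.m (S.ξ t l ω) (S.ξ (t + 1) i ω)

/-- The probability of the index path `j` under the backward chain. -/
def pathProb (ω : Ω) (j : Fin (T + 1) → Fin N) : ℝ :=
  S.weight A T (j (Fin.last T)) ω / S.sumWeight A T ω *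
    ∏ t : Fin T, S.Λ A t ω (j t.succ) (j t.castSucc)

/-- The FFBSi estimator. -/
def estimator (h : (Fin (T + 1) → X) → ℝ) (ω : Ω) : ℝ :=
  (N : ℝ)⁻¹ * ∑ ℓ, h (fun t => S.ξ t (S.J ℓ t ω) ω)

/-- `S` is produced, under `P`, by the auxiliary particle filter `A` followed by backward
simulation:
* the initial particles are i.i.d. with law `ρ₀`;
* conditionally on the particles and weights up to time `t < T`, the pairs
  (ancestor index, particle) at time `t + 1` are i.i.d. with the instrumental distribution;
* conditionally on all particles and weights, the `N` index paths are i.i.d. with the law of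
  the backward chain.
Conditional laws are prescribed on the event that all samples drawn so far can be normalised;
nothing is required off that event, where these laws are undefined. -/
structure IsFFBSi [MeasurableSpace Ω] (P : Measure Ω) : Prop where
  measurable_ξ : ∀ t i, Measurable (S.ξ t i)
  measurable_I : ∀ t i, Measurable (S.I t i)
  measurable_J : ∀ ℓ t, Measurable (S.J ℓ t)
  indep_init : iIndepFun (fun i => S.ξ 0 i) P
  law_init : ∀ i, P.map (S.ξ 0 i) = A.ρ₀
  law_step : ∀ t < T, ∀ B : Fin N → Set (Fin N × X), (∀ i, MeasurableSet (B i)) →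
    ∀ᵐ ω ∂P, S.Nondegenerate A t ω →
      (P⟦{ω' | ∀ i, (S.I (t + 1) i ω', S.ξ (t + 1) i ω') ∈ B i} | S.past A t⟧) ω =
        ∏ i, (S.instrumental A t ω).real (B i)
  law_backward : ∀ j : Fin N → Fin (T + 1) → Fin N,
    ∀ᵐ ω ∂P, S.Nondegenerate A T ω →
      (P⟦{ω' | ∀ ℓ t, S.J ℓ t ω' = j ℓ t} | S.past A T⟧) ω = ∏ ℓ, S.pathProb A ω (j ℓ)

end ParticleArray

end

/-! ### Convergence in probability as convergence along a filter -/

section InProb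

open scoped Topology ENNReal

variable {Ω : Type*} [MeasurableSpace Ω]

/-- The filter on `ℕ × Ω` of the families of events whose probability tends to one. A sequence
`X` converges to a constant `c` in probability iff `(N, ω) ↦ X N ω` tends to `c` along it. -/
def inProb (P : Measure Ω) : Filter (ℕ × Ω) where
  sets := {A | Tendsto (fun N => P {ω | (N, ω) ∉ A}) atTop (𝓝 0)}
  univ_sets := by simp
  sets_of_superset := by
    intro A B hA hAB
    exact tendsto_of_tendsto_of_tendsto_of_le_of_le tendsto_const_nhds hA (fun _ => zero_le)
      (fun N => measure_mono fun ω hω h => hω (hAB h))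
  inter_sets := by
    intro A B hA hB
    have h := Tendsto.add hA hB
    rw [add_zero] at h
    refine tendsto_of_tendsto_of_tendsto_of_le_of_le tendsto_const_nhds h (fun _ => zero_le)
      (fun N => (measure_mono ?_).trans (measure_union_le _ _))
    intro ω hω
    by_contra hc
    simp only [Set.mem_union, Set.mem_ofPred_eq, not_or, not_not] at hc
    exact hω ⟨hc.1, hc.2⟩

variable {P : Measure Ω}

lemma eventually_inProb {p : ℕ × Ω → Prop} :
    (∀ᶠ q in inProb P, p q) ↔ Tendsto (fun N => P {ω | ¬ p (N, ω)}) atTop (𝓝 0) := Iff.rfl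

lemma tendsto_inProb_iff {X : ℕ × Ω → ℝ} {c : ℝ} :
    Tendsto X (inProb P) (𝓝 c) ↔
      ∀ ε > 0, Tendsto (fun N => P {ω | ε ≤ |X (N, ω) - c|}) atTop (𝓝 0) := by
  rw [Metric.tendsto_nhds]
  refine forall₂_congr fun ε _ => ?_
  rw [eventually_inProb]
  simp only [Real.dist_eq, not_lt]

lemma eventually_inProb_of_ae {p : ℕ × Ω → Prop} (h : ∀ N, 1 ≤ N → ∀ᵐ ω ∂P, p (N, ω)) :
    ∀ᶠ q in inProb P, p q := by
  rw [eventually_inProb]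
  refine tendsto_const_nhds.congr' ?_
  filter_upwards [eventually_ge_atTop 1] with N hN
  exact (h N hN).symm

/-- Bounded convergence in probability implies convergence in `L¹`. -/
lemma tendsto_lintegral_of_tendsto_inProb [IsProbabilityMeasure P] {X : ℕ × Ω → ℝ} {c K : ℝ}
    (hX : Tendsto X (inProb P) (𝓝 c)) (hm : ∀ N, Measurable fun ω => X (N, ω))
    (hK : ∀ N ω, |X (N, ω) - c| ≤ K) :
    Tendsto (fun N => ∫⁻ ω, ENNReal.ofReal |X (N, ω) - c| ∂P) atTop (𝓝 0) := by
  rw [ENNReal.tendsto_nhds_zero]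
  intro ε hε
  obtain ⟨δ, hδ0, hδ⟩ : ∃ δ : ℝ, 0 < δ ∧ ENNReal.ofReal δ ≤ ε / 2 := by
    have h2 : 0 < ε / 2 := ENNReal.half_pos hε.ne'
    by_cases ht : ε / 2 = ∞
    · exact ⟨1, one_pos, by simp [ht]⟩
    · exact ⟨(ε / 2).toReal, ENNReal.toReal_pos h2.ne' ht, by rw [ENNReal.ofReal_toReal ht]⟩
  have h1 := tendsto_inProb_iff.1 hX δ hδ0
  have h2 : Tendsto (fun N => ENNReal.ofReal K * P {ω | δ ≤ |X (N, ω) - c|}) atTop (𝓝 0) := by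
    have := ENNReal.Tendsto.const_mul (a := ENNReal.ofReal K) h1 (Or.inr ENNReal.ofReal_ne_top)
    simpa using this
  have h3 := (ENNReal.tendsto_nhds_zero.1 h2) (ε / 2) (ENNReal.half_pos hε.ne')
  filter_upwards [h3] with N hN
  have hms : MeasurableSet {ω | δ ≤ |X (N, ω) - c|} :=
    measurableSet_le measurable_const ((hm N).sub_const c).abs
  calc ∫⁻ ω, ENNReal.ofReal |X (N, ω) - c| ∂P
      ≤ ∫⁻ ω, (ENNReal.ofReal δ +
          {ω | δ ≤ |X (N, ω) - c|}.indicator (fun _ => ENNReal.ofReal K) ω) ∂P := by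
        refine lintegral_mono fun ω => ?_
        by_cases hω : δ ≤ |X (N, ω) - c|
        · rw [Set.indicator_of_mem (by exact hω)]
          exact (ENNReal.ofReal_le_ofReal (hK N ω)).trans le_add_self
        · rw [Set.indicator_of_notMem (by exact hω), add_zero]
          exact ENNReal.ofReal_le_ofReal (not_le.1 hω).le
    _ = ENNReal.ofReal δ + ENNReal.ofReal K * P {ω | δ ≤ |X (N, ω) - c|} := by
        rw [lintegral_add_left measurable_const, lintegral_indicator_const hms]
        simp
    _ ≤ ε / 2 + ε / 2 := add_le_add hδ hN
    _ = ε := ENNReal.add_halves ε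

/-- `L¹` convergence on events of probability tending to one implies convergence in probability. -/
lemma tendsto_inProb_of_tendsto_lintegral {X : ℕ × Ω → ℝ} {c : ℝ} {G : ℕ → Set Ω}
    (hG : ∀ᶠ q in inProb P, q.2 ∈ G q.1)
    (h : Tendsto (fun N => ∫⁻ ω in G N, ENNReal.ofReal |X (N, ω) - c| ∂P) atTop (𝓝 0))
    (hm : ∀ N, Measurable fun ω => X (N, ω)) :
    Tendsto X (inProb P) (𝓝 c) := by
  rw [tendsto_inProb_iff]
  intro ε hε
  rw [eventually_inProb] at hG
  have h2 : Tendsto (fun N => (∫⁻ ω in G N, ENNReal.ofReal |X (N, ω) - c| ∂P) / ENNReal.ofReal ε)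
      atTop (𝓝 0) := by
    have := ENNReal.Tendsto.div_const h (b := ENNReal.ofReal ε) (Or.inr (by simpa using hε))
    simpa using this
  have h3 := hG.add h2
  rw [add_zero] at h3
  refine tendsto_of_tendsto_of_tendsto_of_le_of_le tendsto_const_nhds h3 (fun _ => zero_le) ?_
  intro N
  have hms : MeasurableSet {ω | ε ≤ |X (N, ω) - c|} :=
    measurableSet_le measurable_const ((hm N).sub_const c).abs
  calc P {ω | ε ≤ |X (N, ω) - c|}
      ≤ P ({ω | ω ∉ G N} ∪ ({ω | ε ≤ |X (N, ω) - c|} ∩ G N)) := by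
        refine measure_mono fun ω hω => ?_
        by_cases hg : ω ∈ G N
        · exact Or.inr ⟨hω, hg⟩
        · exact Or.inl hg
    _ ≤ P {ω | ω ∉ G N} + P ({ω | ε ≤ |X (N, ω) - c|} ∩ G N) := measure_union_le _ _
    _ ≤ P {ω | ω ∉ G N} + (∫⁻ ω in G N, ENNReal.ofReal |X (N, ω) - c| ∂P) /
          ENNReal.ofReal ε := by
        gcongr
        rw [← Measure.restrict_apply hms]
        rw [ENNReal.le_div_iff_mul_le (Or.inl (by simpa using hε)) (Or.inl ENNReal.ofReal_ne_top),
          mul_comm]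
        refine le_trans ?_ (mul_meas_ge_le_lintegral
          ((hm N).sub_const c).abs.ennreal_ofReal (ENNReal.ofReal ε))
        gcongr
        rename_i ω
        exact ENNReal.ofReal_le_ofReal

/-- **Pratt's lemma**: dominated convergence to zero with convergent dominating functions. -/
lemma tendsto_lintegral_zero_of_le_tendsto {α : Type*} [MeasurableSpace α] {ν : Measure α}
    {D b : ℕ → α → ℝ≥0∞} {b' : α → ℝ≥0∞} (hD : ∀ n, Measurable (D n)) (hb : ∀ n, Measurable (b n))
    (hle : ∀ n x, D n x ≤ b n x) (hD0 : ∀ x, Tendsto (fun n => D n x) atTop (𝓝 0))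
    (hb0 : ∀ x, Tendsto (fun n => b n x) atTop (𝓝 (b' x)))
    (hint : Tendsto (fun n => ∫⁻ x, b n x ∂ν) atTop (𝓝 (∫⁻ x, b' x ∂ν)))
    (hfin : ∫⁻ x, b' x ∂ν ≠ ∞) :
    Tendsto (fun n => ∫⁻ x, D n x ∂ν) atTop (𝓝 0) := by
  have hfat := lintegral_liminf_le (μ := ν) (f := fun n x => b n x - D n x) (u := atTop)
    (fun n => (hb n).sub (hD n))
  have hlim : ∀ x, liminf (fun n => b n x - D n x) atTop = b' x := by
    intro x
    have := ENNReal.Tendsto.sub (hb0 x) (hD0 x) (Or.inr (by simp))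
    rw [tsub_zero] at this
    exact this.liminf_eq
  simp_rw [hlim] at hfat
  rw [ENNReal.tendsto_nhds_zero]
  intro ε hε
  by_cases hεt : ε = ∞
  · simp [hεt]
  by_cases hI0 : ∫⁻ x, b' x ∂ν = 0
  · rw [hI0] at hint
    filter_upwards [ENNReal.tendsto_nhds_zero.1 hint ε hε] with n hn
    exact (lintegral_mono (hle n)).trans hn
  have hε2 : 0 < ε / 2 := ENNReal.half_pos hε.ne'
  have h1 : ∀ᶠ n in atTop, (∫⁻ x, b' x ∂ν) - ε / 2 < ∫⁻ x, (b n x - D n x) ∂ν := by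
    refine eventually_lt_of_lt_liminf (lt_of_lt_of_le ?_ hfat)
    exact ENNReal.sub_lt_self hfin hI0 hε2.ne'
  have h2 : ∀ᶠ n in atTop, ∫⁻ x, b n x ∂ν < (∫⁻ x, b' x ∂ν) + ε / 2 :=
    hint.eventually_lt_const (ENNReal.lt_add_right hfin hε2.ne')
  filter_upwards [h1, h2] with n hn1 hn2
  have hadd : ∫⁻ x, (b n x - D n x) ∂ν + ∫⁻ x, D n x ∂ν = ∫⁻ x, b n x ∂ν := by
    rw [← lintegral_add_left (f := fun x => b n x - D n x) ((hb n).sub (hD n))]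
    exact lintegral_congr fun x => tsub_add_cancel_of_le (hle n x)
  set I := ∫⁻ x, b' x ∂ν
  set a := ∫⁻ x, (b n x - D n x) ∂ν
  set d := ∫⁻ x, D n x ∂ν
  have hat : a ≠ ∞ := by
    intro h
    rw [h, top_add] at hadd
    rw [← hadd] at hn2
    exact absurd hn2 (by simp)
  have h3 : a + d ≤ a + ε := by
    rw [hadd]
    calc ∫⁻ x, b n x ∂ν ≤ I + ε / 2 := hn2.le
      _ ≤ (a + ε / 2) + ε / 2 := by
        gcongr
        exact tsub_le_iff_right.1 hn1.le
      _ = a + ε := by rw [add_assoc, ENNReal.add_halves]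
  exact (ENNReal.add_le_add_iff_left hat).1 h3

end InProb

/-! ### Conditionally i.i.d. samples -/

lemma sq_integral_le_integral_sq {E : Type*} [MeasurableSpace E] {κ : Measure E}
    [IsProbabilityMeasure κ] {a : E → ℝ} (ha : Measurable a) {K : ℝ} (hK : ∀ y, |a y| ≤ K) :
    (∫ y, a y ∂κ) ^ 2 ≤ ∫ y, a y ^ 2 ∂κ := by
  have hLp : MemLp a 2 κ := MemLp.of_bound ha.aestronglyMeasurable K (ae_of_all _ hK)
  have := variance_nonneg a κ
  rw [variance_eq_sub hLp] at this
  simpa using sub_nonneg.1 this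

section CondIID

open scoped Topology ENNReal

variable {Ω Ω₀ E : Type*} [MeasurableSpace Ω] [MeasurableSpace E]

/-- On the event `Z ∈ G`, the variables `Y i` are i.i.d. with law `κ Z` conditionally on `Z`. -/
structure CondIID (mΩ₀ : MeasurableSpace Ω₀) (P : Measure Ω) {N : ℕ} (Z : Ω → Ω₀) (G : Set Ω₀)
    (κ : Ω₀ → Measure E) (Y : Fin N → Ω → E) : Prop where
  measurable_past : Measurable Z
  measurableSet_good : MeasurableSet G
  measurable_kernel : Measurable κ
  measurable_sample : ∀ i, Measurable (Y i)
  isProbabilityMeasure_kernel : ∀ z ∈ G, IsProbabilityMeasure (κ z)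
  law : ∀ F : Set Ω₀, MeasurableSet F → F ⊆ G → ∀ B : Fin N → Set E, (∀ i, MeasurableSet (B i)) →
    P (Z ⁻¹' F ∩ {ω | ∀ i, Y i ω ∈ B i}) = ∫⁻ ω in Z ⁻¹' F, ∏ i, κ (Z ω) (B i) ∂P

variable {mΩ₀ : MeasurableSpace Ω₀}

lemma measurable_measure_pi {N : ℕ} {κ : Ω₀ → Measure E} (hκ : Measurable κ)
    [∀ z, IsProbabilityMeasure (κ z)] :
    Measurable (fun z => Measure.pi (fun _ : Fin N => κ z)) := by
  refine Measurable.measure_of_isPiSystem_of_isProbabilityMeasure generateFrom_pi.symm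
    isPiSystem_pi ?_
  rintro _ ⟨B, hB, rfl⟩
  simp only [Measure.pi_pi]
  exact Finset.measurable_prod _ fun i _ => (Measure.measurable_coe (hB i trivial)).comp hκ

variable {P : Measure Ω} {N : ℕ} {Z : Ω → Ω₀} {G : Set Ω₀}
  {κ : Ω₀ → Measure E} {Y : Fin N → Ω → E}

namespace CondIID

lemma exists_kernel_law (h : CondIID mΩ₀ P Z G κ Y) (hne : G.Nonempty) :
    ∃ κ' : Ω₀ → Measure E, Measurable κ' ∧ (∀ z, IsProbabilityMeasure (κ' z)) ∧
      ∀ z ∈ G, κ' z = κ z := by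
  classical
  obtain ⟨z₀, hz₀⟩ := hne
  refine ⟨fun z => if z ∈ G then κ z else κ z₀,
    Measurable.ite h.measurableSet_good h.measurable_kernel measurable_const, ?_, ?_⟩
  · intro z
    by_cases hz : z ∈ G
    · simpa only [hz, if_true] using h.isProbabilityMeasure_kernel z hz
    · simpa only [hz, if_false] using h.isProbabilityMeasure_kernel z₀ hz₀
  · intro z hz
    simp [hz]

variable [IsProbabilityMeasure P]

/-- The joint law of the past and of the sample, on the good event. -/
lemma map_restrict_eq (h : CondIID mΩ₀ P Z G κ Y) {κ' : Ω₀ → Measure E} (hκ' : Measurable κ')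
    [∀ z, IsProbabilityMeasure (κ' z)] (heq : ∀ z ∈ G, κ' z = κ z) :
    (P.restrict (Z ⁻¹' G)).map (fun ω => (Z ω, fun i => Y i ω)) =
      ((P.restrict (Z ⁻¹' G)).map Z) ⊗ₘ
        (⟨fun z => Measure.pi (fun _ : Fin N => κ' z), measurable_measure_pi hκ'⟩ :
          Kernel Ω₀ (Fin N → E)) := by
  set K : Kernel Ω₀ (Fin N → E) :=
    ⟨fun z => Measure.pi (fun _ : Fin N => κ' z), measurable_measure_pi hκ'⟩ with hK
  have : IsMarkovKernel K := ⟨fun z => by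
    change IsProbabilityMeasure (Measure.pi (fun _ : Fin N => κ' z)); infer_instance⟩
  have hY : Measurable (fun ω => (fun i => Y i ω)) := measurable_pi_lambda _ h.measurable_sample
  have hZY : Measurable (fun ω => (Z ω, fun i => Y i ω)) := h.measurable_past.prodMk hY
  have key : ∀ F : Set Ω₀, MeasurableSet F → ∀ B : Fin N → Set E, (∀ i, MeasurableSet (B i)) →
      (P.restrict (Z ⁻¹' G)).map (fun ω => (Z ω, fun i => Y i ω)) (F ×ˢ Set.univ.pi B) =
      (((P.restrict (Z ⁻¹' G)).map Z) ⊗ₘ K) (F ×ˢ Set.univ.pi B) := by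
    intro F hF B hB
    rw [Measure.map_apply hZY (hF.prod (MeasurableSet.univ_pi hB)),
      Measure.restrict_apply (hZY (hF.prod (MeasurableSet.univ_pi hB))),
      Measure.compProd_apply_prod hF (MeasurableSet.univ_pi hB),
      setLIntegral_map hF (K.measurable_coe (MeasurableSet.univ_pi hB)) h.measurable_past,
      Measure.restrict_restrict (h.measurable_past hF)]
    have e1 : (fun ω => (Z ω, fun i => Y i ω)) ⁻¹' (F ×ˢ Set.univ.pi B) ∩ Z ⁻¹' G =
        Z ⁻¹' (F ∩ G) ∩ {ω | ∀ i, Y i ω ∈ B i} := by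
      ext ω; simp [Set.mem_pi]; tauto
    rw [e1, h.law _ (hF.inter h.measurableSet_good) Set.inter_subset_right B hB,
      ← Set.preimage_inter]
    refine setLIntegral_congr_fun (h.measurable_past (hF.inter h.measurableSet_good)) ?_
    intro ω hω
    simp only [hK, Kernel.coe_mk, Measure.pi_pi]
    rw [heq _ hω.2]
  refine ext_of_generate_finite
    (Set.image2 (· ×ˢ ·) {F : Set Ω₀ | MeasurableSet F}
      (Set.univ.pi '' Set.univ.pi fun _ : Fin N => {s : Set E | MeasurableSet s})) ?_ ?_ ?_ ?_
  · refine (generateFrom_eq_prod MeasurableSpace.generateFrom_measurableSet generateFrom_pi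
      isCountablySpanning_measurableSet ?_).symm
    exact IsCountablySpanning.pi fun _ => isCountablySpanning_measurableSet
  · exact MeasurableSpace.isPiSystem_measurableSet.prod isPiSystem_pi
  · rintro _ ⟨F, hF, _, ⟨B, hB, rfl⟩, rfl⟩
    exact key F hF B (fun i => hB i trivial)
  · have := key Set.univ MeasurableSet.univ (fun _ => Set.univ) (fun _ => MeasurableSet.univ)
    simpa using this

/-- Conditional Fubini: integrating the sample out given the past. -/
lemma setIntegral_eq {F : Type*} [NormedAddCommGroup F] [NormedSpace ℝ F] (h : CondIID mΩ₀ P Z G κ Y)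
    {ψ : Ω₀ × (Fin N → E) → F} (hψ : StronglyMeasurable ψ) {K : ℝ}
    (hK : ∀ z ∈ G, ∀ y, ‖ψ (z, y)‖ ≤ K) :
    ∫ ω in Z ⁻¹' G, ψ (Z ω, fun i => Y i ω) ∂P =
      ∫ ω in Z ⁻¹' G, ∫ y, ψ (Z ω, y) ∂(Measure.pi (fun _ : Fin N => κ (Z ω))) ∂P := by
  rcases G.eq_empty_or_nonempty with hG | hG
  · simp [hG]
  obtain ⟨κ', hκ', hprob, heq⟩ := h.exists_kernel_law hG
  have hlaw := h.map_restrict_eq hκ' heq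
  set Kn : Kernel Ω₀ (Fin N → E) :=
    ⟨fun z => Measure.pi (fun _ : Fin N => κ' z), measurable_measure_pi hκ'⟩ with hKn
  have : IsMarkovKernel Kn := ⟨fun z => by
    change IsProbabilityMeasure (Measure.pi (fun _ : Fin N => κ' z)); infer_instance⟩
  have hY : Measurable (fun ω => (fun i => Y i ω)) := measurable_pi_lambda _ h.measurable_sample
  have hZY : Measurable (fun ω => (Z ω, fun i => Y i ω)) := h.measurable_past.prodMk hY
  have hGm : MeasurableSet (Z ⁻¹' G) := h.measurable_past h.measurableSet_good
  have hae : ∀ᵐ q ∂((P.restrict (Z ⁻¹' G)).map (fun ω => (Z ω, fun i => Y i ω))), ‖ψ q‖ ≤ K := by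
    rw [ae_map_iff hZY.aemeasurable
      (measurableSet_le hψ.norm.measurable measurable_const)]
    filter_upwards [ae_restrict_mem hGm] with ω hω
    exact hK _ hω _
  have hint : Integrable ψ ((P.restrict (Z ⁻¹' G)).map (fun ω => (Z ω, fun i => Y i ω))) := by
    have : IsFiniteMeasure ((P.restrict (Z ⁻¹' G)).map (fun ω => (Z ω, fun i => Y i ω))) := by
      infer_instance
    exact Integrable.of_bound hψ.aestronglyMeasurable K hae
  rw [← integral_map hZY.aemeasurable hψ.aestronglyMeasurable, hlaw,
    Measure.integral_compProd (hlaw ▸ hint),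
    integral_map h.measurable_past.aemeasurable
      (hψ.integral_kernel_prod_right' (κ := Kn)).aestronglyMeasurable]
  refine setIntegral_congr_fun hGm ?_
  intro ω hω
  simp only [hKn, Kernel.coe_mk]
  rw [heq _ hω]

lemma setIntegral_sq_le (h : CondIID mΩ₀ P Z G κ Y) (hN : 1 ≤ N) {a : Ω₀ × E → ℝ} (ha : Measurable a)
    {K : ℝ} (hK : ∀ z ∈ G, ∀ y, |a (z, y)| ≤ K) {μ : Ω₀ → ℝ} (hμ : Measurable μ)
    (hmean : ∀ z ∈ G, μ z = ∫ y, a (z, y) ∂(κ z)) :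
    ∫ ω in Z ⁻¹' G, ((N : ℝ)⁻¹ * ∑ i, a (Z ω, Y i ω) - μ (Z ω)) ^ 2 ∂P ≤ K ^ 2 / N := by
  have hN0 : (0 : ℝ) < N := by exact_mod_cast hN
  have hμK : ∀ z ∈ G, |μ z| ≤ K := by
    intro z hz
    have := h.isProbabilityMeasure_kernel z hz
    rw [hmean z hz]
    have := norm_integral_le_of_norm_le_const (μ := κ z) (f := fun y => a (z, y)) (C := K)
      (ae_of_all _ fun y => hK z hz y)
    simpa using this
  have hmψ : Measurable (fun q : Ω₀ × (Fin N → E) =>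
      ((N : ℝ)⁻¹ * ∑ i, a (q.1, q.2 i) - μ q.1) ^ 2) := by
    refine (Measurable.sub ?_ (hμ.comp measurable_fst)).pow_const 2
    refine (Finset.measurable_sum _ fun i _ => ?_).const_mul _
    exact ha.comp (measurable_fst.prodMk ((measurable_pi_apply i).comp measurable_snd))
  have hb : ∀ z ∈ G, ∀ y : Fin N → E,
      ‖((N : ℝ)⁻¹ * ∑ i, a (z, y i) - μ z) ^ 2‖ ≤ (2 * K) ^ 2 := by
    intro z hz y
    have h1 : |(N : ℝ)⁻¹ * ∑ i, a (z, y i)| ≤ K := by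
      rw [abs_mul, abs_of_pos (inv_pos.2 hN0), inv_mul_le_iff₀ hN0]
      calc |∑ i, a (z, y i)| ≤ ∑ i, |a (z, y i)| := Finset.abs_sum_le_sum_abs _ _
        _ ≤ ∑ _i : Fin N, K := Finset.sum_le_sum fun i _ => hK z hz _
        _ = N * K := by simp
    rw [Real.norm_eq_abs, abs_pow]
    have := abs_sub (((N : ℝ)⁻¹ * ∑ i, a (z, y i))) (μ z)
    have h2 := hμK z hz
    gcongr
    linarith
  rw [h.setIntegral_eq (ψ := fun q => ((N : ℝ)⁻¹ * ∑ i, a (q.1, q.2 i) - μ q.1) ^ 2)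
    hmψ.stronglyMeasurable hb]
  have hinner : ∀ z ∈ G, ∫ y, ((N : ℝ)⁻¹ * ∑ i, a (z, y i) - μ z) ^ 2
      ∂(Measure.pi (fun _ : Fin N => κ z)) ≤ K ^ 2 / N := by
    intro z hz
    have := h.isProbabilityMeasure_kernel z hz
    have haz : Measurable (fun y => a (z, y)) := ha.comp measurable_prodMk_left
    have hLp : MemLp (fun y => (N : ℝ)⁻¹ * a (z, y)) 2 (κ z) := by
      refine MemLp.of_bound (haz.const_mul _).aestronglyMeasurable ((N : ℝ)⁻¹ * K)
        (ae_of_all _ fun y => ?_)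
      rw [norm_mul, Real.norm_eq_abs, Real.norm_eq_abs, abs_of_pos (inv_pos.2 hN0)]
      gcongr
      exact hK z hz y
    have hv := variance_sum_pi (ι := Fin N) (μ := fun _ => κ z)
      (X := fun _ y => (N : ℝ)⁻¹ * a (z, y)) (fun _ => hLp)
    have hint : ∀ i : Fin N, Integrable (fun y : Fin N → E => (N : ℝ)⁻¹ * a (z, y i))
        (Measure.pi (fun _ : Fin N => κ z)) := fun i =>
      integrable_comp_eval (μ := fun _ : Fin N => κ z) (i := i)
        (f := fun y => (N : ℝ)⁻¹ * a (z, y)) (hLp.integrable (by norm_num))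
    have hE : ∫ y, (∑ i : Fin N, fun y : Fin N → E => (N : ℝ)⁻¹ * a (z, y i)) y
        ∂(Measure.pi (fun _ : Fin N => κ z)) = μ z := by
      simp only [Finset.sum_apply]
      rw [integral_finsetSum _ fun i _ => hint i]
      have : ∀ i : Fin N, ∫ y, (N : ℝ)⁻¹ * a (z, y i) ∂(Measure.pi (fun _ : Fin N => κ z)) =
          (N : ℝ)⁻¹ * μ z := by
        intro i
        rw [integral_const_mul, hmean z hz]
        congr 1
        exact integral_comp_eval (μ := fun _ : Fin N => κ z) (i := i) (f := fun y => a (z, y))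
          haz.aestronglyMeasurable
      simp only [this, Finset.sum_const, Finset.card_univ, Fintype.card_fin, nsmul_eq_mul]
      field_simp
    rw [variance_eq_integral (by
      refine Finset.aemeasurable_sum _ fun i _ => Measurable.aemeasurable ?_
      exact (haz.comp (measurable_pi_apply i)).const_mul _), hE] at hv
    calc ∫ y, ((N : ℝ)⁻¹ * ∑ i, a (z, y i) - μ z) ^ 2 ∂(Measure.pi (fun _ : Fin N => κ z))
        = ∑ i : Fin N, Var[fun y => (N : ℝ)⁻¹ * a (z, y); κ z] := by
          rw [← hv]
          simp only [Finset.sum_apply, Finset.mul_sum]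
      _ ≤ ∑ i : Fin N, (N : ℝ)⁻¹ ^ 2 * K ^ 2 := by
          refine Finset.sum_le_sum fun i _ => ?_
          rw [variance_const_mul]
          gcongr
          refine (variance_le_expectation_sq haz.aestronglyMeasurable).trans ?_
          have := integral_mono_of_nonneg (μ := κ z) (f := fun y => a (z, y) ^ 2)
            (g := fun _ => K ^ 2) (ae_of_all _ fun y => sq_nonneg _) (integrable_const _)
            (ae_of_all _ fun y => by
              have := hK z hz y
              exact sq_le_sq.2 (this.trans (le_abs_self K)))
          simpa using this
      _ = K ^ 2 / N := by
          simp only [Finset.sum_const, Finset.card_univ, Fintype.card_fin, nsmul_eq_mul]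
          field_simp
  calc ∫ ω in Z ⁻¹' G, ∫ y, ((N : ℝ)⁻¹ * ∑ i, a (Z ω, y i) - μ (Z ω)) ^ 2
        ∂(Measure.pi (fun _ : Fin N => κ (Z ω))) ∂P
      ≤ ∫ ω in Z ⁻¹' G, K ^ 2 / N ∂P := by
        refine integral_mono_of_nonneg (ae_of_all _ fun ω => integral_nonneg fun y => sq_nonneg _)
          (integrable_const _) ?_
        filter_upwards [ae_restrict_mem (h.measurable_past h.measurableSet_good)] with ω hω
        exact hinner _ hω
    _ ≤ K ^ 2 / N := by
        rw [setIntegral_const, smul_eq_mul]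
        exact mul_le_of_le_one_left (by positivity) measureReal_le_one

end CondIID

/-- Second order expansion of the characteristic function of a bounded random variable. -/
lemma norm_integral_exp_sub_le {ρ : Measure E} [IsProbabilityMeasure ρ] {a : E → ℝ}
    (ha : Measurable a) {K : ℝ} (hK : ∀ y, |a y| ≤ K) {s : ℝ} (hs : 2 * K * |s| ≤ 1) :
    ‖∫ y, Complex.exp (((s * a y : ℝ) : ℂ) * Complex.I) ∂ρ -
      Complex.exp (((s * ∫ y, a y ∂ρ : ℝ) : ℂ) * Complex.I) *
        ((Real.exp (-(s ^ 2 * (∫ y, a y ^ 2 ∂ρ - (∫ y, a y ∂ρ) ^ 2) / 2)) : ℝ) : ℂ)‖ ≤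
      2 * (2 * K * |s|) ^ 3 := by
  obtain ⟨y₀⟩ := nonempty_of_isProbabilityMeasure ρ
  have hK0 : 0 ≤ K := (abs_nonneg _).trans (hK y₀)
  set μ := ∫ y, a y ∂ρ with hμ
  set V := ∫ y, a y ^ 2 ∂ρ - μ ^ 2 with hV
  have hai : Integrable a ρ := Integrable.of_bound ha.aestronglyMeasurable K (ae_of_all _ hK)
  have ha2 : ∀ y, a y ^ 2 ≤ K ^ 2 := fun y => by rw [← sq_abs]; have := hK y; gcongr
  have hai2 : Integrable (fun y => a y ^ 2) ρ :=
    Integrable.of_bound (ha.pow_const 2).aestronglyMeasurable (K ^ 2) (ae_of_all _ fun y => by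
      rw [Real.norm_eq_abs, abs_of_nonneg (sq_nonneg _)]; exact ha2 y)
  have hμK : |μ| ≤ K := by
    have := norm_integral_le_of_norm_le_const (μ := ρ) (f := a) (C := K) (ae_of_all _ hK)
    simpa using this
  have hVeq : V = ∫ y, (a y - μ) ^ 2 ∂ρ := by
    have : ∀ y, (a y - μ) ^ 2 = a y ^ 2 - 2 * μ * a y + μ ^ 2 := fun y => by ring
    simp_rw [this]
    rw [integral_add (f := fun y => a y ^ 2 - 2 * μ * a y) (hai2.sub (hai.const_mul _))
        (integrable_const _),
      integral_sub hai2 (hai.const_mul _), integral_const_mul]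
    simp only [integral_const, probReal_univ, smul_eq_mul, ← hμ, hV]
    ring
  have hV0 : 0 ≤ V := hVeq ▸ integral_nonneg fun y => sq_nonneg _
  have hVK : V ≤ K ^ 2 := by
    have h1 : ∫ y, a y ^ 2 ∂ρ ≤ K ^ 2 := by
      have := integral_mono hai2 (integrable_const (K ^ 2)) ha2
      simpa using this
    have := sq_nonneg μ
    linarith
  set d := 2 * K * |s| with hd
  have hd0 : 0 ≤ d := by positivity
  have hxd : ∀ y, |s * (a y - μ)| ≤ d := by
    intro y
    rw [abs_mul, hd]
    have := abs_sub (a y) μ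
    have h1 := hK y
    calc |s| * |a y - μ| ≤ |s| * (2 * K) := by gcongr; linarith
      _ = 2 * K * |s| := by ring
  have hfac : ∫ y, Complex.exp (((s * a y : ℝ) : ℂ) * Complex.I) ∂ρ =
      Complex.exp (((s * μ : ℝ) : ℂ) * Complex.I) *
        ∫ y, Complex.exp (((s * (a y - μ) : ℝ) : ℂ) * Complex.I) ∂ρ := by
    rw [← integral_const_mul]
    congr 1 with y
    rw [← Complex.exp_add]
    congr 1
    push_cast; ring
  have hmeas : Measurable (fun y => Complex.exp (((s * (a y - μ) : ℝ) : ℂ) * Complex.I)) :=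
    Complex.measurable_exp.comp ((Complex.measurable_ofReal.comp
      ((ha.sub_const μ).const_mul s)).mul_const _)
  have hexpi : Integrable (fun y => Complex.exp (((s * (a y - μ) : ℝ) : ℂ) * Complex.I)) ρ :=
    Integrable.of_bound hmeas.aestronglyMeasurable 1 (ae_of_all _ fun y => by
      rw [Complex.norm_exp_ofReal_mul_I])
  set q : E → ℂ := fun y => 1 + ((s * (a y - μ) : ℝ) : ℂ) * Complex.I -
    (((s * (a y - μ)) ^ 2 / 2 : ℝ) : ℂ) with hq
  have hi1 : Integrable (fun y => (((s * (a y - μ) : ℝ) : ℂ) * Complex.I)) ρ :=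
    (((hai.sub (integrable_const μ)).const_mul s).ofReal).mul_const _
  have hi2' : Integrable (fun y => (s * (a y - μ)) ^ 2 / 2) ρ :=
    Integrable.of_bound (((ha.sub_const μ).const_mul s).pow_const 2 |>.div_const 2
      ).aestronglyMeasurable (d ^ 2) (ae_of_all _ fun y => by
        rw [Real.norm_eq_abs, abs_of_nonneg (by positivity), ← sq_abs]
        have := hxd y
        have h2 : |s * (a y - μ)| ^ 2 ≤ d ^ 2 := by gcongr
        have h3 := sq_nonneg (|s * (a y - μ)|)
        linarith)
  have hi2 : Integrable (fun y => (((s * (a y - μ)) ^ 2 / 2 : ℝ) : ℂ)) ρ := hi2'.ofReal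
  have hqi : Integrable q ρ := ((integrable_const _).add hi1).sub hi2
  have hqint : ∫ y, q y ∂ρ = ((1 - s ^ 2 * V / 2 : ℝ) : ℂ) := by
    simp only [hq]
    rw [integral_sub (f := fun y => 1 + ((s * (a y - μ) : ℝ) : ℂ) * Complex.I)
        ((integrable_const _).add hi1) hi2,
      integral_add (integrable_const _) hi1, integral_mul_const,
      integral_complex_ofReal, integral_complex_ofReal]
    have e1 : ∫ y, s * (a y - μ) ∂ρ = 0 := by
      rw [integral_const_mul, integral_sub hai (integrable_const _)]
      simp [← hμ]
    have e2 : ∫ y, (s * (a y - μ)) ^ 2 / 2 ∂ρ = s ^ 2 * V / 2 := by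
      rw [hVeq, integral_div]
      simp_rw [mul_pow]
      rw [integral_const_mul]
    rw [e1, e2]
    simp
  have hb1 : ‖∫ y, Complex.exp (((s * (a y - μ) : ℝ) : ℂ) * Complex.I) ∂ρ - ∫ y, q y ∂ρ‖ ≤
      d ^ 3 := by
    rw [← integral_sub hexpi hqi]
    have := norm_integral_le_of_norm_le_const (μ := ρ) (C := d ^ 3)
      (f := fun y => Complex.exp (((s * (a y - μ) : ℝ) : ℂ) * Complex.I) - q y)
      (ae_of_all _ fun y => by
        set x : ℂ := ((s * (a y - μ) : ℝ) : ℂ) * Complex.I with hx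
        have hxn : ‖x‖ ≤ d := by
          rw [hx, norm_mul, Complex.norm_I, mul_one, Complex.norm_real]
          exact hxd y
        have hb := Complex.exp_bound (x := x) (hxn.trans hs) (n := 3) (by norm_num)
        have hsum : ∑ m ∈ Finset.range 3, x ^ m / (m.factorial : ℂ) = q y := by
          simp only [hq, Finset.sum_range_succ, Finset.sum_range_zero]
          simp only [Nat.factorial]
          have hx2 : x ^ 2 = -(((s * (a y - μ)) ^ 2 : ℝ) : ℂ) := by
            rw [hx, mul_pow, Complex.I_sq]; push_cast; ring
          rw [hx2]
          push_cast
          rw [hx]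
          push_cast
          ring
        rw [hsum] at hb
        refine hb.trans ?_
        have h1 : ‖x‖ ^ 3 ≤ d ^ 3 := by gcongr
        have h2 : ((Nat.succ 3 : ℕ) : ℝ) * (((3 : ℕ).factorial : ℝ) * ((3 : ℕ) : ℝ))⁻¹ ≤ 1 := by
          norm_num [Nat.factorial]
        calc ‖x‖ ^ 3 * _ ≤ ‖x‖ ^ 3 * 1 := by gcongr
          _ ≤ d ^ 3 := by rw [mul_one]; exact h1)
    simpa using this
  have hb2 : ‖((1 - s ^ 2 * V / 2 : ℝ) : ℂ) - ((Real.exp (-(s ^ 2 * V / 2)) : ℝ) : ℂ)‖ ≤ d ^ 3 := by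
    rw [← Complex.ofReal_sub, Complex.norm_real, Real.norm_eq_abs]
    have hb0 : 0 ≤ s ^ 2 * V / 2 := by positivity
    have hbd : s ^ 2 * V / 2 ≤ d ^ 2 := by
      have : d ^ 2 = 4 * K ^ 2 * s ^ 2 := by rw [hd, mul_pow, mul_pow, sq_abs]; ring
      rw [this]
      have h1 : s ^ 2 * V ≤ s ^ 2 * K ^ 2 := by gcongr
      nlinarith [mul_nonneg (sq_nonneg s) (sq_nonneg K)]
    have hd1 : d ^ 2 ≤ 1 := pow_le_one₀ hd0 hs
    have := Real.abs_exp_sub_one_sub_id_le (x := -(s ^ 2 * V / 2)) (by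
      rw [abs_neg, abs_of_nonneg hb0]; linarith)
    rw [abs_sub_comm]
    have e : Real.exp (-(s ^ 2 * V / 2)) - (1 - s ^ 2 * V / 2) =
      Real.exp (-(s ^ 2 * V / 2)) - 1 - -(s ^ 2 * V / 2) := by ring
    rw [e]
    refine this.trans ?_
    calc (-(s ^ 2 * V / 2)) ^ 2 = (s ^ 2 * V / 2) * (s ^ 2 * V / 2) := by ring
      _ ≤ d ^ 2 * d ^ 2 := by gcongr
      _ = d ^ 3 * d := by ring
      _ ≤ d ^ 3 * 1 := by gcongr
      _ = d ^ 3 := mul_one _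
  rw [hfac, ← mul_sub, norm_mul, Complex.norm_exp_ofReal_mul_I, one_mul]
  rw [hqint] at hb1
  refine (norm_sub_le_norm_sub_add_norm_sub _ ((1 - s ^ 2 * V / 2 : ℝ) : ℂ) _).trans ?_
  linarith

lemma norm_pow_sub_pow_le_mul {z w : ℂ} (hz : ‖z‖ ≤ 1) (hw : ‖w‖ ≤ 1) (n : ℕ) :
    ‖z ^ n - w ^ n‖ ≤ n * ‖z - w‖ := by
  induction n with
  | zero => simp
  | succ n ih =>
    have : z ^ (n + 1) - w ^ (n + 1) = z * (z ^ n - w ^ n) + (z - w) * w ^ n := by ring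
    rw [this]
    refine (norm_add_le _ _).trans ?_
    rw [norm_mul, norm_mul, norm_pow]
    have h1 : ‖z‖ * ‖z ^ n - w ^ n‖ ≤ 1 * (n * ‖z - w‖) := by gcongr
    have h2 : ‖z - w‖ * ‖w‖ ^ n ≤ ‖z - w‖ * 1 := by
      gcongr
      exact pow_le_one₀ (norm_nonneg _) hw
    push_cast
    linarith

/-- Conditional Gaussian approximation of the characteristic function of a normalised sum of
bounded conditionally i.i.d. variables. -/
lemma CondIID.norm_setIntegral_exp_sub_le [IsProbabilityMeasure P] (h : CondIID mΩ₀ P Z G κ Y)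
    (hN : 1 ≤ N) {a : Ω₀ × E → ℝ} (ha : Measurable a)
    {K : ℝ} (hK0 : 0 ≤ K) (hK : ∀ z ∈ G, ∀ y, |a (z, y)| ≤ K) {μ s : Ω₀ → ℝ} (hμ : Measurable μ)
    (hs : Measurable s) (hmean : ∀ z ∈ G, μ z = ∫ y, a (z, y) ∂(κ z))
    (hsq : ∀ z ∈ G, s z = ∫ y, a (z, y) ^ 2 ∂(κ z)) {u : ℝ} (hu : 2 * K * |u| ≤ √N) :
    ‖∫ ω in Z ⁻¹' G, (Complex.exp (((u * (√N * ((N : ℝ)⁻¹ * ∑ i, a (Z ω, Y i ω))) : ℝ) : ℂ) *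
          Complex.I) -
        Complex.exp (((u * (√N * μ (Z ω)) : ℝ) : ℂ) * Complex.I) *
          ((Real.exp (-(u ^ 2 * (s (Z ω) - μ (Z ω) ^ 2) / 2)) : ℝ) : ℂ)) ∂P‖ ≤
      2 * (2 * K * |u|) ^ 3 / √N := by
  have hN0 : (0 : ℝ) < N := by exact_mod_cast hN
  have hsN : 0 < √(N : ℝ) := Real.sqrt_pos.2 hN0
  have hsqN : √(N : ℝ) ^ 2 = N := Real.sq_sqrt hN0.le
  set r : Ω₀ → ℂ := fun z => Complex.exp (((u * (√N * μ z) : ℝ) : ℂ) * Complex.I) *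
          ((Real.exp (-(u ^ 2 * (s z - μ z ^ 2) / 2)) : ℝ) : ℂ) with hr
  have hrm : Measurable r := by fun_prop
  have hVnn : ∀ z ∈ G, 0 ≤ s z - μ z ^ 2 := by
    intro z hz
    have := h.isProbabilityMeasure_kernel z hz
    have haz : Measurable (fun y => a (z, y)) := ha.comp measurable_prodMk_left
    rw [hsq z hz, hmean z hz]
    exact sub_nonneg.2 (sq_integral_le_integral_sq haz (hK z hz))
  set e : Ω₀ × (Fin N → E) → ℂ := fun q =>
    Complex.exp (((u * (√N * ((N : ℝ)⁻¹ * ∑ i, a (q.1, q.2 i))) : ℝ) : ℂ) * Complex.I) with he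
  have hem : Measurable e := by
    have : Measurable (fun q : Ω₀ × (Fin N → E) => ∑ i, a (q.1, q.2 i)) :=
      Finset.measurable_sum _ fun i _ =>
        ha.comp (measurable_fst.prodMk ((measurable_pi_apply i).comp measurable_snd))
    fun_prop
  have hr1 : ∀ z ∈ G, ‖r z‖ ≤ 1 := by
    intro z hz
    rw [hr, norm_mul, Complex.norm_exp_ofReal_mul_I, one_mul, Complex.norm_real,
      Real.norm_eq_abs, Real.abs_exp, Real.exp_le_one_iff]
    have := hVnn z hz
    have : 0 ≤ u ^ 2 * (s z - μ z ^ 2) / 2 := by positivity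
    linarith
  have hb : ∀ z ∈ G, ∀ y, ‖(fun q => e q - r q.1) (z, y)‖ ≤ 2 := by
    intro z hz y
    refine (norm_sub_le _ _).trans ?_
    have h1 : ‖e (z, y)‖ = 1 := Complex.norm_exp_ofReal_mul_I _
    have := hr1 z hz
    simp only
    linarith
  have hmain := h.setIntegral_eq (ψ := fun q => e q - r q.1)
    (hem.sub (hrm.comp measurable_fst)).stronglyMeasurable hb
  change ‖∫ ω in Z ⁻¹' G, (fun q => e q - r q.1) (Z ω, fun i => Y i ω) ∂P‖ ≤ _
  rw [hmain]
  have hinner : ∀ z ∈ G, ‖∫ y, (e (z, y) - r z) ∂(Measure.pi (fun _ : Fin N => κ z))‖ ≤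
      2 * (2 * K * |u|) ^ 3 / √N := by
    intro z hz
    have := h.isProbabilityMeasure_kernel z hz
    have haz : Measurable (fun y => a (z, y)) := ha.comp measurable_prodMk_left
    set σ : ℝ := u / √N with hσ
    have hσs : |σ| = |u| / √N := by rw [hσ, abs_div, abs_of_pos hsN]
    set b : E → ℂ := fun y => Complex.exp (((σ * a (z, y) : ℝ) : ℂ) * Complex.I) with hbdef
    have hez : ∀ y : Fin N → E, e (z, y) = ∏ i, b (y i) := by
      intro y
      simp only [he, hbdef]
      rw [← Complex.exp_sum]
      congr 1
      rw [← Finset.sum_mul, ← Complex.ofReal_sum, ← Finset.mul_sum]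
      congr 2
      rw [hσ]
      field_simp
      rw [hsqN]
    have hei : Integrable (fun y => e (z, y)) (Measure.pi (fun _ : Fin N => κ z)) :=
      Integrable.of_bound (hem.comp measurable_prodMk_left).aestronglyMeasurable 1
        (ae_of_all _ fun y => (Complex.norm_exp_ofReal_mul_I _).le)
    set w : ℂ := Complex.exp (((σ * μ z : ℝ) : ℂ) * Complex.I) *
        ((Real.exp (-(σ ^ 2 * (s z - μ z ^ 2) / 2)) : ℝ) : ℂ) with hw
    have hwN : w ^ N = r z := by
      rw [hw, mul_pow, ← Complex.exp_nat_mul, hr, ← Complex.ofReal_pow, ← Real.exp_nat_mul]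
      have e1 : (N : ℂ) * (((σ * μ z : ℝ) : ℂ) * Complex.I) =
          ((u * (√N * μ z) : ℝ) : ℂ) * Complex.I := by
        rw [← mul_assoc]
        congr 1
        rw [← Complex.ofReal_natCast, ← Complex.ofReal_mul]
        congr 1
        rw [hσ]
        field_simp
        rw [hsqN]
        ring
      have e2 : (N : ℝ) * (-(σ ^ 2 * (s z - μ z ^ 2) / 2)) =
          -(u ^ 2 * (s z - μ z ^ 2) / 2) := by
        rw [hσ, div_pow, hsqN]
        field_simp
      rw [e1, e2]
    have hw1 : ‖w‖ ≤ 1 := by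
      rw [hw, norm_mul, Complex.norm_exp_ofReal_mul_I, one_mul, Complex.norm_real,
        Real.norm_eq_abs, Real.abs_exp, Real.exp_le_one_iff]
      have := hVnn z hz
      have : 0 ≤ σ ^ 2 * (s z - μ z ^ 2) / 2 := by positivity
      linarith
    have hz1 : ‖∫ y, b y ∂(κ z)‖ ≤ 1 := by
      have := norm_integral_le_of_norm_le_const (μ := κ z) (f := b) (C := 1)
        (ae_of_all _ fun y => (Complex.norm_exp_ofReal_mul_I _).le)
      simpa using this
    have hexp := norm_integral_exp_sub_le (ρ := κ z) haz (hK z hz) (s := σ) (by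
      rw [hσs, ← mul_div_assoc]
      exact (div_le_one hsN).2 hu)
    rw [← hmean z hz, ← hsq z hz] at hexp
    have hint : ∫ y, (e (z, y) - r z) ∂(Measure.pi (fun _ : Fin N => κ z)) =
        (∫ y, b y ∂(κ z)) ^ N - w ^ N := by
      rw [integral_sub hei (integrable_const _)]
      simp_rw [hez]
      rw [integral_fintype_prod_eq_pow, hwN]
      simp
    rw [hint]
    refine (norm_pow_sub_pow_le_mul hz1 hw1 N).trans ?_
    calc (N : ℝ) * ‖∫ y, b y ∂(κ z) - w‖ ≤ N * (2 * (2 * K * |σ|) ^ 3) := by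
          gcongr
      _ = 2 * (2 * K * |u|) ^ 3 / √N := by
          rw [hσs]
          have : (2 * K * (|u| / √(N : ℝ))) ^ 3 = (2 * K * |u|) ^ 3 / (√N ^ 2 * √N) := by
            field_simp
          rw [this, hsqN]
          field_simp
  have := norm_integral_le_of_norm_le_const (μ := P.restrict (Z ⁻¹' G))
    (C := 2 * (2 * K * |u|) ^ 3 / √N)
    (f := fun ω => ∫ y, (e (Z ω, y) - r (Z ω)) ∂(Measure.pi (fun _ : Fin N => κ (Z ω)))) (by
      filter_upwards [ae_restrict_mem (h.measurable_past h.measurableSet_good)] with ω hω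
      exact hinner _ hω)
  refine this.trans (mul_le_of_le_one_right (by positivity) ?_)
  rw [measureReal_restrict_apply_univ]
  exact measureReal_le_one

end CondIID

section Sequences

open scoped Topology ENNReal

variable {Ω : Type*} [MeasurableSpace Ω] {P : Measure Ω} [IsProbabilityMeasure P]

lemma tendsto_inProb_zero_of_setIntegral_sq_le {D : ℕ × Ω → ℝ} {G : ℕ → Set Ω} {b c : ℝ}
    (hG : ∀ᶠ q in inProb P, q.2 ∈ G q.1) (hGm : ∀ N, MeasurableSet (G N))
    (hm : ∀ N, Measurable fun ω => D (N, ω)) (hb : ∀ N, ∀ ω ∈ G N, |D (N, ω)| ≤ b)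
    (h : ∀ N : ℕ, 1 ≤ N → ∫ ω in G N, D (N, ω) ^ 2 ∂P ≤ c / N) :
    Tendsto D (inProb P) (𝓝 0) := by
  have h2 : Tendsto (fun q => D q ^ 2) (inProb P) (𝓝 0) := by
    refine tendsto_inProb_of_tendsto_lintegral hG ?_ fun N => (hm N).pow_const 2
    have hlim : Tendsto (fun N : ℕ => ENNReal.ofReal (c / N)) atTop (𝓝 0) := by
      have := ENNReal.tendsto_ofReal (tendsto_const_div_atTop_nhds_zero_nat c)
      simpa using this
    refine tendsto_of_tendsto_of_tendsto_of_le_of_le' tendsto_const_nhds hlim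
      (Eventually.of_forall fun _ => zero_le) ?_
    filter_upwards [eventually_ge_atTop 1] with N hN
    have hint : Integrable (fun ω => D (N, ω) ^ 2) (P.restrict (G N)) := by
      refine Integrable.of_bound ((hm N).pow_const 2).aestronglyMeasurable (b ^ 2) ?_
      filter_upwards [ae_restrict_mem (hGm N)] with ω hω
      rw [Real.norm_eq_abs, abs_pow]
      have := hb N ω hω
      gcongr
    calc ∫⁻ ω in G N, ENNReal.ofReal |D (N, ω) ^ 2 - 0| ∂P
        = ∫⁻ ω in G N, ENNReal.ofReal (D (N, ω) ^ 2) ∂P := by simp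
      _ = ENNReal.ofReal (∫ ω in G N, D (N, ω) ^ 2 ∂P) :=
          (ofReal_integral_eq_lintegral_ofReal hint (ae_of_all _ fun _ => sq_nonneg _)).symm
      _ ≤ ENNReal.ofReal (c / N) := ENNReal.ofReal_le_ofReal (h N hN)
  have h3 := h2.sqrt
  simp only [Real.sqrt_sq_eq_abs, Real.sqrt_zero] at h3
  exact (tendsto_zero_iff_abs_tendsto_zero _).2 h3

/-- Propagation of a Gaussian factor through one conditionally i.i.d. sampling step. -/
lemma tendsto_integral_exp_of_step {R X V : ℕ × Ω → ℝ} {G : ℕ → Set Ω} {u v : ℝ} {l : ℂ}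
    (hG : ∀ᶠ q in inProb P, q.2 ∈ G q.1) (hGm : ∀ N, MeasurableSet (G N))
    (hR : ∀ N, Measurable fun ω => R (N, ω)) (hX : ∀ N, Measurable fun ω => X (N, ω))
    (hV : ∀ N, Measurable fun ω => V (N, ω)) (hVnn : ∀ N, ∀ ω ∈ G N, 0 ≤ V (N, ω))
    (hVlim : Tendsto V (inProb P) (𝓝 v)) {ε : ℕ → ℝ} (hε : Tendsto ε atTop (𝓝 0))
    (hstep : ∀ᶠ N in atTop, ‖∫ ω in G N, (Complex.exp (((u * R (N, ω) : ℝ) : ℂ) * Complex.I) -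
        Complex.exp (((u * X (N, ω) : ℝ) : ℂ) * Complex.I) *
          ((Real.exp (-(u ^ 2 * V (N, ω) / 2)) : ℝ) : ℂ)) ∂P‖ ≤ ε N)
    (hl : Tendsto (fun N => ∫ ω, Complex.exp (((u * X (N, ω) : ℝ) : ℂ) * Complex.I) ∂P) atTop
      (𝓝 l)) :
    Tendsto (fun N => ∫ ω, Complex.exp (((u * R (N, ω) : ℝ) : ℂ) * Complex.I) ∂P) atTop
      (𝓝 (l * ((Real.exp (-(u ^ 2 * v / 2)) : ℝ) : ℂ))) := by
  classical
  set c : ℝ := Real.exp (-(u ^ 2 * v / 2)) with hc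
  set W : ℕ × Ω → ℝ := fun q => if q.2 ∈ G q.1 then Real.exp (-(u ^ 2 * V q / 2)) else c with hW
  have hWm : ∀ N, Measurable fun ω => W (N, ω) := fun N =>
    Measurable.ite (hGm N) (((((hV N).const_mul _).div_const _).neg).exp) measurable_const
  have hWlim : Tendsto W (inProb P) (𝓝 c) := by
    have h1 : Tendsto (fun q => Real.exp (-(u ^ 2 * V q / 2))) (inProb P) (𝓝 c) :=
      (Real.continuous_exp.tendsto _).comp (((hVlim.const_mul _).div_const _).neg)
    refine h1.congr' ?_
    filter_upwards [hG] with q hq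
    simp only [hW, hq, if_true]
  have hW1 : ∀ N ω, |W (N, ω) - c| ≤ 1 + c := by
    intro N ω
    have hc0 : 0 < c := Real.exp_pos _
    by_cases hω : ω ∈ G N
    · have h0 : 0 ≤ u ^ 2 * V (N, ω) / 2 := by have := hVnn N ω hω; positivity
      have h1 : Real.exp (-(u ^ 2 * V (N, ω) / 2)) ≤ 1 := Real.exp_le_one_iff.2 (by linarith)
      have h2 := Real.exp_pos (-(u ^ 2 * V (N, ω) / 2))
      simp only [hW, hω, if_true]
      rw [abs_le]
      constructor <;> linarith
    · simp only [hW, hω, if_false, sub_self, abs_zero]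
      positivity
  have hW0 := tendsto_lintegral_of_tendsto_inProb hWlim hWm hW1
  have hWint : ∀ N, Integrable (fun ω => W (N, ω) - c) P := fun N =>
    Integrable.of_bound ((hWm N).sub_const c).aestronglyMeasurable (1 + c) (ae_of_all _ (hW1 N))
  have hWr : Tendsto (fun N => ∫ ω, |W (N, ω) - c| ∂P) atTop (𝓝 0) := by
    have := (ENNReal.tendsto_toReal ENNReal.zero_ne_top).comp hW0
    refine this.congr fun N => ?_
    rw [Function.comp_apply, ← ofReal_integral_eq_lintegral_ofReal (hWint N).abs
      (ae_of_all _ fun _ => abs_nonneg _), ENNReal.toReal_ofReal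
      (integral_nonneg fun _ => abs_nonneg _)]
  have hGc : Tendsto (fun N => P.real (G N)ᶜ) atTop (𝓝 0) := by
    have := (ENNReal.tendsto_toReal ENNReal.zero_ne_top).comp (eventually_inProb.1 hG)
    exact this
  set eR : ℕ → Ω → ℂ := fun N ω => Complex.exp (((u * R (N, ω) : ℝ) : ℂ) * Complex.I) with heR
  set eX : ℕ → Ω → ℂ := fun N ω => Complex.exp (((u * X (N, ω) : ℝ) : ℂ) * Complex.I) with heX
  have heRm : ∀ N, Measurable (eR N) := fun N =>
    Complex.measurable_exp.comp ((Complex.measurable_ofReal.comp ((hR N).const_mul u)).mul_const _)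
  have heXm : ∀ N, Measurable (eX N) := fun N =>
    Complex.measurable_exp.comp ((Complex.measurable_ofReal.comp ((hX N).const_mul u)).mul_const _)
  have heRi : ∀ N, Integrable (eR N) P := fun N =>
    Integrable.of_bound (heRm N).aestronglyMeasurable 1
      (ae_of_all _ fun ω => (Complex.norm_exp_ofReal_mul_I _).le)
  have heXi : ∀ N, Integrable (eX N) P := fun N =>
    Integrable.of_bound (heXm N).aestronglyMeasurable 1
      (ae_of_all _ fun ω => (Complex.norm_exp_ofReal_mul_I _).le)
  have heXW : ∀ N, Integrable (fun ω => eX N ω * ((W (N, ω) - c : ℝ) : ℂ)) P := fun N =>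
    Integrable.of_bound ((heXm N).mul (Complex.measurable_ofReal.comp
      ((hWm N).sub_const c))).aestronglyMeasurable (1 + c) (ae_of_all _ fun ω => by
        rw [norm_mul, Complex.norm_exp_ofReal_mul_I, one_mul, Complex.norm_real]
        exact hW1 N ω)
  have hdiff : Tendsto (fun N => ∫ ω, eR N ω ∂P - (∫ ω, eX N ω ∂P) * (c : ℂ)) atTop (𝓝 0) := by
    have hbound : Tendsto (fun N => ε N + (1 + c) * P.real (G N)ᶜ + ∫ ω, |W (N, ω) - c| ∂P)
        atTop (𝓝 0) := by
      have := (hε.add (hGc.const_mul (1 + c))).add hWr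
      simpa using this
    refine squeeze_zero_norm' ?_ hbound
    filter_upwards [hstep] with N hN
    have hi1 : Integrable (fun ω => eR N ω - eX N ω * (W (N, ω) : ℂ)) P := by
      have : (fun ω => eR N ω - eX N ω * (W (N, ω) : ℂ)) =
          fun ω => eR N ω - (eX N ω * ((W (N, ω) - c : ℝ) : ℂ) + eX N ω * (c : ℂ)) := by
        ext ω; push_cast; ring
      rw [this]
      exact (heRi N).sub ((heXW N).add ((heXi N).mul_const _))
    have hsplit : ∫ ω, eR N ω ∂P - (∫ ω, eX N ω ∂P) * (c : ℂ) =
        ∫ ω, (eR N ω - eX N ω * (W (N, ω) : ℂ)) ∂P +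
          ∫ ω, eX N ω * ((W (N, ω) - c : ℝ) : ℂ) ∂P := by
      rw [← integral_add hi1 (heXW N), ← integral_mul_const,
        ← integral_sub (heRi N) ((heXi N).mul_const _)]
      congr 1 with ω
      push_cast; ring
    have h1 : ‖∫ ω in G N, (eR N ω - eX N ω * (W (N, ω) : ℂ)) ∂P‖ ≤ ε N := by
      rw [setIntegral_congr_fun (hGm N) (g := fun ω => eR N ω - eX N ω *
        ((Real.exp (-(u ^ 2 * V (N, ω) / 2)) : ℝ) : ℂ))]
      · exact hN
      · intro ω hω
        simp only [hW]
        rw [if_pos (by exact hω)]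
    have h2 : ‖∫ ω in (G N)ᶜ, (eR N ω - eX N ω * (W (N, ω) : ℂ)) ∂P‖ ≤
        (1 + c) * P.real (G N)ᶜ := by
      refine norm_setIntegral_le_of_norm_le_const (measure_lt_top _ _) ?_
      intro ω hω
      refine (norm_sub_le _ _).trans ?_
      rw [norm_mul, Complex.norm_exp_ofReal_mul_I, Complex.norm_exp_ofReal_mul_I, one_mul,
        Complex.norm_real]
      simp only [hW]
      rw [if_neg (by exact hω), Real.norm_eq_abs, abs_of_pos (Real.exp_pos _)]
    have h3 : ‖∫ ω, eX N ω * ((W (N, ω) - c : ℝ) : ℂ) ∂P‖ ≤ ∫ ω, |W (N, ω) - c| ∂P := by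
      refine (norm_integral_le_integral_norm _).trans (le_of_eq ?_)
      congr 1 with ω
      rw [norm_mul, Complex.norm_exp_ofReal_mul_I, one_mul, Complex.norm_real, Real.norm_eq_abs]
    rw [hsplit, ← integral_add_compl (hGm N) hi1]
    refine (norm_add_le _ _).trans ?_
    have := norm_add_le (∫ ω in G N, (eR N ω - eX N ω * (W (N, ω) : ℂ)) ∂P)
      (∫ ω in (G N)ᶜ, (eR N ω - eX N ω * (W (N, ω) : ℂ)) ∂P)
    linarith
  have hsum := hdiff.add (hl.mul_const (c : ℂ))
  rw [zero_add] at hsum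
  exact hsum.congr fun N => by simp only [heX, heR, sub_add_cancel]

end Sequences

/-! ### Markov kernels given by a density -/

section Density

open scoped ENNReal

variable {X : Type*} [MeasurableSpace X] {ν : Measure X} {d : X → X → ℝ}

lemma integrable_density (hd : Measurable (Function.uncurry d)) (h0 : ∀ x x', 0 ≤ d x x')
    (h1 : ∀ x, ∫⁻ x', ENNReal.ofReal (d x x') ∂ν = 1) (x : X) : Integrable (d x) ν := by
  have hdx : Measurable (d x) := hd.comp measurable_prodMk_left
  refine ⟨hdx.aestronglyMeasurable, ?_⟩
  rw [hasFiniteIntegral_iff_ofReal (ae_of_all _ (h0 x)), h1]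
  exact ENNReal.one_lt_top

lemma integral_density (hd : Measurable (Function.uncurry d)) (h0 : ∀ x x', 0 ≤ d x x')
    (h1 : ∀ x, ∫⁻ x', ENNReal.ofReal (d x x') ∂ν = 1) (x : X) : ∫ z, d x z ∂ν = 1 := by
  have hdx : Measurable (d x) := hd.comp measurable_prodMk_left
  rw [integral_eq_lintegral_of_nonneg_ae (ae_of_all _ (h0 x)) hdx.aestronglyMeasurable, h1,
    ENNReal.toReal_one]

variable [SigmaFinite ν]

lemma densityKernel_apply (hd : Measurable (Function.uncurry d)) (x : X) :
    Kernel.withDensity (Kernel.const X ν) (fun x x' => ENNReal.ofReal (d x x')) x =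
      ν.withDensity (fun x' => ENNReal.ofReal (d x x')) := by
  rw [Kernel.withDensity_apply _ (by exact hd.ennreal_ofReal), Kernel.const_apply]

lemma isMarkovKernel_densityKernel (hd : Measurable (Function.uncurry d))
    (h1 : ∀ x, ∫⁻ x', ENNReal.ofReal (d x x') ∂ν = 1) :
    IsMarkovKernel (Kernel.withDensity (Kernel.const X ν)
      (fun x x' => ENNReal.ofReal (d x x'))) :=
  ⟨fun x => ⟨by rw [densityKernel_apply hd, withDensity_apply _ MeasurableSet.univ,
    Measure.restrict_univ, h1]⟩⟩

lemma integral_densityKernel (hd : Measurable (Function.uncurry d)) (h0 : ∀ x x', 0 ≤ d x x')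
    (x : X) (f : X → ℝ) :
    ∫ z, f z ∂(Kernel.withDensity (Kernel.const X ν) (fun x x' => ENNReal.ofReal (d x x')) x) =
      ∫ z, d x z * f z ∂ν := by
  have hdx : Measurable (d x) := hd.comp measurable_prodMk_left
  rw [densityKernel_apply hd, integral_withDensity_eq_integral_toReal_smul hdx.ennreal_ofReal
    (ae_of_all _ fun _ => ENNReal.ofReal_lt_top)]
  simp only [ENNReal.toReal_ofReal (h0 _ _), smul_eq_mul]

lemma integrable_density_mul_prod (hd : Measurable (Function.uncurry d))
    (h0 : ∀ x x', 0 ≤ d x x') (h1 : ∀ x, ∫⁻ x', ENNReal.ofReal (d x x') ∂ν = 1)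
    (μ : Measure X) [IsFiniteMeasure μ] {k : X × X → ℝ} (hk : Measurable k) {K : ℝ}
    (hK : ∀ p, |k p| ≤ K) :
    Integrable (fun p : X × X => d p.1 p.2 * k p) (μ.prod ν) := by
  have hi : Integrable (fun p : X × X => d p.1 p.2) (μ.prod ν) := by
    rw [integrable_prod_iff (by exact hd.aestronglyMeasurable)]
    refine ⟨ae_of_all _ fun x => integrable_density hd h0 h1 x, ?_⟩
    have : (fun x => ∫ y, ‖d (x, y).1 (x, y).2‖ ∂ν) = fun _ => 1 := by
      ext x
      simp only [Real.norm_eq_abs, abs_of_nonneg (h0 _ _)]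
      exact integral_density hd h0 h1 x
    rw [this]
    exact integrable_const _
  exact hi.mul_bdd hk.aestronglyMeasurable (ae_of_all _ hK)

/-- Fubini for a finite measure followed by a Markov kernel with a density. -/
lemma integral_integral_densityKernel (hd : Measurable (Function.uncurry d))
    (h0 : ∀ x x', 0 ≤ d x x') (h1 : ∀ x, ∫⁻ x', ENNReal.ofReal (d x x') ∂ν = 1)
    (μ : Measure X) [IsFiniteMeasure μ] {k : X × X → ℝ} (hk : Measurable k) {K : ℝ}
    (hK : ∀ p, |k p| ≤ K) :
    ∫ u, ∫ z, k (u, z) ∂(Kernel.withDensity (Kernel.const X ν)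
        (fun x x' => ENNReal.ofReal (d x x')) u) ∂μ =
      ∫ z, ∫ u, d u z * k (u, z) ∂μ ∂ν := by
  simp_rw [integral_densityKernel hd h0]
  exact integral_integral_swap (integrable_density_mul_prod hd h0 h1 μ hk hK)

end Density

/-! ### Backward smoothing along an arbitrary sequence of measures -/

namespace DominatedHMM

open scoped ENNReal
open Function

variable {X : Type*} [MeasurableSpace X] (H : DominatedHMM X)

instance isMarkovKernel_M : IsMarkovKernel H.M :=
  isMarkovKernel_densityKernel H.measurable_m H.lintegral_m

lemma integral_M (x : X) (f : X → ℝ) : ∫ z, f z ∂(H.M x) = ∫ z, H.m x z * f z ∂H.ν :=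
  integral_densityKernel H.measurable_m H.m_nonneg x f

/-- Backward integration of the coordinates `x_{t-1}, …, x_0` with the backward kernels of an
arbitrary sequence of measures `η`. -/
noncomputable def gbwd (η : ℕ → Measure X) : ℕ → ((ℕ → X) → ℝ) → (ℕ → X) → ℝ
  | 0, f, x => f x
  | t + 1, f, x => H.BK (η t) (x (t + 1)) (fun z => gbwd η t f (update x t z))

/-- The integral of `f` over the coordinates `x_t, …, x_0`: the first one against `η t`, the others
against the backward kernels. -/
noncomputable def pathInt (η : ℕ → Measure X) (t : ℕ) (f : (ℕ → X) → ℝ) (x : ℕ → X) : ℝ :=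
  ∫ z, H.gbwd η t f (update x t z) ∂η t

/-- One step of forward integration of the coordinate `x_{t+1}`. -/
noncomputable def fstep (t : ℕ) (f : (ℕ → X) → ℝ) (x : ℕ → X) : ℝ :=
  ∫ z, H.g (t + 1) z * f (update x (t + 1) z) ∂(H.M (x t))

lemma fwd_succ (n t : ℕ) (f : (ℕ → X) → ℝ) :
    H.fwd (n + 1) t f = H.fstep t (H.fwd n (t + 1) f) := rfl

lemma bwd_eq_gbwd (t : ℕ) (f : (ℕ → X) → ℝ) : H.bwd t f = H.gbwd H.filt t f := by
  induction t with
  | zero => rfl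
  | succ t ih =>
    ext x
    simp only [bwd, gbwd, ih]

variable {H} {η : ℕ → Measure X}

lemma abs_BK_le {μ : Measure X} {x : X} {f : X → ℝ} {K : ℝ} (hK : 0 ≤ K) (hf : ∀ z, |f z| ≤ K) :
    |H.BK μ x f| ≤ K := by
  unfold BK
  by_cases h0 : ∫ z, H.m z x ∂μ = 0
  · simpa [h0] using hK
  have hpos : 0 < ∫ z, H.m z x ∂μ :=
    lt_of_le_of_ne (integral_nonneg fun z => H.m_nonneg _ _) (Ne.symm h0)
  have hint : Integrable (fun z => H.m z x) μ := by
    by_contra h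
    exact h0 (integral_undef h)
  rw [abs_div, abs_of_pos hpos, div_le_iff₀ hpos, ← integral_const_mul]
  refine norm_integral_le_of_norm_le (f := fun z => H.m z x * f z) (hint.const_mul K)
    (ae_of_all _ fun z => ?_)
  rw [norm_mul, Real.norm_eq_abs, Real.norm_eq_abs, abs_of_nonneg (H.m_nonneg _ _), mul_comm]
  have := H.m_nonneg z x
  have := hf z
  gcongr

lemma abs_gbwd_le {t : ℕ} {f : (ℕ → X) → ℝ} {K : ℝ} (hf : ∀ x, |f x| ≤ K) (x : ℕ → X) :
    |H.gbwd η t f x| ≤ K := by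
  induction t generalizing x with
  | zero => exact hf x
  | succ t ih => exact abs_BK_le ((abs_nonneg _).trans (hf x)) fun z => ih _

lemma gbwd_congr {t : ℕ} {f f' : (ℕ → X) → ℝ} {x : ℕ → X}
    (h : ∀ y, (∀ s, t ≤ s → y s = x s) → f y = f' y) : H.gbwd η t f x = H.gbwd η t f' x := by
  induction t generalizing x with
  | zero => exact h x fun _ _ => rfl
  | succ t ih =>
    simp only [gbwd]
    congr 1
    ext z
    refine ih fun y hy => h y fun s hs => ?_
    rw [hy s (by omega), update_of_ne (by omega)]

/-- If `f` depends only on the coordinates up to `t`, then its backward integral depends only on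
the coordinate `t`. -/
lemma gbwd_eq_of_apply_eq {t n : ℕ} (hn : t ≤ n) {f : (ℕ → X) → ℝ}
    (hf : ∀ y y' : ℕ → X, (∀ s ≤ n, y s = y' s) → f y = f y') {x x' : ℕ → X}
    (hx : ∀ s, t ≤ s → s ≤ n → x s = x' s) : H.gbwd η t f x = H.gbwd η t f x' := by
  induction t generalizing x x' with
  | zero => exact hf x x' fun s hs => hx s (Nat.zero_le _) hs
  | succ t ih =>
    simp only [gbwd]
    rw [hx (t + 1) le_rfl hn]
    congr 1
    ext z
    refine ih (by omega) fun s hs1 hs2 => ?_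
    rcases Nat.eq_or_lt_of_le hs1 with rfl | h
    · simp
    · rw [update_of_ne (by omega), update_of_ne (by omega), hx s h hs2]

lemma gbwd_update {t n : ℕ} (hn : t < n) (f : (ℕ → X) → ℝ) (x : ℕ → X) (z : X) :
    H.gbwd η t (fun y => f (update y n z)) x = H.gbwd η t f (update x n z) := by
  induction t generalizing x with
  | zero => rfl
  | succ t ih =>
    simp only [gbwd]
    rw [update_of_ne (by omega)]
    congr 1
    ext w
    rw [ih (by omega), update_comm (by omega)]

lemma gbwd_const_mul {t : ℕ} (c : ℝ) (f : (ℕ → X) → ℝ) (x : ℕ → X) :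
    H.gbwd η t (fun y => c * f y) x = c * H.gbwd η t f x := by
  induction t generalizing x with
  | zero => rfl
  | succ t ih =>
    simp only [gbwd, ih, BK, mul_left_comm _ c, integral_const_mul, mul_div_assoc]

/-- Backward integration leaves factors depending on the later coordinates untouched. -/
lemma gbwd_mul_left {t : ℕ} {c f : (ℕ → X) → ℝ} {x : ℕ → X}
    (hc : ∀ y, (∀ s, t ≤ s → y s = x s) → c y = c x) :
    H.gbwd η t (fun y => c y * f y) x = c x * H.gbwd η t f x := by
  rw [← gbwd_const_mul]
  exact gbwd_congr fun y hy => by rw [hc y hy]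

lemma gbwd_succ_eq_div (t : ℕ) (f : (ℕ → X) → ℝ) (x : ℕ → X) :
    H.gbwd η (t + 1) f x =
      H.pathInt η t (fun y => H.m (y t) (y (t + 1)) * f y) x / ∫ z, H.m z (x (t + 1)) ∂η t := by
  simp only [gbwd, BK, pathInt]
  congr 2
  ext z
  rw [gbwd_mul_left (c := fun y => H.m (y t) (y (t + 1)))]
  · simp
  · intro y hy
    rw [hy t le_rfl, hy (t + 1) (Nat.le_succ t)]

lemma gbwd_smul {c : ℕ → ℝ≥0∞} {t : ℕ} (hc : ∀ s < t, c s ≠ 0) (hc' : ∀ s < t, c s ≠ ∞)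
    (f : (ℕ → X) → ℝ) :
    H.gbwd (fun s => c s • η s) t f = H.gbwd η t f := by
  induction t with
  | zero => rfl
  | succ t ih =>
    ext x
    have ih' := ih (fun s hs => hc s (by omega)) (fun s hs => hc' s (by omega))
    simp only [gbwd, ih', BK, integral_smul_measure, smul_eq_mul]
    refine mul_div_mul_left _ _ ?_
    exact (ENNReal.toReal_pos (hc t (by omega)) (hc' t (by omega))).ne'

/-! #### Measurability -/

section Meas

variable {Θ : Type*} {mΘ : MeasurableSpace Θ}

lemma measurable_update_pair (n : ℕ) :
    Measurable (fun p : (ℕ → X) × X => update p.1 n p.2) := by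
  refine measurable_pi_lambda _ fun i => ?_
  by_cases h : i = n
  · subst h
    simpa using measurable_snd
  · simp only [update_of_ne h]
    exact (measurable_pi_apply i).comp measurable_fst

/-- Integration against `μ` preserves measurability of functions with parameters in `Θ` and
paths. -/
def MeasurableIntegral {Θ : Type*} (mΘ : MeasurableSpace Θ) (μ : Θ → Measure X) : Prop :=
  ∀ F : (Θ × (ℕ → X)) × X → ℝ, Measurable F → Measurable fun q : Θ × (ℕ → X) => ∫ z, F (q, z) ∂μ q.1

lemma measurableIntegral_const (μ : Measure X) [SFinite μ] :
    MeasurableIntegral mΘ (fun _ => μ) := fun _ hF =>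
  (hF.stronglyMeasurable.integral_prod_right' (ν := μ)).measurable

lemma measurable_gbwd {η : Θ → ℕ → Measure X} {t : ℕ}
    (hη : ∀ s < t, MeasurableIntegral mΘ fun θ => η θ s) {f : Θ × (ℕ → X) → ℝ}
    (hf : Measurable f) :
    Measurable fun q : Θ × (ℕ → X) => H.gbwd (η q.1) t (fun y => f (q.1, y)) q.2 := by
  induction t with
  | zero => exact hf
  | succ t ih =>
    have ih' := ih fun s hs => hη s (by omega)
    simp only [gbwd, BK]
    have hupd : Measurable fun r : (Θ × (ℕ → X)) × X => (r.1.1, update r.1.2 t r.2) :=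
      (measurable_fst.comp measurable_fst).prodMk ((measurable_update_pair t).comp
        ((measurable_snd.comp measurable_fst).prodMk measurable_snd))
    have hm : Measurable fun r : (Θ × (ℕ → X)) × X => H.m r.2 (r.1.2 (t + 1)) :=
      H.measurable_m.comp (measurable_snd.prodMk
        ((measurable_pi_apply (t + 1)).comp (measurable_snd.comp measurable_fst)))
    exact (hη t (by omega) _ (hm.mul (ih'.comp hupd))).div (hη t (by omega) _ hm)

lemma measurable_gbwd_const [∀ s, SFinite (η s)] {t : ℕ} {f : (ℕ → X) → ℝ} (hf : Measurable f) :
    Measurable (H.gbwd η t f) := by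
  have := measurable_gbwd (H := H) (Θ := Unit) (mΘ := inferInstance) (t := t) (η := fun _ => η)
    (fun s _ => measurableIntegral_const (η s)) (f := fun q => f q.2) (hf.comp measurable_snd)
  exact this.comp (measurable_const (a := ()) |>.prodMk measurable_id)

lemma measurable_fstep {t : ℕ} {f : (ℕ → X) → ℝ} (hf : Measurable f) :
    Measurable (H.fstep t f) := by
  unfold fstep
  have hF : Measurable fun q : (ℕ → X) × X => H.g (t + 1) q.2 * f (update q.1 (t + 1) q.2) :=
    ((H.measurable_g _).comp measurable_snd).mul (hf.comp (measurable_update_pair _))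
  exact (hF.stronglyMeasurable.integral_kernel_prod_right'
    (κ := H.M.comap (fun x : ℕ → X => x t) (measurable_pi_apply t))).measurable

end Meas

lemma abs_fstep_le {t : ℕ} {f : (ℕ → X) → ℝ} {K C : ℝ} (hf : ∀ x, |f x| ≤ K)
    (hg : ∀ z, H.g (t + 1) z ≤ C) (x : ℕ → X) : |H.fstep t f x| ≤ C * K := by
  have := norm_integral_le_of_norm_le_const (μ := H.M (x t)) (C := C * K)
    (f := fun z => H.g (t + 1) z * f (update x (t + 1) z)) (ae_of_all _ fun z => by
      rw [norm_mul, Real.norm_eq_abs, Real.norm_eq_abs, abs_of_nonneg (H.g_nonneg _ _)]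
      exact mul_le_mul (hg z) (hf _) (abs_nonneg _) ((H.g_nonneg _ _).trans (hg z)))
  simpa [fstep] using this

/-- Backward integration commutes with integration over a parameter. -/
lemma gbwd_integral [∀ s, IsFiniteMeasure (η s)] {Cm : ℝ} (hm : ∀ x x', H.m x x' ≤ Cm)
    (μ : Measure X) [IsFiniteMeasure μ] {t : ℕ} {k : (ℕ → X) × X → ℝ} (hk : Measurable k) {K : ℝ}
    (hK : ∀ p, |k p| ≤ K) (x : ℕ → X) :
    H.gbwd η t (fun y => ∫ z, k (y, z) ∂μ) x = ∫ z, H.gbwd η t (fun y => k (y, z)) x ∂μ := by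
  induction t generalizing x with
  | zero => rfl
  | succ t ih =>
    simp only [gbwd, ih, BK]
    rw [integral_div]
    congr 1
    simp_rw [← integral_const_mul]
    rw [integral_integral_swap]
    have hmeas : Measurable fun p : X × X => H.m p.1 (x (t + 1)) *
        H.gbwd η t (fun y => k (y, p.2)) (update x t p.1) := by
      have h1 := measurable_gbwd (H := H) (Θ := X) (t := t) (η := fun _ => η)
        (fun s _ => measurableIntegral_const (η s)) (f := fun q => k (q.2, q.1))
        (hk.comp measurable_swap)
      refine (H.measurable_m.comp (measurable_fst.prodMk measurable_const)).mul ?_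
      exact h1.comp (measurable_snd.prodMk
        ((measurable_update_pair t).comp (measurable_const.prodMk measurable_fst)))
    refine Integrable.of_bound hmeas.aestronglyMeasurable (Cm * K) (ae_of_all _ fun p => ?_)
    rw [uncurry_apply_pair, norm_mul, Real.norm_eq_abs, Real.norm_eq_abs,
      abs_of_nonneg (H.m_nonneg _ _)]
    exact mul_le_mul (hm _ _) (abs_gbwd_le (fun y => hK _) _) (abs_nonneg _)
      ((H.m_nonneg _ _).trans (hm p.1 (x (t + 1))))

/-- Propagating by one forward step and integrating backwards is the same as integrating the
forward step. -/
lemma integral_M_gbwd_succ [∀ s, IsFiniteMeasure (η s)] {Cm Cg K : ℝ}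
    (hm : ∀ x x', H.m x x' ≤ Cm) {t : ℕ} (hg : ∀ z, H.g (t + 1) z ≤ Cg) {f : (ℕ → X) → ℝ}
    (hf : Measurable f) (hK : ∀ x, |f x| ≤ K) (y : ℕ → X) :
    ∫ u, ∫ z, H.g (t + 1) z * H.gbwd η (t + 1) f (update y (t + 1) z) ∂(H.M u) ∂(η t) =
      H.pathInt η t (H.fstep t f) y := by
  have hgb : ∀ (s : ℕ) (w : ℕ → X) z, |H.g (t + 1) z * H.gbwd η s f w| ≤ Cg * K := by
    intro s w z
    rw [abs_mul, abs_of_nonneg (H.g_nonneg _ _)]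
    exact mul_le_mul (hg z) (abs_gbwd_le hK _) (abs_nonneg _) ((H.g_nonneg _ _).trans (hg z))
  have hmu : ∀ (n : ℕ) (w : ℕ → X), Measurable fun z => update w n z := fun n w =>
    (measurable_update_pair n).comp (measurable_const.prodMk measurable_id)
  have h1 : ∫ u, ∫ z, H.g (t + 1) z * H.gbwd η (t + 1) f (update y (t + 1) z) ∂(H.M u) ∂(η t) =
      ∫ z, ∫ u, H.m u z * (H.g (t + 1) z * H.gbwd η (t + 1) f (update y (t + 1) z))
        ∂(η t) ∂H.ν := by
    refine integral_integral_densityKernel H.measurable_m H.m_nonneg H.lintegral_m (η t)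
      (k := fun p => H.g (t + 1) p.2 * H.gbwd η (t + 1) f (update y (t + 1) p.2)) (K := Cg * K)
      ?_ fun p => hgb _ _ _
    exact ((H.measurable_g _).comp measurable_snd).mul
      ((measurable_gbwd_const hf).comp ((hmu _ _).comp measurable_snd))
  have h2 : ∫ u, ∫ z, H.g (t + 1) z * H.gbwd η t f (update (update y t u) (t + 1) z)
        ∂(H.M u) ∂(η t) =
      ∫ z, ∫ u, H.m u z * (H.g (t + 1) z * H.gbwd η t f (update (update y t u) (t + 1) z))
        ∂(η t) ∂H.ν := by
    refine integral_integral_densityKernel H.measurable_m H.m_nonneg H.lintegral_m (η t)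
      (k := fun p => H.g (t + 1) p.2 * H.gbwd η t f (update (update y t p.1) (t + 1) p.2))
      (K := Cg * K) ?_ fun p => hgb _ _ _
    exact ((H.measurable_g _).comp measurable_snd).mul
      ((measurable_gbwd_const hf).comp ((measurable_update_pair _).comp
        (((hmu _ _).comp measurable_fst).prodMk measurable_snd)))
  have h3 : H.pathInt η t (H.fstep t f) y =
      ∫ u, ∫ z, H.g (t + 1) z * H.gbwd η t f (update (update y t u) (t + 1) z)
        ∂(H.M u) ∂(η t) := by
    unfold pathInt
    congr 1 with u
    have e1 : H.gbwd η t (H.fstep t f) (update y t u) =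
        H.gbwd η t (fun w => ∫ z, H.g (t + 1) z * f (update w (t + 1) z) ∂(H.M u))
          (update y t u) := by
      refine gbwd_congr fun w hw => ?_
      have := hw t le_rfl
      rw [update_self] at this
      rw [fstep, this]
    rw [e1, gbwd_integral hm (H.M u)
      (k := fun p => H.g (t + 1) p.2 * f (update p.1 (t + 1) p.2)) (K := Cg * K)
      (((H.measurable_g _).comp measurable_snd).mul (hf.comp (measurable_update_pair _)))
      (fun p => by
        rw [abs_mul, abs_of_nonneg (H.g_nonneg _ _)]
        exact mul_le_mul (hg p.2) (hK _) (abs_nonneg _) ((H.g_nonneg _ _).trans (hg p.2)))]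
    congr 1 with z
    dsimp only
    rw [gbwd_const_mul, gbwd_update (Nat.lt_succ_self t)]
  rw [h1, h3, h2]
  congr 1 with z
  have e2 : ∀ u, H.m u z * (H.g (t + 1) z * H.gbwd η (t + 1) f (update y (t + 1) z)) =
      (H.g (t + 1) z * H.gbwd η (t + 1) f (update y (t + 1) z)) * H.m u z := fun u => by ring
  have e3 : ∀ u, H.m u z * (H.g (t + 1) z * H.gbwd η t f (update (update y t u) (t + 1) z)) =
      H.g (t + 1) z * (H.m u z * H.gbwd η t f (update (update y (t + 1) z) t u)) := fun u => by
    rw [update_comm (by omega : t ≠ t + 1)]; ring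
  simp_rw [e2, e3]
  rw [integral_const_mul, integral_const_mul, mul_assoc]
  congr 1
  simp only [gbwd, BK, update_self]
  by_cases h0 : ∫ u, H.m u z ∂(η t) = 0
  · rw [h0, div_zero, zero_mul]
    have hmi : Integrable (fun u => H.m u z) (η t) :=
      Integrable.of_bound (H.measurable_m.comp (measurable_id.prodMk
        measurable_const)).aestronglyMeasurable Cm (ae_of_all _ fun u => by
          rw [Real.norm_eq_abs, abs_of_nonneg (H.m_nonneg _ _)]; exact hm _ _)
    have hae := (integral_eq_zero_iff_of_nonneg (fun u => H.m_nonneg u z) hmi).1 h0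
    symm
    refine integral_eq_zero_of_ae ?_
    filter_upwards [hae] with u hu
    simp only [Pi.zero_apply] at hu
    simp [hu]
  · rw [div_mul_cancel₀ _ h0]

end DominatedHMM

/-! ### The unnormalised filters and the smoothing functional -/

namespace DominatedHMM

open scoped ENNReal
open Function

variable {X : Type*} [MeasurableSpace X] (H : DominatedHMM X)

/-- The sequence of unnormalised filters, frozen after time `T`. -/
noncomputable def unfiltUpTo (T s : ℕ) : Measure X := H.unfilt (min s T)

variable {H} {η η' : ℕ → Measure X}

lemma gbwd_congr_measure {t : ℕ} (h : ∀ s < t, η s = η' s) (f : (ℕ → X) → ℝ) :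
    H.gbwd η t f = H.gbwd η' t f := by
  induction t with
  | zero => rfl
  | succ t ih =>
    ext x
    simp only [gbwd, ih fun s hs => h s (by omega), h t (by omega)]

lemma BoundedLikelihood.isFiniteMeasure_unfilt {T : ℕ} (hlik : H.BoundedLikelihood T) {s : ℕ}
    (hs : s ≤ T) : IsFiniteMeasure (H.unfilt s) := by
  obtain ⟨-, C, hC⟩ := hlik
  induction s with
  | zero =>
    refine isFiniteMeasure_withDensity ?_
    refine ne_top_of_le_ne_top (b := ENNReal.ofReal C) ENNReal.ofReal_ne_top ?_
    calc ∫⁻ x, ENNReal.ofReal (H.g 0 x) ∂H.χ ≤ ∫⁻ _, ENNReal.ofReal C ∂H.χ :=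
          lintegral_mono fun x => ENNReal.ofReal_le_ofReal (hC 0 hs x)
      _ = ENNReal.ofReal C := by simp
  | succ s ih =>
    have := ih (by omega)
    refine isFiniteMeasure_withDensity ?_
    refine ne_top_of_le_ne_top (b := ENNReal.ofReal C * ((H.unfilt s).bind H.M) Set.univ)
      (ENNReal.mul_ne_top ENNReal.ofReal_ne_top (measure_ne_top _ _)) ?_
    calc ∫⁻ x, ENNReal.ofReal (H.g (s + 1) x) ∂((H.unfilt s).bind H.M)
        ≤ ∫⁻ _, ENNReal.ofReal C ∂((H.unfilt s).bind H.M) :=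
          lintegral_mono fun x => ENNReal.ofReal_le_ofReal (hC _ hs x)
      _ = _ := by rw [lintegral_const]

lemma BoundedLikelihood.isFiniteMeasure_unfiltUpTo {T : ℕ} (hlik : H.BoundedLikelihood T) (s : ℕ) :
    IsFiniteMeasure (H.unfiltUpTo T s) := hlik.isFiniteMeasure_unfilt (min_le_right _ _)

lemma BoundedLikelihood.unfilt_univ_ne_zero {T : ℕ} (hlik : H.BoundedLikelihood T) {s : ℕ}
    (hs : s ≤ T) : H.unfilt s Set.univ ≠ 0 := by
  have hpos := hlik.1
  have key : ∀ (μ : Measure X) (s : ℕ), s ≤ T → μ Set.univ ≠ 0 →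
      μ.withDensity (fun x => ENNReal.ofReal (H.g s x)) Set.univ ≠ 0 := by
    intro μ s hs hμ h0
    rw [Measure.measure_univ_eq_zero,
      withDensity_eq_zero_iff (H.measurable_g s).ennreal_ofReal.aemeasurable] at h0
    have : ∀ᵐ _ ∂μ, False := by
      filter_upwards [h0] with x hx
      have h1 := ENNReal.ofReal_pos.2 (hpos s hs x)
      simp only [Pi.zero_apply] at hx
      rw [hx] at h1
      exact lt_irrefl _ h1
    rw [ae_iff] at this
    simp only [not_false_eq_true] at this
    exact hμ this
  induction s with
  | zero => exact key _ 0 hs (by simp)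
  | succ s ih =>
    refine key _ _ hs ?_
    rw [Measure.bind_apply MeasurableSet.univ H.M.aemeasurable]
    simpa using ih (by omega)

lemma BoundedLikelihood.bwd_eq {T : ℕ} (hlik : H.BoundedLikelihood T) {t : ℕ} (ht : t ≤ T)
    (f : (ℕ → X) → ℝ) : H.bwd t f = H.gbwd (H.unfiltUpTo T) t f := by
  rw [bwd_eq_gbwd]
  have h1 : H.gbwd H.filt t f = H.gbwd H.unfilt t f :=
    gbwd_smul (c := fun s => (H.unfilt s Set.univ)⁻¹)
      (fun s hs => by
        have := hlik.isFiniteMeasure_unfilt (s := s) (by omega)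
        simp)
      (fun s hs => by
        have := hlik.unfilt_univ_ne_zero (s := s) (by omega)
        simpa using this) f
  rw [h1]
  refine gbwd_congr_measure (fun s hs => ?_) f
  rw [unfiltUpTo, min_eq_left (by omega)]

lemma BoundedLikelihood.integral_unfilt_zero (f : X → ℝ) :
    ∫ x, f x ∂(H.unfilt 0) = ∫ x, H.g 0 x * f x ∂H.χ := by
  rw [unfilt, integral_withDensity_eq_integral_toReal_smul (H.measurable_g 0).ennreal_ofReal
    (ae_of_all _ fun _ => ENNReal.ofReal_lt_top)]
  simp only [ENNReal.toReal_ofReal (H.g_nonneg _ _), smul_eq_mul]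

lemma BoundedLikelihood.integral_unfiltUpTo_succ {T : ℕ} (hlik : H.BoundedLikelihood T) {t : ℕ}
    (ht : t + 1 ≤ T) {f : X → ℝ} (hf : Measurable f) {K : ℝ} (hK : ∀ x, |f x| ≤ K) :
    ∫ x, f x ∂(H.unfiltUpTo T (t + 1)) =
      ∫ u, ∫ z, H.g (t + 1) z * f z ∂(H.M u) ∂(H.unfiltUpTo T t) := by
  have hfin := hlik.isFiniteMeasure_unfilt (s := t) (by omega)
  obtain ⟨-, C, hC⟩ := hlik
  rw [unfiltUpTo, unfiltUpTo, min_eq_left ht, min_eq_left (by omega), unfilt,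
    integral_withDensity_eq_integral_toReal_smul (H.measurable_g _).ennreal_ofReal
    (ae_of_all _ fun _ => ENNReal.ofReal_lt_top)]
  simp only [ENNReal.toReal_ofReal (H.g_nonneg _ _), smul_eq_mul]
  rw [Measure.comp_eq_comp_const_apply, Kernel.integral_comp, Kernel.const_apply]
  refine Integrable.of_bound
    ((H.measurable_g _).mul hf).aestronglyMeasurable (C * K) (ae_of_all _ fun z => ?_)
  rw [norm_mul, Real.norm_eq_abs, Real.norm_eq_abs, abs_of_nonneg (H.g_nonneg _ _)]
  exact mul_le_mul (hC _ ht z) (hK z) (abs_nonneg _) ((H.g_nonneg _ _).trans (hC _ ht z))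

lemma BoundedLikelihood.pathInt_succ {T : ℕ} (hlik : H.BoundedLikelihood T) {Cm : ℝ}
    (hm : ∀ x x', H.m x x' ≤ Cm) {t : ℕ} (ht : t + 1 ≤ T) {f : (ℕ → X) → ℝ}
    (hf : Measurable f) {K : ℝ} (hK : ∀ x, |f x| ≤ K) (y : ℕ → X) :
    H.pathInt (H.unfiltUpTo T) (t + 1) f y = H.pathInt (H.unfiltUpTo T) t (H.fstep t f) y := by
  have := hlik.isFiniteMeasure_unfiltUpTo
  obtain ⟨C, hC⟩ := hlik.2
  rw [← integral_M_gbwd_succ hm (hC _ ht) hf hK, pathInt,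
    hlik.integral_unfiltUpTo_succ ht _ fun z => abs_gbwd_le hK _]
  exact (measurable_gbwd_const hf).comp
    ((measurable_update_pair _).comp (measurable_const.prodMk measurable_id))

/-! #### Forward integration -/

lemma measurable_fwd {n t : ℕ} {f : (ℕ → X) → ℝ} (hf : Measurable f) :
    Measurable (H.fwd n t f) := by
  induction n generalizing t with
  | zero => exact hf
  | succ n ih => exact measurable_fstep ih

lemma abs_fwd_le {n t T : ℕ} {C : ℝ} (hC : ∀ t ≤ T, ∀ x, H.g t x ≤ C) (ht : t + n ≤ T)
    {f : (ℕ → X) → ℝ} {K : ℝ} (hK : ∀ x, |f x| ≤ K) (x : ℕ → X) :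
    |H.fwd n t f x| ≤ C ^ n * K := by
  induction n generalizing t x with
  | zero => simpa using! hK x
  | succ n ih =>
    rw [fwd_succ]
    have := abs_fstep_le (H := H) (t := t) (fun x => ih (t := t + 1) (by omega) x)
      (hC (t + 1) (by omega)) x
    calc _ ≤ _ := this
      _ = _ := by ring

lemma fwd_sub_const_mul {n t T : ℕ} {C : ℝ} (hC : ∀ t ≤ T, ∀ x, H.g t x ≤ C) (ht : t + n ≤ T)
    {f f' : (ℕ → X) → ℝ} (hf : Measurable f) (hf' : Measurable f') {K : ℝ} (hK : ∀ x, |f x| ≤ K)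
    (hK' : ∀ x, |f' x| ≤ K) (c : ℝ) (x : ℕ → X) :
    H.fwd n t (fun y => f y - c * f' y) x = H.fwd n t f x - c * H.fwd n t f' x := by
  induction n generalizing t x with
  | zero => rfl
  | succ n ih =>
    have hint : ∀ {f : (ℕ → X) → ℝ}, Measurable f → (∀ x, |f x| ≤ K) → Integrable
        (fun z => H.g (t + 1) z * H.fwd n (t + 1) f (update x (t + 1) z)) (H.M (x t)) := by
      intro f hf hK
      refine Integrable.of_bound (((H.measurable_g _).mul ((measurable_fwd hf).comp
        ((measurable_update_pair _).comp (measurable_const.prodMk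
          measurable_id)))).aestronglyMeasurable) (C * (C ^ n * K)) (ae_of_all _ fun z => ?_)
      rw [norm_mul, Real.norm_eq_abs, Real.norm_eq_abs, abs_of_nonneg (H.g_nonneg _ _)]
      exact mul_le_mul (hC _ (by omega) z) (abs_fwd_le hC (by omega) hK _) (abs_nonneg _)
        ((H.g_nonneg _ _).trans (hC _ (by omega : t + 1 ≤ T) z))
    simp only [fwd_succ, fstep]
    rw [← integral_const_mul, ← integral_sub (hint hf hK) ((hint hf' hK').const_mul c)]
    congr 1 with z
    rw [ih (by omega)]
    ring

lemma fwd_pos {n t T : ℕ} (hlik : H.BoundedLikelihood T) (ht : t + n ≤ T) (x : ℕ → X) :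
    0 < H.fwd n t (fun _ => 1) x := by
  obtain ⟨C, hC⟩ := hlik.2
  induction n generalizing t x with
  | zero => exact one_pos
  | succ n ih =>
    rw [fwd_succ, fstep]
    have hp : ∀ z, 0 < H.g (t + 1) z * H.fwd n (t + 1) (fun _ => 1) (update x (t + 1) z) :=
      fun z => mul_pos (hlik.1 _ (by omega) z) (ih (by omega) _)
    rw [integral_pos_iff_support_of_nonneg (fun z => (hp z).le)]
    · have : support (fun z => H.g (t + 1) z *
          H.fwd n (t + 1) (fun _ => 1) (update x (t + 1) z)) = Set.univ := by
        ext z; simpa using (hp z).ne'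
      rw [this]
      simp
    · refine Integrable.of_bound (((H.measurable_g _).mul ((measurable_fwd measurable_const).comp
        ((measurable_update_pair _).comp (measurable_const.prodMk
          measurable_id)))).aestronglyMeasurable) (C * (C ^ n * 1)) (ae_of_all _ fun z => ?_)
      rw [norm_mul, Real.norm_eq_abs, Real.norm_eq_abs, abs_of_nonneg (H.g_nonneg _ _)]
      exact mul_le_mul (hC _ (by omega) z) (abs_fwd_le hC (by omega) (fun _ => by simp) _)
        (abs_nonneg _) ((H.g_nonneg _ _).trans (hC _ (by omega : t + 1 ≤ T) z))

lemma fwd_eq_of_apply_eq {n t : ℕ} {f : (ℕ → X) → ℝ}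
    (hf : ∀ y y' : ℕ → X, (∀ s ≤ t + n, y s = y' s) → f y = f y') {x x' : ℕ → X}
    (hx : ∀ s ≤ t, x s = x' s) : H.fwd n t f x = H.fwd n t f x' := by
  induction n generalizing t x x' with
  | zero => exact hf x x' hx
  | succ n ih =>
    simp only [fwd_succ, fstep]
    rw [hx t le_rfl]
    congr 1 with z
    congr 1
    refine ih (fun y y' hy => hf y y' fun s hs => hy s (by omega)) fun s hs => ?_
    by_cases h : s = t + 1
    · subst h; simp
    · rw [update_of_ne h, update_of_ne h, hx s (by omega)]

/-- A function of `x_0, …, x_T` as a function of infinite paths. -/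
def pathFun {T : ℕ} (h : (Fin (T + 1) → X) → ℝ) (y : ℕ → X) : ℝ := h (fun i => y i)

lemma measurable_pathFun {T : ℕ} {h : (Fin (T + 1) → X) → ℝ} (hh : Measurable h) :
    Measurable (pathFun h) :=
  hh.comp (measurable_pi_lambda _ fun i => measurable_pi_apply (i : ℕ))

lemma L_eq (T t : ℕ) (h : (Fin (T + 1) → X) → ℝ) : H.L T t h = H.fwd (T - t) t (pathFun h) := rfl

lemma L_eq_of_apply_eq {T t : ℕ} (ht : t ≤ T) {h : (Fin (T + 1) → X) → ℝ} {x x' : ℕ → X}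
    (hx : ∀ s ≤ t, x s = x' s) : H.L T t h x = H.L T t h x' := by
  refine fwd_eq_of_apply_eq (fun y y' hy => ?_) hx
  congr 1
  ext i
  exact hy i (by have := i.2; omega)

lemma L_succ {T t : ℕ} (ht : t + 1 ≤ T) (h : (Fin (T + 1) → X) → ℝ) :
    H.L T t h = H.fstep t (H.L T (t + 1) h) := by
  rw [L_eq, L_eq, show T - t = (T - (t + 1)) + 1 by omega, fwd_succ]

lemma measurable_L {T t : ℕ} {h : (Fin (T + 1) → X) → ℝ} (hh : Measurable h) :
    Measurable (H.L T t h) := measurable_fwd (measurable_pathFun hh)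

lemma BoundedLikelihood.exists_abs_L_le {T : ℕ} (hlik : H.BoundedLikelihood T)
    {h : (Fin (T + 1) → X) → ℝ} {K : ℝ} (hK : ∀ x, |h x| ≤ K) :
    ∃ K', ∀ t ≤ T, ∀ x, |H.L T t h x| ≤ K' := by
  obtain ⟨C, hC⟩ := hlik.2
  refine ⟨(max C 1) ^ T * K, fun t ht x => ?_⟩
  have hK0 : 0 ≤ K := (abs_nonneg _).trans (hK fun _ => x 0)
  have := abs_fwd_le (H := H) (C := max C 1) (T := T) (n := T - t) (t := t)
    (fun t ht x => (hC t ht x).trans (le_max_left _ _)) (by omega) (f := pathFun h) (K := K)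
    (fun x => hK _) x
  refine this.trans ?_
  gcongr
  · exact le_max_right _ _
  · omega

/-- The unnormalised smoothing functional. -/
noncomputable def unsmooth (H : DominatedHMM X) (T : ℕ) (h : (Fin (T + 1) → X) → ℝ) : ℝ :=
  ∫ x, H.g 0 x * H.L T 0 h (fun _ => x) ∂H.χ

lemma smooth_eq (T : ℕ) (h : (Fin (T + 1) → X) → ℝ) :
    H.smooth T h = H.unsmooth T h / H.unsmooth T (fun _ => 1) := rfl

lemma BoundedLikelihood.integrable_L_zero {T : ℕ} (hlik : H.BoundedLikelihood T)
    {h : (Fin (T + 1) → X) → ℝ} (hh : Measurable h) {K : ℝ} (hK : ∀ x, |h x| ≤ K) :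
    Integrable (fun x => H.g 0 x * H.L T 0 h (fun _ => x)) H.χ := by
  obtain ⟨C, hC⟩ := hlik.2
  obtain ⟨K', hK'⟩ := hlik.exists_abs_L_le hK
  refine Integrable.of_bound ((H.measurable_g 0).mul ((measurable_L hh).comp
    (measurable_pi_lambda _ fun _ => measurable_id))).aestronglyMeasurable (C * K')
    (ae_of_all _ fun z => ?_)
  rw [norm_mul, Real.norm_eq_abs, Real.norm_eq_abs, abs_of_nonneg (H.g_nonneg _ _)]
  exact mul_le_mul (hC _ (by omega) z) (hK' 0 (by omega) _) (abs_nonneg _)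
    ((H.g_nonneg _ _).trans (hC 0 (by omega) z))

lemma BoundedLikelihood.unsmooth_one_pos {T : ℕ} (hlik : H.BoundedLikelihood T) :
    0 < H.unsmooth T (fun _ => 1) := by
  have hp : ∀ z, 0 < H.g 0 z * H.L T 0 (fun _ => 1) (fun _ => z) := fun z =>
    mul_pos (hlik.1 0 (by omega) z) (fwd_pos hlik (by omega) _)
  rw [unsmooth, integral_pos_iff_support_of_nonneg (fun z => (hp z).le)
    (hlik.integrable_L_zero measurable_const (K := 1) (fun _ => by simp))]
  have : support (fun z => H.g 0 z * H.L T 0 (fun _ => 1) (fun _ => z)) = Set.univ := by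
    ext z; simpa using (hp z).ne'
  rw [this]
  simp

lemma BoundedLikelihood.unsmooth_sub_const {T : ℕ} (hlik : H.BoundedLikelihood T)
    {h : (Fin (T + 1) → X) → ℝ} (hh : Measurable h) {K : ℝ} (hK : ∀ x, |h x| ≤ K) (c : ℝ) :
    H.unsmooth T (fun x => h x - c) = H.unsmooth T h - c * H.unsmooth T (fun _ => 1) := by
  obtain ⟨C, hC⟩ := hlik.2
  rw [unsmooth, unsmooth, unsmooth, ← integral_const_mul, ← integral_sub
    (hlik.integrable_L_zero hh hK)
    ((hlik.integrable_L_zero measurable_const (K := 1) (fun _ => by simp)).const_mul c)]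
  congr 1 with z
  have := fwd_sub_const_mul (H := H) (T := T) (n := T) (t := 0) hC (by omega) (f := pathFun h)
    (f' := fun _ => 1) (measurable_pathFun hh) measurable_const (K := max K 1)
    (fun x => (hK _).trans (le_max_left _ _)) (fun x => by simp) c (fun _ => z)
  simp only [mul_one] at this
  rw [L_eq, L_eq, L_eq]
  change H.g 0 z * H.fwd T 0 (fun y => pathFun h y - c) (fun _ => z) = _
  rw [this]
  simp only [Nat.sub_zero]
  change _ = H.g 0 z * H.fwd T 0 (pathFun h) (fun _ => z) -
    c * (H.g 0 z * H.fwd T 0 (fun _ => 1) (fun _ => z))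
  ring

lemma BoundedLikelihood.smooth_sub_smooth {T : ℕ} (hlik : H.BoundedLikelihood T)
    {h : (Fin (T + 1) → X) → ℝ} (hh : Measurable h) {K : ℝ} (hK : ∀ x, |h x| ≤ K) :
    H.smooth T (fun x => h x - H.smooth T h) = 0 := by
  rw [smooth_eq, hlik.unsmooth_sub_const hh hK, smooth_eq,
    div_mul_cancel₀ _ hlik.unsmooth_one_pos.ne', sub_self, zero_div]

/-- The path integral of `L_{t,T}` does not depend on `t`. -/
lemma BoundedLikelihood.pathInt_L {T : ℕ} (hlik : H.BoundedLikelihood T) {Cm : ℝ}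
    (hm : ∀ x x', H.m x x' ≤ Cm) {h : (Fin (T + 1) → X) → ℝ} (hh : Measurable h) {K : ℝ}
    (hK : ∀ x, |h x| ≤ K) {t : ℕ} (ht : t ≤ T) (y : ℕ → X) :
    H.pathInt (H.unfiltUpTo T) t (H.L T t h) y = H.unsmooth T h := by
  obtain ⟨K', hK'⟩ := hlik.exists_abs_L_le hK
  induction t with
  | zero =>
    rw [pathInt, unfiltUpTo, min_eq_left (Nat.zero_le _),
      BoundedLikelihood.integral_unfilt_zero, unsmooth]
    congr 1 with z
    congr 1
    refine L_eq_of_apply_eq (by omega) fun s hs => ?_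
    obtain rfl : s = 0 := by omega
    simp
  | succ t ih =>
    rw [hlik.pathInt_succ hm ht (measurable_L hh) (hK' _ ht), ← L_succ ht]
    exact ih (by omega)

lemma BoundedLikelihood.F_eq {T : ℕ} (hlik : H.BoundedLikelihood T) {t : ℕ} (ht : t ≤ T) (x : X)
    (h : (Fin (T + 1) → X) → ℝ) (y : ℕ → X) :
    H.F T t x h = H.gbwd (H.unfiltUpTo T) t (H.L T t h) (update y t x) := by
  rw [F, hlik.bwd_eq ht]
  refine gbwd_eq_of_apply_eq (n := t) le_rfl (fun y y' hy => L_eq_of_apply_eq ht hy)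
    fun s hs1 hs2 => ?_
  obtain rfl : s = t := by omega
  simp

end DominatedHMM

/-! ### Conditionally i.i.d. samples from conditional probabilities -/

section CondExpLaw

open scoped ENNReal

variable {Ω E : Type*} {m mΩ : MeasurableSpace Ω} [MeasurableSpace E] {P : Measure Ω}
  [IsProbabilityMeasure P]

lemma measure_inter_eq_setLIntegral_of_condExp (hm : m ≤ mΩ) {F G B : Set Ω}
    (hF : MeasurableSet[m] F) (hFG : F ⊆ G) (hB : MeasurableSet B) {r : Ω → ℝ}
    (hr0 : ∀ ω ∈ G, 0 ≤ r ω) (hr : ∀ᵐ ω ∂P, ω ∈ G → (P⟦B | m⟧) ω = r ω) :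
    P (F ∩ B) = ∫⁻ ω in F, ENNReal.ofReal (r ω) ∂P := by
  have hF' : MeasurableSet F := hm _ hF
  have hint : Integrable (B.indicator fun _ => (1 : ℝ)) P := (integrable_const 1).indicator hB
  have h1 : ∫ ω in F, (P⟦B | m⟧) ω ∂P = P.real (F ∩ B) := by
    rw [setIntegral_condExp hm hint hF, setIntegral_indicator hB, setIntegral_const, smul_eq_mul,
      mul_one]
  have h2 : (fun ω => (P⟦B | m⟧) ω) =ᵐ[P.restrict F] r := by
    filter_upwards [ae_restrict_of_ae hr, ae_restrict_mem hF'] with ω h1 h2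
    exact h1 (hFG h2)
  rw [integral_congr_ae h2] at h1
  have hri : Integrable r (P.restrict F) := (integrable_condExp.integrableOn).congr h2
  rw [← ofReal_integral_eq_lintegral_ofReal hri, h1, ofReal_measureReal]
  filter_upwards [ae_restrict_mem hF'] with ω hω using hr0 ω (hFG hω)

lemma condIID_of_condExp (hm : m ≤ mΩ) {N : ℕ} {G : Set Ω}
    (hG : MeasurableSet[m] G) {κ : Ω → Measure E} (hκ : Measurable[m] κ)
    {Y : Fin N → Ω → E} (hY : ∀ i, Measurable (Y i))
    (hprob : ∀ ω ∈ G, IsProbabilityMeasure (κ ω))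
    (hlaw : ∀ B : Fin N → Set E, (∀ i, MeasurableSet (B i)) → ∀ᵐ ω ∂P, ω ∈ G →
      (P⟦{ω' | ∀ i, Y i ω' ∈ B i} | m⟧) ω = ∏ i, (κ ω).real (B i)) :
    CondIID m P id G κ Y where
  measurable_past := measurable_id'' hm
  measurableSet_good := hG
  measurable_kernel := hκ
  measurable_sample := hY
  isProbabilityMeasure_kernel := hprob
  law := by
    intro F hF hFG B hB
    have hBm : MeasurableSet {ω' | ∀ i, Y i ω' ∈ B i} := by
      rw [show {ω' | ∀ i, Y i ω' ∈ B i} = ⋂ i, Y i ⁻¹' B i by ext; simp]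
      exact MeasurableSet.iInter fun i => hY i (hB i)
    rw [Set.preimage_id, measure_inter_eq_setLIntegral_of_condExp hm hF hFG hBm
      (fun ω _ => Finset.prod_nonneg fun i _ => measureReal_nonneg) (hlaw B hB)]
    refine setLIntegral_congr_fun (hm _ hF) fun ω hω => ?_
    have := hprob ω (hFG hω)
    simp only [id]
    rw [ENNReal.ofReal_prod_of_nonneg fun i _ => measureReal_nonneg]
    exact Finset.prod_congr rfl fun i _ => ofReal_measureReal

end CondExpLaw

/-! ### Bounds and measurability for the auxiliary particle filter -/

namespace APF

variable {X : Type*} [MeasurableSpace X] {H : DominatedHMM X} (A : APF H)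

/-- All the functions defining the model and the filter are bounded by `C` up to time `T`. -/
structure Bounds (T : ℕ) (C : ℝ) : Prop where
  one_le : 1 ≤ C
  g_le : ∀ t ≤ T, ∀ x, H.g t x ≤ C
  ϑ_le : ∀ t < T, ∀ x, A.ϑ (t + 1) x ≤ C
  w₀_le : ∀ᵐ x ∂A.ρ₀, A.w₀ x ≤ C
  w_le : ∀ t < T, ∀ x x', A.w (t + 1) x x' ≤ C
  m_le : ∀ x x', H.m x x' ≤ C

variable {A}

lemma exists_bounds {T : ℕ} (hlik : H.BoundedLikelihood T) (hweights : A.BoundedWeights T)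
    (hdens : A.BoundedDensities T) : ∃ C, A.Bounds T C := by
  obtain ⟨-, c1, h1⟩ := hlik
  obtain ⟨⟨c2, h2⟩, ⟨c3, h3⟩, ⟨c4, h4⟩⟩ := hweights
  obtain ⟨⟨c5, h5⟩, -⟩ := hdens
  set C := max 1 (max c1 (max c2 (max c3 (max c4 c5)))) with hC
  have e1 : c1 ≤ C := by simp [hC]
  have e2 : c2 ≤ C := by simp [hC]
  have e3 : c3 ≤ C := by simp [hC]
  have e4 : c4 ≤ C := by simp [hC]
  have e5 : c5 ≤ C := by simp [hC]
  exact ⟨C, le_max_left _ _, fun t ht x => (h1 t ht x).trans e1,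
    fun t ht x => (h2 (t + 1) (by omega) (by omega) x).trans e2,
    h3.mono fun x hx => hx.trans e3,
    fun t ht x x' => (h4 (t + 1) (by omega) (by omega) x x').trans e4,
    fun x x' => (h5 x x').trans e5⟩

lemma w₀_nonneg (x : X) : 0 ≤ A.w₀ x := mul_nonneg ENNReal.toReal_nonneg (H.g_nonneg _ _)

lemma w_nonneg (t : ℕ) (x x' : X) : 0 ≤ A.w t x x' :=
  div_nonneg (mul_nonneg (H.m_nonneg _ _) (H.g_nonneg _ _))
    (mul_nonneg (A.ϑ_pos _ _).le (A.p_nonneg _ _ _))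

lemma measurable_w₀ : Measurable A.w₀ :=
  (Measure.measurable_rnDeriv _ _).ennreal_toReal.mul (H.measurable_g 0)

lemma measurable_w (t : ℕ) : Measurable fun p : X × X => A.w t p.1 p.2 :=
  (H.measurable_m.mul ((H.measurable_g t).comp measurable_snd)).div
    (((A.measurable_ϑ t).comp measurable_fst).mul (A.measurable_p t))

instance isMarkovKernel_proposal (t : ℕ) : IsMarkovKernel (A.proposal t) :=
  isMarkovKernel_densityKernel (A.measurable_p t) (A.lintegral_p t)

lemma integral_proposal (t : ℕ) (x : X) (f : X → ℝ) :
    ∫ z, f z ∂(A.proposal t x) = ∫ z, A.p t x z * f z ∂H.ν :=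
  integral_densityKernel (A.measurable_p t) (A.p_nonneg t) x f

lemma ϑ_mul_p_mul_w (t : ℕ) (x z : X) :
    A.ϑ t x * (A.p t x z * A.w t x z) = H.m x z * H.g t z := by
  have hϑ := (A.ϑ_pos t x).ne'
  by_cases hp : A.p t x z = 0
  · simp [hp, A.p_dominates t x z hp]
  · unfold w
    field_simp

lemma ϑ_mul_integral_proposal (t : ℕ) (x : X) (f : X → ℝ) :
    A.ϑ t x * ∫ z, A.w t x z * f z ∂(A.proposal t x) = ∫ z, H.g t z * f z ∂(H.M x) := by
  rw [integral_proposal, H.integral_M, ← integral_const_mul]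
  congr 1 with z
  rw [← mul_assoc (H.m x z), ← ϑ_mul_p_mul_w]
  ring

lemma integral_w₀_mul (f : X → ℝ) : ∫ x, A.w₀ x * f x ∂A.ρ₀ = ∫ x, f x ∂(H.unfilt 0) := by
  rw [DominatedHMM.BoundedLikelihood.integral_unfilt_zero, ← integral_rnDeriv_smul A.χ_ac]
  congr 1 with x
  simp only [w₀, smul_eq_mul]
  ring

end APF

namespace ParticleArray

open scoped ENNReal

variable {Ω X : Type*} [MeasurableSpace X] {H : DominatedHMM X} {T N : ℕ}
  (S : ParticleArray Ω X T N) (A : APF H)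

/-- The unbiased estimator of the normalising constant of the law of the particles at time `t`. -/
noncomputable def normConst : ℕ → Ω → ℝ
  | 0, _ => 1
  | t + 1, ω => normConst t ω *
      ((N : ℝ)⁻¹ * ∑ k, S.weight A t k ω * A.ϑ (t + 1) (S.ξ t k ω))

/-- The unnormalised empirical measure of the weighted particles at time `t`. -/
noncomputable def emp (ω : Ω) (t : ℕ) : Measure X :=
  ∑ k, ENNReal.ofReal (S.normConst A t ω * ((N : ℝ)⁻¹ * S.weight A t k ω)) •
    Measure.dirac (S.ξ t k ω)

/-- The event that the samples up to time `t` can be normalised and the initial weights are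
bounded. -/
def good (C : ℝ) (t : ℕ) : Set Ω := {ω | S.Nondegenerate A t ω ∧ ∀ i, S.weight A 0 i ω ≤ C}

variable {S A}

lemma weight_nonneg (t : ℕ) (i : Fin N) (ω : Ω) : 0 ≤ S.weight A t i ω := by
  cases t with
  | zero => exact APF.w₀_nonneg _
  | succ t => exact APF.w_nonneg _ _ _

lemma normConst_nonneg (t : ℕ) (ω : Ω) : 0 ≤ S.normConst A t ω := by
  induction t with
  | zero => exact zero_le_one
  | succ t ih =>
    exact mul_nonneg ih (mul_nonneg (by positivity) (Finset.sum_nonneg fun k _ =>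
      mul_nonneg (weight_nonneg _ _ _) (A.ϑ_pos _ _).le))

instance isFiniteMeasure_emp (ω : Ω) (t : ℕ) : IsFiniteMeasure (S.emp A ω t) := by
  unfold emp
  have : ∀ k, IsFiniteMeasure (ENNReal.ofReal (S.normConst A t ω * ((N : ℝ)⁻¹ *
      S.weight A t k ω)) • Measure.dirac (S.ξ t k ω)) := fun k =>
    Measure.smul_finite _ ENNReal.ofReal_ne_top
  infer_instance

lemma integral_emp [MeasurableSingletonClass X] (ω : Ω) (t : ℕ) (f : X → ℝ) :
    ∫ x, f x ∂(S.emp A ω t) =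
      S.normConst A t ω * ((N : ℝ)⁻¹ * ∑ k, S.weight A t k ω * f (S.ξ t k ω)) := by
  unfold emp
  rw [integral_finsetSum_measure]
  · rw [Finset.mul_sum, Finset.mul_sum]
    refine Finset.sum_congr rfl fun k _ => ?_
    rw [integral_smul_measure, integral_dirac, ENNReal.toReal_ofReal, smul_eq_mul]
    · ring
    · exact mul_nonneg (normConst_nonneg _ _) (mul_nonneg (by positivity) (weight_nonneg _ _ _))
  · intro k _
    exact (integrable_dirac (by simp)).smul_measure ENNReal.ofReal_ne_top

lemma weight_le {C : ℝ} (hb : A.Bounds T C) {t s : ℕ} (ht : t ≤ T) {ω : Ω}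
    (h : ω ∈ S.good A C s) (i : Fin N) : S.weight A t i ω ≤ C := by
  cases t with
  | zero => exact h.2 i
  | succ t => exact hb.w_le t (by omega) _ _

lemma inv_mul_sum_le {c : Fin N → ℝ} {K : ℝ} (hK : 0 ≤ K) (h : ∀ i, c i ≤ K) :
    (N : ℝ)⁻¹ * ∑ i, c i ≤ K := by
  rcases Nat.eq_zero_or_pos N with hN | hN
  · subst hN; simpa using hK
  · have hN0 : (0 : ℝ) < N := by exact_mod_cast hN
    rw [inv_mul_le_iff₀ hN0]
    calc ∑ i, c i ≤ ∑ _i : Fin N, K := Finset.sum_le_sum fun i _ => h i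
      _ = N * K := by simp

lemma normConst_le {C : ℝ} (hb : A.Bounds T C) {t s : ℕ} (ht : t ≤ T) {ω : Ω}
    (h : ω ∈ S.good A C s) : S.normConst A t ω ≤ (C * C) ^ t := by
  have hC : 0 ≤ C := zero_le_one.trans hb.one_le
  induction t with
  | zero => simp [normConst]
  | succ t ih =>
    rw [normConst, pow_succ]
    refine mul_le_mul (ih (by omega)) (inv_mul_sum_le (by positivity) fun i => ?_)
      (mul_nonneg (by positivity) (Finset.sum_nonneg fun k _ =>
        mul_nonneg (weight_nonneg _ _ _) (A.ϑ_pos _ _).le)) (by positivity)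
    exact mul_le_mul (weight_le hb (by omega) h i) (hb.ϑ_le t (by omega) _) (A.ϑ_pos _ _).le hC

lemma normConst_pos {t : ℕ} {ω : Ω} (h : ∀ s < t, 0 < S.sumWeight A s ω) :
    0 < S.normConst A t ω := by
  induction t with
  | zero => exact one_pos
  | succ t ih =>
    have hw := h t (by omega)
    have hN : (0 : ℝ) < N := by
      rcases Nat.eq_zero_or_pos N with hN | hN
      · subst hN; simp [sumWeight] at hw
      · exact_mod_cast hN
    refine mul_pos (ih fun s hs => h s (by omega)) (mul_pos (inv_pos.2 hN) ?_)
    obtain ⟨k, hk, hk0⟩ := Finset.exists_lt_of_sum_lt (s := Finset.univ) (f := fun _ : Fin N => 0)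
      (g := fun k => S.weight A t k ω) (by simpa [sumWeight] using hw)
    exact Finset.sum_pos' (fun i _ => mul_nonneg (weight_nonneg _ _ _) (A.ϑ_pos _ _).le)
      ⟨k, hk, mul_pos hk0 (A.ϑ_pos _ _)⟩

/-! #### Measurability -/

section Meas

variable {m : MeasurableSpace Ω}

lemma measurable_ξ_of_past_le {t s : ℕ} (hm : S.past A t ≤ m) (hs : s ≤ t) (i : Fin N) :
    Measurable[m] (S.ξ s i) := by
  refine Measurable.mono (ma := MeasurableSpace.comap (S.ξ s i) inferInstance)
    (comap_measurable _) (le_trans ?_ hm) le_rfl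
  refine le_trans ?_ (le_iSup₂ (f := fun s (_ : s ∈ Finset.range (t + 1)) => ⨆ i : Fin N,
    MeasurableSpace.comap (S.ξ s i) inferInstance ⊔
      MeasurableSpace.comap (S.weight A s i) inferInstance) s (by simp; omega))
  exact le_trans le_sup_left (le_iSup (fun i : Fin N =>
    MeasurableSpace.comap (S.ξ s i) inferInstance ⊔
      MeasurableSpace.comap (S.weight A s i) inferInstance) i)

lemma measurable_weight_of_past_le {t s : ℕ} (hm : S.past A t ≤ m) (hs : s ≤ t) (i : Fin N) :
    Measurable[m] (S.weight A s i) := by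
  refine Measurable.mono (ma := MeasurableSpace.comap (S.weight A s i) inferInstance)
    (comap_measurable _) (le_trans ?_ hm) le_rfl
  refine le_trans ?_ (le_iSup₂ (f := fun s (_ : s ∈ Finset.range (t + 1)) => ⨆ i : Fin N,
    MeasurableSpace.comap (S.ξ s i) inferInstance ⊔
      MeasurableSpace.comap (S.weight A s i) inferInstance) s (by simp; omega))
  exact le_trans le_sup_right (le_iSup (fun i : Fin N =>
    MeasurableSpace.comap (S.ξ s i) inferInstance ⊔
      MeasurableSpace.comap (S.weight A s i) inferInstance) i)

lemma measurable_normConst_of_past_le {t s : ℕ} (hm : S.past A t ≤ m) (hs : s ≤ t + 1) :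
    Measurable[m] (S.normConst A s) := by
  induction s with
  | zero => exact measurable_const
  | succ s ih =>
    refine (ih (by omega)).mul ((Finset.measurable_sum _ fun k _ => ?_).const_mul _)
    exact (measurable_weight_of_past_le hm (by omega) k).mul
      ((A.measurable_ϑ _).comp (measurable_ξ_of_past_le hm (by omega) k))

lemma measurableSet_good {C : ℝ} {t s : ℕ} (hm : S.past A t ≤ m) (hs : s ≤ t) :
    MeasurableSet[m] (S.good A C s) := by
  have : S.good A C s = (⋂ r ∈ Finset.range (s + 1), {ω | 0 < S.sumWeight A r ω}) ∩
      ⋂ i, {ω | S.weight A 0 i ω ≤ C} := by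
    ext ω
    simp [good, Nondegenerate]
  rw [this]
  refine MeasurableSet.inter (Finset.measurableSet_biInter _ fun r hr => ?_)
    (MeasurableSet.iInter fun i => ?_)
  · refine measurableSet_lt measurable_const (Finset.measurable_sum _ fun k _ => ?_)
    exact measurable_weight_of_past_le hm (by simp at hr; omega) k
  · exact measurableSet_le (measurable_weight_of_past_le hm (by omega) i) measurable_const

lemma measurableIntegral_emp [MeasurableSingletonClass X] {t s : ℕ} (hm : S.past A t ≤ m)
    (hs : s ≤ t) : DominatedHMM.MeasurableIntegral m (fun ω => S.emp A ω s) := by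
  intro F hF
  simp only [integral_emp]
  refine ((measurable_normConst_of_past_le hm (by omega)).comp measurable_fst).mul
    ((Finset.measurable_sum _ fun k _ => ?_).const_mul _)
  exact ((measurable_weight_of_past_le hm hs k).comp measurable_fst).mul
    (hF.comp (measurable_id.prodMk ((measurable_ξ_of_past_le hm hs k).comp measurable_fst)))

end Meas

variable [mΩ : MeasurableSpace Ω] {P : Measure Ω}

lemma IsFFBSi.measurable_weight (hS : S.IsFFBSi A P) (t : ℕ) (i : Fin N) :
    Measurable (S.weight A t i) := by
  cases t with
  | zero => exact APF.measurable_w₀.comp (hS.measurable_ξ 0 i)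
  | succ t =>
    have h1 : Measurable fun ω => S.ξ t (S.I (t + 1) i ω) ω :=
      (measurable_from_prod_countable_right (f := fun p : Fin N × Ω => S.ξ t p.1 p.2)
        fun k => hS.measurable_ξ t k).comp ((hS.measurable_I (t + 1) i).prodMk measurable_id)
    exact (APF.measurable_w (t + 1)).comp (h1.prodMk (hS.measurable_ξ (t + 1) i))

lemma IsFFBSi.past_le (hS : S.IsFFBSi A P) (t : ℕ) : S.past A t ≤ mΩ :=
  iSup₂_le fun _ _ => iSup_le fun i => sup_le (hS.measurable_ξ _ i).comap_le
    (hS.measurable_weight _ i).comap_le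

end ParticleArray

section MeasurabilityTools

variable {Θ X : Type*} {mΘ : MeasurableSpace Θ} [MeasurableSpace X]

lemma measurable_integral_kernel_comp (κ : Kernel X X) [IsSFiniteKernel κ] {ζ : Θ → X}
    (hζ : Measurable ζ) {F : Θ × X → ℝ} (hF : Measurable F) :
    Measurable fun θ => ∫ z, F (θ, z) ∂(κ (ζ θ)) :=
  (hF.stronglyMeasurable.integral_kernel_prod_right' (κ := κ.comap ζ hζ)).measurable

lemma measurable_indexed_product {N : ℕ} {ζ : Fin N → Θ → X} (hζ : ∀ k, Measurable (ζ k))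
    {c : Θ → ℝ} (hc : Measurable c) {w : X × X → ℝ} (hw : Measurable w) {φ : Θ × X → ℝ}
    (hφ : Measurable φ) :
    Measurable fun q : Θ × (Fin N × X) => c q.1 * (w (ζ q.2.1 q.1, q.2.2) * φ (q.1, q.2.2)) := by
  have h1 : Measurable fun q : Θ × (Fin N × X) => ζ q.2.1 q.1 :=
    (measurable_from_prod_countable_right (f := fun p : Fin N × Θ => ζ p.1 p.2) hζ).comp
      ((measurable_fst.comp measurable_snd).prodMk measurable_fst)
  have h2 : Measurable fun q : Θ × (Fin N × X) => q.2.2 := measurable_snd.comp measurable_snd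
  exact (hc.comp measurable_fst).mul ((hw.comp (h1.prodMk h2)).mul
    (hφ.comp (measurable_fst.prodMk h2)))

end MeasurabilityTools

namespace ParticleArray

open scoped ENNReal

variable {Ω X : Type*} [MeasurableSpace X] {H : DominatedHMM X} {T N : ℕ}
  {S : ParticleArray Ω X T N} {A : APF H}

/-! ### The sampling steps of the algorithm as conditionally i.i.d. samples -/

lemma instrumental_apply (t : ℕ) (ω : Ω) {B : Set (Fin N × X)} (hB : MeasurableSet B) :
    S.instrumental A t ω B = ∑ k, ENNReal.ofReal (S.weight A t k ω * A.ϑ (t + 1) (S.ξ t k ω) /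
      ∑ l, S.weight A t l ω * A.ϑ (t + 1) (S.ξ t l ω)) *
        A.proposal (t + 1) (S.ξ t k ω) (Prod.mk k ⁻¹' B) := by
  simp only [instrumental, Measure.coe_finsetSum, Finset.sum_apply, Measure.smul_apply,
    smul_eq_mul]
  refine Finset.sum_congr rfl fun k _ => ?_
  rw [Measure.dirac_prod, Measure.map_apply measurable_prodMk_left hB]

lemma sum_weight_mul_ϑ_pos {t : ℕ} {ω : Ω} (h : 0 < S.sumWeight A t ω) :
    0 < ∑ l, S.weight A t l ω * A.ϑ (t + 1) (S.ξ t l ω) := by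
  obtain ⟨k, hk, hk0⟩ := Finset.exists_lt_of_sum_lt (s := Finset.univ) (f := fun _ : Fin N => 0)
    (g := fun k => S.weight A t k ω) (by simpa [sumWeight] using h)
  exact Finset.sum_pos' (fun i _ => mul_nonneg (weight_nonneg _ _ _) (A.ϑ_pos _ _).le)
    ⟨k, hk, mul_pos hk0 (A.ϑ_pos _ _)⟩

lemma isProbabilityMeasure_instrumental {t : ℕ} {ω : Ω} (h : 0 < S.sumWeight A t ω) :
    IsProbabilityMeasure (S.instrumental A t ω) := by
  have hD := sum_weight_mul_ϑ_pos h
  refine ⟨?_⟩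
  rw [instrumental_apply t ω MeasurableSet.univ]
  simp only [Set.preimage_univ, measure_univ, mul_one]
  rw [← ENNReal.ofReal_sum_of_nonneg fun k _ => div_nonneg
    (mul_nonneg (weight_nonneg _ _ _) (A.ϑ_pos _ _).le) hD.le, ← Finset.sum_div,
    div_self hD.ne', ENNReal.ofReal_one]

lemma integral_instrumental (t : ℕ) (ω : Ω) {ψ : Fin N × X → ℝ} (hψ : Measurable ψ) {K : ℝ}
    (hK : ∀ y, |ψ y| ≤ K) :
    ∫ y, ψ y ∂(S.instrumental A t ω) =
      ∑ k, S.weight A t k ω * A.ϑ (t + 1) (S.ξ t k ω) /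
        (∑ l, S.weight A t l ω * A.ϑ (t + 1) (S.ξ t l ω)) *
          ∫ x, ψ (k, x) ∂(A.proposal (t + 1) (S.ξ t k ω)) := by
  unfold instrumental
  rw [integral_finsetSum_measure]
  · refine Finset.sum_congr rfl fun k _ => ?_
    rw [integral_smul_measure, Measure.dirac_prod,
      integral_map measurable_prodMk_left.aemeasurable hψ.aestronglyMeasurable,
      ENNReal.toReal_ofReal, smul_eq_mul]
    exact div_nonneg (mul_nonneg (weight_nonneg _ _ _) (A.ϑ_pos _ _).le)
      (Finset.sum_nonneg fun k _ => mul_nonneg (weight_nonneg _ _ _) (A.ϑ_pos _ _).le)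
  · intro k _
    exact (Integrable.of_bound hψ.aestronglyMeasurable K (ae_of_all _ hK)).smul_measure
      ENNReal.ofReal_ne_top

lemma normConst_mul_integral_instrumental [MeasurableSingletonClass X] {t : ℕ} {ω : Ω}
    (h : 0 < S.sumWeight A t ω) {ψ : X × X → ℝ} (hψ : Measurable ψ) {K : ℝ}
    (hK : ∀ y, |ψ y| ≤ K) :
    S.normConst A (t + 1) ω * ∫ y, ψ (S.ξ t y.1 ω, y.2) ∂(S.instrumental A t ω) =
      ∫ u, A.ϑ (t + 1) u * ∫ x, ψ (u, x) ∂(A.proposal (t + 1) u) ∂(S.emp A ω t) := by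
  have hD := (sum_weight_mul_ϑ_pos h).ne'
  have hm : Measurable fun y : Fin N × X => ψ (S.ξ t y.1 ω, y.2) :=
    hψ.comp (((measurable_of_finite fun k : Fin N => S.ξ t k ω).comp
      measurable_fst).prodMk measurable_snd)
  rw [integral_instrumental t ω hm (fun y => hK _), integral_emp, normConst, mul_assoc]
  congr 1
  rw [mul_assoc]
  congr 1
  rw [Finset.mul_sum]
  refine Finset.sum_congr rfl fun k _ => ?_
  field_simp

variable {mΩ : MeasurableSpace Ω} {P : Measure Ω}

lemma IsFFBSi.measurableSet_J (hS : S.IsFFBSi A P) (j : Fin N → Fin (T + 1) → Fin N) :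
    MeasurableSet {ω' | ∀ ℓ t, S.J ℓ t ω' = j ℓ t} := by
  have : {ω' | ∀ ℓ t, S.J ℓ t ω' = j ℓ t} = ⋂ ℓ, ⋂ t, S.J ℓ t ⁻¹' {j ℓ t} := by ext; simp
  rw [this]
  exact MeasurableSet.iInter fun ℓ => MeasurableSet.iInter fun t =>
    hS.measurable_J ℓ t (MeasurableSet.singleton _)

variable [IsProbabilityMeasure P]

lemma measurable_instrumental (t : ℕ) : Measurable[S.past A t] (S.instrumental A t) := by
  refine @Measure.measurable_of_measurable_coe _ _ _ (S.past A t) _ fun B hB => ?_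
  simp only [instrumental_apply _ _ hB]
  refine Finset.measurable_sum _ fun k _ => ?_
  refine Measurable.mul ?_ ?_
  · refine Measurable.ennreal_ofReal (Measurable.div ?_ (Finset.measurable_sum _ fun l _ => ?_))
    · exact (measurable_weight_of_past_le le_rfl le_rfl k).mul
        ((A.measurable_ϑ _).comp (measurable_ξ_of_past_le le_rfl le_rfl k))
    · exact (measurable_weight_of_past_le le_rfl le_rfl l).mul
        ((A.measurable_ϑ _).comp (measurable_ξ_of_past_le le_rfl le_rfl l))
  · exact ((A.proposal (t + 1)).measurable_coe (measurable_prodMk_left hB)).comp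
      (measurable_ξ_of_past_le le_rfl le_rfl k)

lemma IsFFBSi.condIID_init (hS : S.IsFFBSi A P) :
    CondIID (⊥ : MeasurableSpace Ω) P id Set.univ (fun _ => A.ρ₀) (S.ξ 0) := by
  refine condIID_of_condExp bot_le MeasurableSet.univ (@measurable_const _ _ _ ⊥ _)
    (hS.measurable_ξ 0) (fun _ _ => inferInstance) fun B hB => ae_of_all _ fun ω _ => ?_
  have hBm : MeasurableSet {ω' | ∀ i, S.ξ 0 i ω' ∈ B i} := by
    rw [show {ω' | ∀ i, S.ξ 0 i ω' ∈ B i} = ⋂ i, S.ξ 0 i ⁻¹' B i by ext; simp]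
    exact MeasurableSet.iInter fun i => hS.measurable_ξ 0 i (hB i)
  rw [condExp_bot, integral_indicator_const _ hBm, smul_eq_mul, mul_one]
  have := hS.indep_init.measure_inter_preimage_eq_mul (Finset.univ) (sets := B)
    (fun i _ => hB i)
  rw [show {ω' | ∀ i, S.ξ 0 i ω' ∈ B i} = ⋂ i ∈ (Finset.univ : Finset (Fin N)),
    S.ξ 0 i ⁻¹' B i by ext; simp, measureReal_def, this, ENNReal.toReal_prod]
  refine Finset.prod_congr rfl fun i _ => ?_
  rw [measureReal_def, ← hS.law_init i, Measure.map_apply (hS.measurable_ξ 0 i) (hB i)]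

lemma IsFFBSi.condIID_step (hS : S.IsFFBSi A P) (C : ℝ) {t : ℕ} (ht : t < T) :
    CondIID (S.past A t) P id (S.good A C t) (S.instrumental A t)
      (fun i ω => (S.I (t + 1) i ω, S.ξ (t + 1) i ω)) := by
  refine condIID_of_condExp (hS.past_le t) (measurableSet_good le_rfl le_rfl)
    (measurable_instrumental t)
    (fun i => (hS.measurable_I _ i).prodMk (hS.measurable_ξ _ i))
    (fun ω hω => isProbabilityMeasure_instrumental (hω.1 t le_rfl)) fun B hB => ?_
  filter_upwards [hS.law_step t ht B hB] with ω hω hg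
  exact hω hg.1

/-! #### Backward simulation -/

lemma Λ_nonneg (t : ℕ) (ω : Ω) (i j : Fin N) : 0 ≤ S.Λ A t ω i j :=
  div_nonneg (mul_nonneg (weight_nonneg _ _ _) (H.m_nonneg _ _))
    (Finset.sum_nonneg fun _ _ => mul_nonneg (weight_nonneg _ _ _) (H.m_nonneg _ _))

lemma pathProb_nonneg (ω : Ω) (j : Fin (T + 1) → Fin N) : 0 ≤ S.pathProb A ω j :=
  mul_nonneg (div_nonneg (weight_nonneg _ _ _) (Finset.sum_nonneg fun _ _ => weight_nonneg _ _ _))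
    (Finset.prod_nonneg fun _ _ => Λ_nonneg _ _ _ _)

variable (S A) in
/-- The law of one backward index path. -/
noncomputable def pathLaw (ω : Ω) : Measure (Fin (T + 1) → Fin N) :=
  ∑ j, ENNReal.ofReal (S.pathProb A ω j) • Measure.dirac j

lemma integral_pathLaw (ω : Ω) (ψ : (Fin (T + 1) → Fin N) → ℝ) :
    ∫ j, ψ j ∂(S.pathLaw A ω) = ∑ j, S.pathProb A ω j * ψ j := by
  unfold pathLaw
  rw [integral_finsetSum_measure]
  · refine Finset.sum_congr rfl fun k _ => ?_
    rw [integral_smul_measure, integral_dirac, ENNReal.toReal_ofReal (pathProb_nonneg _ _),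
      smul_eq_mul]
  · intro k _
    exact (integrable_dirac (by simp)).smul_measure ENNReal.ofReal_ne_top

open Classical in
lemma pathLaw_apply (ω : Ω) (B : Set (Fin (T + 1) → Fin N)) :
    S.pathLaw A ω B = ∑ j ∈ Finset.univ.filter (· ∈ B), ENNReal.ofReal (S.pathProb A ω j) := by
  simp only [pathLaw, Measure.coe_finsetSum, Finset.sum_apply, Measure.smul_apply, smul_eq_mul]
  rw [Finset.sum_filter]
  refine Finset.sum_congr rfl fun j _ => ?_
  rw [Measure.dirac_apply' _ (Set.toFinite B).measurableSet]
  by_cases h : j ∈ B <;> simp [h]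

lemma measurable_pathProb {m : MeasurableSpace Ω} (hm : S.past A T ≤ m)
    (j : Fin (T + 1) → Fin N) : Measurable[m] fun ω => S.pathProb A ω j := by
  unfold pathProb Λ sumWeight
  refine Measurable.mul (Measurable.div (measurable_weight_of_past_le hm le_rfl _)
    (Finset.measurable_sum _ fun l _ => measurable_weight_of_past_le hm le_rfl l))
    (Finset.measurable_prod _ fun t _ => Measurable.div ?_ (Finset.measurable_sum _ fun l _ => ?_))
  · exact (measurable_weight_of_past_le hm (by omega) _).mul (H.measurable_m.comp
      ((measurable_ξ_of_past_le hm (by omega) _).prodMk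
        (measurable_ξ_of_past_le hm (by omega) _)))
  · exact (measurable_weight_of_past_le hm (by omega) _).mul (H.measurable_m.comp
      ((measurable_ξ_of_past_le hm (by omega) _).prodMk
        (measurable_ξ_of_past_le hm (by omega) _)))

variable (S A) in
/-- The good event at the final time on which the backward probabilities sum to one. -/
def goodBackward (C : ℝ) : Set Ω := {ω | ω ∈ S.good A C T ∧ ∑ j, S.pathProb A ω j = 1}

lemma measurableSet_goodBackward (C : ℝ) : MeasurableSet[S.past A T] (S.goodBackward A C) :=
  (measurableSet_good le_rfl le_rfl).inter (measurableSet_eq_fun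
    (Finset.measurable_sum _ fun j _ => measurable_pathProb le_rfl j) measurable_const)

lemma IsFFBSi.sum_pathProb_ae (hS : S.IsFFBSi A P) :
    ∀ᵐ ω ∂P, S.Nondegenerate A T ω → ∑ j, S.pathProb A ω j = 1 := by
  have hsum : (fun _ : Ω => (1 : ℝ)) = ∑ j : Fin N → Fin (T + 1) → Fin N,
      {ω' | ∀ ℓ t, S.J ℓ t ω' = j ℓ t}.indicator (fun _ => (1 : ℝ)) := by
    ext ω
    rw [Finset.sum_apply, Finset.sum_eq_single (fun ℓ t => S.J ℓ t ω)]
    · simp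
    · intro j _ hj
      rw [Set.indicator_of_notMem]
      intro h
      exact hj (funext fun ℓ => funext fun t => (h ℓ t).symm)
    · simp
  have h1 : P[fun _ : Ω => (1 : ℝ) | S.past A T] = fun _ => 1 := condExp_const (hS.past_le T) 1
  have h2 : P[fun _ : Ω => (1 : ℝ) | S.past A T] =ᵐ[P] ∑ j : Fin N → Fin (T + 1) → Fin N,
      P⟦{ω' | ∀ ℓ t, S.J ℓ t ω' = j ℓ t} | S.past A T⟧ := by
    have := condExp_finsetSum (μ := P) (s := Finset.univ)
      (f := fun j : Fin N → Fin (T + 1) → Fin N =>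
        {ω' | ∀ ℓ t, S.J ℓ t ω' = j ℓ t}.indicator (fun _ => (1 : ℝ)))
      (fun j _ => (integrable_const 1).indicator (hS.measurableSet_J j)) (S.past A T)
    have h0 := congrArg (fun f : Ω → ℝ => P[f | S.past A T]) hsum
    exact (EventuallyEq.of_eq h0).trans this
  have h3 : ∀ᵐ ω ∂P, ∀ j : Fin N → Fin (T + 1) → Fin N, S.Nondegenerate A T ω →
      (P⟦{ω' | ∀ ℓ t, S.J ℓ t ω' = j ℓ t} | S.past A T⟧) ω = ∏ ℓ, S.pathProb A ω (j ℓ) :=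
    ae_all_iff.2 fun j => hS.law_backward j
  filter_upwards [h2, h3] with ω hω2 hω3 hn
  replace hω2 : (1 : ℝ) = ∑ j : Fin N → Fin (T + 1) → Fin N, ∏ ℓ, S.pathProb A ω (j ℓ) := by
    rw [← Finset.sum_congr rfl fun j _ => hω3 j hn, ← Finset.sum_apply, ← hω2, h1]
  have hN : N ≠ 0 := by
    rintro rfl
    have := hn T le_rfl
    simp [sumWeight] at this
  have h4 : (∑ j, S.pathProb A ω j) ^ N = 1 := by
    have := Finset.prod_univ_sum (fun _ : Fin N => (Finset.univ : Finset (Fin (T + 1) → Fin N)))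
      (fun _ j => S.pathProb A ω j)
    simp only [Finset.prod_const, Finset.card_univ, Fintype.card_fin,
      Fintype.piFinset_univ] at this
    exact this.trans hω2.symm
  exact (pow_eq_one_iff_of_nonneg (Finset.sum_nonneg fun _ _ => pathProb_nonneg _ _) hN).1 h4

lemma IsFFBSi.condIID_backward (hS : S.IsFFBSi A P) (C : ℝ) :
    CondIID (S.past A T) P id (S.goodBackward A C) (S.pathLaw A) (fun ℓ ω t => S.J ℓ t ω) where
  measurable_past := measurable_id'' (hS.past_le T)
  measurableSet_good := measurableSet_goodBackward C
  measurable_kernel := by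
    refine @Measure.measurable_of_measurable_coe _ _ _ (S.past A T) _ fun B _ => ?_
    simp only [pathLaw_apply]
    exact Finset.measurable_sum _ fun j _ => (measurable_pathProb le_rfl j).ennreal_ofReal
  measurable_sample := fun ℓ => measurable_pi_lambda _ fun t => hS.measurable_J ℓ t
  isProbabilityMeasure_kernel := by
    intro ω hω
    refine ⟨?_⟩
    rw [pathLaw_apply]
    simp only [Set.mem_univ, Finset.filter_true]
    rw [← ENNReal.ofReal_sum_of_nonneg fun j _ => pathProb_nonneg _ _, hω.2, ENNReal.ofReal_one]
  law := by
    classical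
    intro F hF hFG B _
    have hF' : MeasurableSet F := hS.past_le T _ hF
    set Q : Finset (Fin N → Fin (T + 1) → Fin N) :=
      Fintype.piFinset fun ℓ => Finset.univ.filter (· ∈ B ℓ) with hQ
    have hset : id ⁻¹' F ∩ {ω | ∀ ℓ, (fun t => S.J ℓ t ω) ∈ B ℓ} =
        ⋃ j ∈ Q, F ∩ {ω | ∀ ℓ t, S.J ℓ t ω = j ℓ t} := by
      ext ω
      simp only [Set.preimage_id, Set.mem_inter_iff, Set.mem_ofPred_eq, Set.mem_iUnion,
        exists_prop, hQ, Fintype.mem_piFinset, Finset.mem_filter, Finset.mem_univ, true_and]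
      constructor
      · rintro ⟨h1, h2⟩
        exact ⟨fun ℓ t => S.J ℓ t ω, h2, h1, fun _ _ => rfl⟩
      · rintro ⟨j, h2, h1, h3⟩
        refine ⟨h1, fun ℓ => ?_⟩
        have : (fun t => S.J ℓ t ω) = j ℓ := funext fun t => h3 ℓ t
        rw [this]
        exact h2 ℓ
    rw [hset, measure_biUnion_finset]
    · have h1 : ∀ j : Fin N → Fin (T + 1) → Fin N, P (F ∩ {ω | ∀ ℓ t, S.J ℓ t ω = j ℓ t}) =
          ∫⁻ ω in F, ENNReal.ofReal (∏ ℓ, S.pathProb A ω (j ℓ)) ∂P := by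
        intro j
        refine measure_inter_eq_setLIntegral_of_condExp (hS.past_le T) hF hFG
          (hS.measurableSet_J j) (fun ω _ => Finset.prod_nonneg fun _ _ => pathProb_nonneg _ _) ?_
        filter_upwards [hS.law_backward j] with ω hω hg
        exact hω hg.1.1
      simp only [h1]
      rw [← lintegral_finsetSum]
      · refine setLIntegral_congr_fun hF' fun ω _ => ?_
        simp only [pathLaw_apply, id]
        rw [Finset.prod_univ_sum]
        exact Finset.sum_congr rfl fun j _ =>
          ENNReal.ofReal_prod_of_nonneg fun _ _ => pathProb_nonneg _ _
      · intro j _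
        exact (Finset.measurable_prod _ fun ℓ _ =>
          measurable_pathProb (hS.past_le T) (j ℓ)).ennreal_ofReal
    · intro j _ j' _ hjj
      refine Set.disjoint_left.2 fun ω h1 h2 => hjj ?_
      funext ℓ t
      rw [← h1.2 ℓ t, ← h2.2 ℓ t]
    · intro j _
      exact hF'.inter (hS.measurableSet_J j)

end ParticleArray

namespace ParticleArray

open scoped ENNReal Topology
open Function (update)

variable {Ω X : Type*} [MeasurableSpace X] {H : DominatedHMM X} {T N : ℕ}
  {S : ParticleArray Ω X T N} {A : APF H}

/-! ### One step of the particle filter -/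

section Meas

variable [MeasurableSingletonClass X] {m : MeasurableSpace Ω}

lemma measurable_integral_emp {t s : ℕ} (hm : S.past A t ≤ m) (hs : s ≤ t) {F : Ω × X → ℝ}
    (hF : Measurable F) : Measurable[m] fun ω => ∫ u, F (ω, u) ∂(S.emp A ω s) := by
  simp only [integral_emp]
  refine (measurable_normConst_of_past_le hm (by omega)).mul
    ((Finset.measurable_sum _ fun k _ => ?_).const_mul _)
  exact (measurable_weight_of_past_le hm hs k).mul
    (hF.comp (measurable_id.prodMk (measurable_ξ_of_past_le hm hs k)))

lemma measurable_integral_M_emp {t : ℕ} (hm : S.past A t ≤ m) {φ : Ω × X → ℝ}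
    (hφ : Measurable φ) :
    Measurable[m] fun ω => ∫ u, ∫ z, H.g (t + 1) z * φ (ω, z) ∂(H.M u) ∂(S.emp A ω t) := by
  refine measurable_integral_emp hm le_rfl
    (F := fun q => ∫ z, H.g (t + 1) z * φ (q.1, z) ∂(H.M q.2)) ?_
  exact measurable_integral_kernel_comp H.M (Θ := Ω × X) measurable_snd
    (F := fun q : (Ω × X) × X => H.g (t + 1) q.2 * φ (q.1.1, q.2))
    (((H.measurable_g _).comp measurable_snd).mul
      (hφ.comp ((measurable_fst.comp measurable_fst).prodMk measurable_snd)))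

lemma measurable_integral_proposal_emp {t : ℕ} (hm : S.past A t ≤ m) {φ : Ω × X → ℝ}
    (hφ : Measurable φ) :
    Measurable[m] fun ω => ∫ u, A.ϑ (t + 1) u *
      ∫ x, A.w (t + 1) u x ^ 2 * φ (ω, x) ^ 2 ∂(A.proposal (t + 1) u) ∂(S.emp A ω t) := by
  refine measurable_integral_emp hm le_rfl (F := fun q => A.ϑ (t + 1) q.2 *
      ∫ x, A.w (t + 1) q.2 x ^ 2 * φ (q.1, x) ^ 2 ∂(A.proposal (t + 1) q.2)) ?_
  refine ((A.measurable_ϑ _).comp measurable_snd).mul ?_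
  exact measurable_integral_kernel_comp (A.proposal (t + 1)) (Θ := Ω × X) measurable_snd
    (F := fun q : (Ω × X) × X => A.w (t + 1) q.1.2 q.2 ^ 2 * φ (q.1.1, q.2) ^ 2)
    ((((APF.measurable_w _).comp ((measurable_snd.comp measurable_fst).prodMk
        measurable_snd)).pow_const 2).mul
      ((hφ.comp ((measurable_fst.comp measurable_fst).prodMk measurable_snd)).pow_const 2))

lemma measurable_gbwd_emp {t s : ℕ} (hm : S.past A t ≤ m) (hs : s ≤ t + 1) {f : (ℕ → X) → ℝ}
    (hf : Measurable f) (y : ℕ → X) :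
    Measurable fun q : Ω × X => H.gbwd (S.emp A q.1) s f (update y s q.2) := by
  have h1 : ∀ r < s, DominatedHMM.MeasurableIntegral m fun ω => S.emp A ω r :=
    fun r hr => measurableIntegral_emp hm (by omega)
  have := DominatedHMM.measurable_gbwd (H := H) (mΘ := m) (η := fun ω => S.emp A ω) (t := s)
    h1 (f := fun q => f q.2)
    (hf.comp measurable_snd)
  have h2 : Measurable fun q : Ω × X => (q.1, update y s q.2) := measurable_fst.prodMk
    ((DominatedHMM.measurable_update_pair s).comp
      ((measurable_const (a := y)).prodMk measurable_snd))
  have h3 := this.comp h2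
  simp only [Function.comp_def] at h3
  exact h3

lemma measurable_pathInt_emp {t s : ℕ} (hm : S.past A t ≤ m) (hs : s ≤ t) {f : (ℕ → X) → ℝ}
    (hf : Measurable f) (y : ℕ → X) :
    Measurable[m] fun ω => H.pathInt (S.emp A ω) s f y :=
  measurable_integral_emp hm hs (F := fun q => H.gbwd (S.emp A q.1) s f (update y s q.2))
    (measurable_gbwd_emp hm (by omega) hf y)

end Meas

lemma abs_normConst_mul_le {C : ℝ} (hb : A.Bounds T C) {t s : ℕ} (ht : t < T) {ω : Ω}
    (h : ω ∈ S.good A C s) (u x : X) {b K : ℝ} (hK : |b| ≤ K) :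
    |S.normConst A (t + 1) ω * (A.w (t + 1) u x * b)| ≤ (C * C) ^ (t + 1) * (C * K) := by
  have hC : 0 ≤ C := zero_le_one.trans hb.one_le
  rw [abs_mul, abs_mul, abs_of_nonneg (normConst_nonneg _ _), abs_of_nonneg (APF.w_nonneg _ _ _)]
  have h1 := normConst_le (t := t + 1) hb (by omega) h
  have h2 := hb.w_le t ht u x
  have h3 := APF.w_nonneg (A := A) (t + 1) u x
  gcongr

section Step

variable [MeasurableSingletonClass X]

lemma integral_emp_succ (t : ℕ) (ω : Ω) (φ : X → ℝ) :
    ∫ x, φ x ∂(S.emp A ω (t + 1)) = (N : ℝ)⁻¹ * ∑ i, S.normConst A (t + 1) ω *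
      (A.w (t + 1) (S.ξ t (S.I (t + 1) i ω) ω) (S.ξ (t + 1) i ω) * φ (S.ξ (t + 1) i ω)) := by
  rw [integral_emp, ← Finset.mul_sum, mul_left_comm]
  rfl

lemma integral_instrumental_mul {C : ℝ} (hb : A.Bounds T C) {t : ℕ} (ht : t < T) {ω : Ω}
    (h : 0 < S.sumWeight A t ω) {φ : X → ℝ} (hφ : Measurable φ) {K : ℝ} (hK : ∀ x, |φ x| ≤ K) :
    ∫ y, S.normConst A (t + 1) ω * (A.w (t + 1) (S.ξ t y.1 ω) y.2 * φ y.2)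
        ∂(S.instrumental A t ω) =
      ∫ u, ∫ z, H.g (t + 1) z * φ z ∂(H.M u) ∂(S.emp A ω t) := by
  have hC : 0 ≤ C := zero_le_one.trans hb.one_le
  rw [integral_const_mul, normConst_mul_integral_instrumental h
    (ψ := fun p => A.w (t + 1) p.1 p.2 * φ p.2) (K := C * K)]
  · simp only [APF.ϑ_mul_integral_proposal]
  · exact (APF.measurable_w _).mul (hφ.comp measurable_snd)
  · intro p
    rw [abs_mul, abs_of_nonneg (APF.w_nonneg _ _ _)]
    exact mul_le_mul (hb.w_le t ht _ _) (hK _) (abs_nonneg _) hC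

lemma integral_instrumental_mul_sq {C : ℝ} (hb : A.Bounds T C) {t : ℕ} (ht : t < T) {ω : Ω}
    (h : 0 < S.sumWeight A t ω) {φ : X → ℝ} (hφ : Measurable φ) {K : ℝ} (hK : ∀ x, |φ x| ≤ K) :
    ∫ y, (S.normConst A (t + 1) ω * (A.w (t + 1) (S.ξ t y.1 ω) y.2 * φ y.2)) ^ 2
        ∂(S.instrumental A t ω) =
      S.normConst A (t + 1) ω * ∫ u, A.ϑ (t + 1) u *
        ∫ x, A.w (t + 1) u x ^ 2 * φ x ^ 2 ∂(A.proposal (t + 1) u) ∂(S.emp A ω t) := by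
  have hC : 0 ≤ C := zero_le_one.trans hb.one_le
  rw [← normConst_mul_integral_instrumental h
    (ψ := fun p => A.w (t + 1) p.1 p.2 ^ 2 * φ p.2 ^ 2) (K := C ^ 2 * K ^ 2)]
  · simp only [mul_pow]
    rw [integral_const_mul, ← mul_assoc, ← sq]
  · exact ((APF.measurable_w _).pow_const 2).mul ((hφ.comp measurable_snd).pow_const 2)
  · intro p
    rw [abs_mul, abs_pow, abs_pow, abs_of_nonneg (APF.w_nonneg _ _ _)]
    have h1 := hb.w_le t ht p.1 p.2
    have h2 := hK p.2
    have h3 := APF.w_nonneg (A := A) (t + 1) p.1 p.2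
    gcongr

variable {mΩ : MeasurableSpace Ω} {P : Measure Ω} [IsProbabilityMeasure P]

lemma IsFFBSi.setIntegral_step_sq_le (hS : S.IsFFBSi A P) (hN : 1 ≤ N) {C : ℝ}
    (hb : A.Bounds T C) {t : ℕ} (ht : t < T) {φ : Ω × X → ℝ}
    (hφ : Measurable[(S.past A t).prod inferInstance] φ) {K : ℝ} (hK : ∀ q, |φ q| ≤ K) :
    ∫ ω in S.good A C t, (∫ x, φ (ω, x) ∂(S.emp A ω (t + 1)) -
        ∫ u, ∫ z, H.g (t + 1) z * φ (ω, z) ∂(H.M u) ∂(S.emp A ω t)) ^ 2 ∂P ≤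
      ((C * C) ^ (t + 1) * (C * K)) ^ 2 / N := by
  have := (hS.condIID_step C ht).setIntegral_sq_le hN
    (a := fun q => S.normConst A (t + 1) q.1 *
      (A.w (t + 1) (S.ξ t q.2.1 q.1) q.2.2 * φ (q.1, q.2.2)))
    (measurable_indexed_product (fun k => measurable_ξ_of_past_le le_rfl le_rfl k)
      (measurable_normConst_of_past_le le_rfl le_rfl) (APF.measurable_w (t + 1)) hφ)
    (K := (C * C) ^ (t + 1) * (C * K))
    (fun ω hω y => abs_normConst_mul_le hb ht hω _ _ (hK _))
    (measurable_integral_M_emp le_rfl hφ)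
    (fun ω hω => (integral_instrumental_mul hb ht (hω.1 t le_rfl)
      (φ := fun x => φ (ω, x)) (hφ.comp measurable_prodMk_left) (fun x => hK _)).symm)
  simp only [integral_emp_succ]
  exact this

lemma IsFFBSi.norm_setIntegral_exp_step_le (hS : S.IsFFBSi A P) (hN : 1 ≤ N) {C : ℝ}
    (hb : A.Bounds T C) {t : ℕ} (ht : t < T) {φ : Ω × X → ℝ}
    (hφ : Measurable[(S.past A t).prod inferInstance] φ) {K : ℝ} (hK0 : 0 ≤ K)
    (hK : ∀ q, |φ q| ≤ K) {u : ℝ} (hu : 2 * ((C * C) ^ (t + 1) * (C * K)) * |u| ≤ √N) :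
    ‖∫ ω in S.good A C t,
        (Complex.exp (((u * (√N * ∫ x, φ (ω, x) ∂(S.emp A ω (t + 1))) : ℝ) : ℂ) * Complex.I) -
        Complex.exp (((u * (√N * ∫ u, ∫ z, H.g (t + 1) z * φ (ω, z) ∂(H.M u)
          ∂(S.emp A ω t)) : ℝ) : ℂ) * Complex.I) *
        ((Real.exp (-(u ^ 2 * (S.normConst A (t + 1) ω * (∫ u, A.ϑ (t + 1) u *
          ∫ x, A.w (t + 1) u x ^ 2 * φ (ω, x) ^ 2 ∂(A.proposal (t + 1) u) ∂(S.emp A ω t)) -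
          (∫ u, ∫ z, H.g (t + 1) z * φ (ω, z) ∂(H.M u) ∂(S.emp A ω t)) ^ 2) / 2)) : ℝ) : ℂ)) ∂P‖
      ≤ 2 * (2 * ((C * C) ^ (t + 1) * (C * K)) * |u|) ^ 3 / √N := by
  have hC : 0 ≤ C := zero_le_one.trans hb.one_le
  have := (hS.condIID_step C ht).norm_setIntegral_exp_sub_le hN
    (a := fun q => S.normConst A (t + 1) q.1 *
      (A.w (t + 1) (S.ξ t q.2.1 q.1) q.2.2 * φ (q.1, q.2.2)))
    (measurable_indexed_product (fun k => measurable_ξ_of_past_le le_rfl le_rfl k)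
      (measurable_normConst_of_past_le le_rfl le_rfl) (APF.measurable_w (t + 1)) hφ)
    (K := (C * C) ^ (t + 1) * (C * K)) (by positivity)
    (fun ω hω y => abs_normConst_mul_le hb ht hω _ _ (hK _))
    (measurable_integral_M_emp le_rfl hφ)
    (s := fun ω => S.normConst A (t + 1) ω * ∫ u, A.ϑ (t + 1) u *
      ∫ x, A.w (t + 1) u x ^ 2 * φ (ω, x) ^ 2 ∂(A.proposal (t + 1) u) ∂(S.emp A ω t))
    ((measurable_normConst_of_past_le le_rfl le_rfl).mul
      (measurable_integral_proposal_emp le_rfl hφ))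
    (fun ω hω => (integral_instrumental_mul hb ht (hω.1 t le_rfl)
      (φ := fun x => φ (ω, x)) (hφ.comp measurable_prodMk_left) (fun x => hK _)).symm)
    (fun ω hω => (integral_instrumental_mul_sq hb ht (hω.1 t le_rfl)
      (φ := fun x => φ (ω, x)) (hφ.comp measurable_prodMk_left) (fun x => hK _)).symm) hu
  simp only [integral_emp_succ]
  exact this

end Step

end ParticleArray

namespace ParticleArray

open scoped ENNReal Topology
open Function (update)

section Init

variable {Ω X : Type*} [MeasurableSpace X] {H : DominatedHMM X} {T N : ℕ}
  {S : ParticleArray Ω X T N} {A : APF H} {mΩ : MeasurableSpace Ω} {P : Measure Ω}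

lemma abs_inv_mul_sum_le {c : Fin N → ℝ} {K : ℝ} (hK : 0 ≤ K) (h : ∀ i, |c i| ≤ K) :
    |(N : ℝ)⁻¹ * ∑ i, c i| ≤ K := by
  rw [abs_mul, abs_of_nonneg (by positivity : (0 : ℝ) ≤ (N : ℝ)⁻¹)]
  exact (mul_le_mul_of_nonneg_left (Finset.abs_sum_le_sum_abs _ _) (by positivity)).trans
    (inv_mul_sum_le hK h)

lemma IsFFBSi.weight_zero_le_ae (hS : S.IsFFBSi A P) {C : ℝ} (hb : A.Bounds T C) :
    ∀ᵐ ω ∂P, ∀ i, S.weight A 0 i ω ≤ C := by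
  refine ae_all_iff.2 fun i => ?_
  have := hb.w₀_le
  rw [← hS.law_init i] at this
  exact ae_of_ae_map (hS.measurable_ξ 0 i).aemeasurable this

lemma integral_min_w₀_mul {C : ℝ} (hb : A.Bounds T C) (f : X → ℝ) :
    ∫ x, min (A.w₀ x) C * f x ∂A.ρ₀ = ∫ x, f x ∂(H.unfilt 0) := by
  rw [← APF.integral_w₀_mul]
  refine integral_congr_ae ?_
  filter_upwards [hb.w₀_le] with x hx
  rw [min_eq_left hx]

lemma abs_min_w₀_mul_le {C : ℝ} (hC : 0 ≤ C) (x : X) {b K : ℝ} (hK : |b| ≤ K) :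
    |min (A.w₀ x) C * b| ≤ C * K := by
  rw [abs_mul, abs_of_nonneg (le_min (APF.w₀_nonneg _) hC)]
  exact mul_le_mul (min_le_right _ _) hK (abs_nonneg _) hC

lemma integral_emp_zero [MeasurableSingletonClass X] {C : ℝ} {ω : Ω}
    (h : ∀ i, S.weight A 0 i ω ≤ C) (φ : X → ℝ) :
    ∫ x, φ x ∂(S.emp A ω 0) = (N : ℝ)⁻¹ * ∑ i, min (A.w₀ (S.ξ 0 i ω)) C * φ (S.ξ 0 i ω) := by
  rw [integral_emp, normConst, one_mul]
  congr 1
  refine Finset.sum_congr rfl fun i _ => ?_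
  rw [min_eq_left (show A.w₀ (S.ξ 0 i ω) ≤ C from h i)]
  rfl

end Init

/-! ### Laws of large numbers -/

section LLN

variable {Ω X : Type*} [MeasurableSpace X] [MeasurableSingletonClass X] {H : DominatedHMM X}
  {T : ℕ} {A : APF H} {mΩ : MeasurableSpace Ω} {P : Measure Ω} [IsProbabilityMeasure P]
  {S : (N : ℕ) → ParticleArray Ω X T N} {C : ℝ}

lemma tendsto_step_sub (hS : ∀ N, (S N).IsFFBSi A P) (hb : A.Bounds T C)
    {t : ℕ} (ht : t < T)
    (hgood : ∀ᶠ q in inProb P, q.2 ∈ (S q.1).good A C t) {φ : ℕ → Ω × X → ℝ}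
    (hφ : ∀ N, Measurable[((S N).past A t).prod inferInstance] (φ N)) {K : ℝ}
    (hK : ∀ N q, |φ N q| ≤ K) :
    Tendsto (fun q : ℕ × Ω => ∫ x, φ q.1 (q.2, x) ∂((S q.1).emp A q.2 (t + 1)) -
      ∫ u, ∫ z, H.g (t + 1) z * φ q.1 (q.2, z) ∂(H.M u) ∂((S q.1).emp A q.2 t))
      (inProb P) (𝓝 0) := by
  have hC : 0 ≤ C := zero_le_one.trans hb.one_le
  obtain ⟨x₀⟩ : Nonempty X := A.ρ₀.nonempty_of_neZero
  obtain ⟨ω₀⟩ : Nonempty Ω := P.nonempty_of_neZero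
  have hK0 : 0 ≤ K := (abs_nonneg _).trans (hK 0 (ω₀, x₀))
  have hφ' : ∀ N, Measurable (φ N) := fun N => (hφ N).comp
    (((measurable_id'' ((hS N).past_le t)).comp measurable_fst).prodMk measurable_snd)
  refine tendsto_inProb_zero_of_setIntegral_sq_le hgood
    (fun N => measurableSet_good ((hS N).past_le t) le_rfl) (fun N => ?_)
    (b := 2 * ((C * C) ^ (t + 1) * (C * K))) (fun N ω hω => ?_)
    fun N hN => (hS N).setIntegral_step_sq_le hN hb ht (hφ N) (hK N)
  · exact (measurable_integral_emp ((hS N).past_le (t + 1)) le_rfl (hφ' N)).sub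
      (measurable_integral_M_emp ((hS N).past_le t) (hφ' N))
  · simp only
    refine (abs_sub _ _).trans ?_
    rw [two_mul]
    refine add_le_add ?_ ?_
    · rw [integral_emp_succ]
      exact abs_inv_mul_sum_le (by positivity) fun i => abs_normConst_mul_le hb ht hω _ _ (hK N _)
    · have := isProbabilityMeasure_instrumental (hω.1 t le_rfl)
      rw [← integral_instrumental_mul hb ht (hω.1 t le_rfl) (φ := fun x => φ N (ω, x))
        ((hφ' N).comp measurable_prodMk_left) (fun x => hK N _)]
      have h1 := norm_integral_le_of_norm_le_const (μ := (S N).instrumental A t ω)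
        (C := (C * C) ^ (t + 1) * (C * K))
        (f := fun y => (S N).normConst A (t + 1) ω *
          (A.w (t + 1) ((S N).ξ t y.1 ω) y.2 * φ N (ω, y.2)))
        (ae_of_all _ fun y => abs_normConst_mul_le hb ht hω _ _ (hK N _))
      simpa using h1

lemma tendsto_integral_emp_zero (hS : ∀ N, (S N).IsFFBSi A P) (hb : A.Bounds T C)
    {φ : X → ℝ} (hφ : Measurable φ) {K : ℝ} (hK : ∀ x, |φ x| ≤ K) :
    Tendsto (fun q : ℕ × Ω => ∫ x, φ x ∂((S q.1).emp A q.2 0)) (inProb P)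
      (𝓝 (∫ x, φ x ∂(H.unfiltUpTo T 0))) := by
  have hC : 0 ≤ C := zero_le_one.trans hb.one_le
  obtain ⟨x₀⟩ : Nonempty X := A.ρ₀.nonempty_of_neZero
  have hK0 : 0 ≤ K := (abs_nonneg _).trans (hK x₀)
  have ha : Measurable fun x => min (A.w₀ x) C * φ x :=
    (APF.measurable_w₀.min measurable_const).mul hφ
  have hmean : ∫ x, min (A.w₀ x) C * φ x ∂A.ρ₀ = ∫ x, φ x ∂(H.unfiltUpTo T 0) := by
    rw [integral_min_w₀_mul hb, DominatedHMM.unfiltUpTo, min_eq_left (Nat.zero_le _)]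
  have key : Tendsto (fun q : ℕ × Ω => ((q.1 : ℝ)⁻¹ * ∑ i, min (A.w₀ ((S q.1).ξ 0 i q.2)) C *
      φ ((S q.1).ξ 0 i q.2)) - ∫ x, φ x ∂(H.unfiltUpTo T 0)) (inProb P) (𝓝 0) := by
    refine tendsto_inProb_zero_of_setIntegral_sq_le (G := fun _ => Set.univ) (by simp) (by simp)
      (fun N => ?_) (b := 2 * (C * K)) (fun N ω _ => ?_) (c := (C * K) ^ 2) fun N hN => ?_
    · simp only
      exact Measurable.sub_const (Measurable.const_mul (Finset.measurable_sum Finset.univ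
        (f := fun i ω => min (A.w₀ ((S N).ξ 0 i ω)) C * φ ((S N).ξ 0 i ω)) fun i _ =>
        ha.comp ((hS N).measurable_ξ 0 i)) _) _
    · refine (abs_sub _ _).trans ?_
      rw [two_mul]
      refine add_le_add (abs_inv_mul_sum_le (by positivity)
        fun i => abs_min_w₀_mul_le hC _ (hK _)) ?_
      rw [← hmean]
      have h1 := norm_integral_le_of_norm_le_const (μ := A.ρ₀) (C := C * K)
        (f := fun x => min (A.w₀ x) C * φ x)
        (ae_of_all _ fun y => abs_min_w₀_mul_le hC _ (hK _))
      simpa using h1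
    · have := (hS N).condIID_init.setIntegral_sq_le hN
        (a := fun q => min (A.w₀ q.2) C * φ q.2)
        (ha.comp measurable_snd) (K := C * K)
        (fun _ _ y => abs_min_w₀_mul_le hC _ (hK _))
        (μ := fun _ => ∫ x, φ x ∂(H.unfiltUpTo T 0)) (@measurable_const _ _ _ ⊥ _)
        (fun _ _ => hmean.symm)
      simpa only [Set.preimage_univ] using this
  have key2 := key.add_const (∫ x, φ x ∂(H.unfiltUpTo T 0))
  simp only [sub_add_cancel, zero_add] at key2
  refine key2.congr' ?_
  refine eventually_inProb_of_ae fun N _ => ?_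
  filter_upwards [(hS N).weight_zero_le_ae hb] with ω hω
  exact (integral_emp_zero hω φ).symm

lemma good_and_tendsto_integral_emp (hS : ∀ N, (S N).IsFFBSi A P) (hb : A.Bounds T C)
    (hlik : H.BoundedLikelihood T)
    {t : ℕ} (ht : t ≤ T) :
    (∀ᶠ q in inProb P, q.2 ∈ (S q.1).good A C t) ∧
    ∀ (φ : X → ℝ) (K : ℝ), Measurable φ → (∀ x, |φ x| ≤ K) →
      Tendsto (fun q : ℕ × Ω => ∫ x, φ x ∂((S q.1).emp A q.2 t)) (inProb P)
        (𝓝 (∫ x, φ x ∂(H.unfiltUpTo T t))) := by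
  have hC : 0 ≤ C := zero_le_one.trans hb.one_le
  have hfin := hlik.isFiniteMeasure_unfiltUpTo
  have hpos : ∀ t ≤ T, (∀ (φ : X → ℝ) (K : ℝ), Measurable φ → (∀ x, |φ x| ≤ K) →
      Tendsto (fun q : ℕ × Ω => ∫ x, φ x ∂((S q.1).emp A q.2 t)) (inProb P)
        (𝓝 (∫ x, φ x ∂(H.unfiltUpTo T t)))) →
      ∀ᶠ q in inProb P, 0 < (S q.1).sumWeight A t q.2 := by
    intro t ht h
    have h1 := h (fun _ => 1) 1 measurable_const (by simp)
    have h2 : 0 < ∫ _, (1 : ℝ) ∂(H.unfiltUpTo T t) := by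
      rw [integral_const, smul_eq_mul, mul_one, measureReal_def]
      refine ENNReal.toReal_pos ?_ (measure_ne_top _ _)
      exact hlik.unfilt_univ_ne_zero (min_le_right _ _)
    filter_upwards [h1.eventually (lt_mem_nhds h2)] with q hq
    rw [integral_emp] at hq
    refine lt_of_le_of_ne (Finset.sum_nonneg fun i _ => weight_nonneg _ _ _) fun h0 => ?_
    simp only [mul_one] at hq
    rw [sumWeight] at h0
    rw [← h0] at hq
    simp at hq
  induction t with
  | zero =>
    have hb0 := fun (φ : X → ℝ) (K : ℝ) (hφ : Measurable φ) (hK : ∀ x, |φ x| ≤ K) =>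
      tendsto_integral_emp_zero hS hb hφ hK
    refine ⟨?_, hb0⟩
    have h1 : ∀ᶠ q in inProb P, ∀ i, (S q.1).weight A 0 i q.2 ≤ C :=
      eventually_inProb_of_ae fun N _ => (hS N).weight_zero_le_ae hb
    filter_upwards [h1, hpos 0 ht hb0] with q hq1 hq2
    refine ⟨fun s hs => ?_, hq1⟩
    obtain rfl : s = 0 := by omega
    exact hq2
  | succ t ih =>
    obtain ⟨ihg, ihφ⟩ := ih (by omega)
    have hstep : ∀ (φ : X → ℝ) (K : ℝ), Measurable φ → (∀ x, |φ x| ≤ K) →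
      Tendsto (fun q : ℕ × Ω => ∫ x, φ x ∂((S q.1).emp A q.2 (t + 1))) (inProb P)
        (𝓝 (∫ x, φ x ∂(H.unfiltUpTo T (t + 1)))) := by
      intro φ K hφ hK
      have h1 := tendsto_step_sub hS hb (t := t) (by omega) ihg (φ := fun _ q => φ q.2)
        (fun N => hφ.comp measurable_snd) (K := K) (fun _ _ => hK _)
      have h2 := ihφ (fun u => ∫ z, H.g (t + 1) z * φ z ∂(H.M u)) (C * K) ?_ ?_
      · rw [hlik.integral_unfiltUpTo_succ ht hφ hK]
        have h3 := h1.add h2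
        simpa using h3
      · exact measurable_integral_kernel_comp H.M measurable_id
          (F := fun q : X × X => H.g (t + 1) q.2 * φ q.2)
          (((H.measurable_g _).comp measurable_snd).mul (hφ.comp measurable_snd))
      · intro u
        have h4 := norm_integral_le_of_norm_le_const (μ := H.M u) (C := C * K)
          (f := fun z => H.g (t + 1) z * φ z) (ae_of_all _ fun z => by
            rw [norm_mul, Real.norm_eq_abs, Real.norm_eq_abs, abs_of_nonneg (H.g_nonneg _ _)]
            exact mul_le_mul (hb.g_le _ ht z) (hK _) (abs_nonneg _) hC)
        simpa using h4
    refine ⟨?_, hstep⟩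
    filter_upwards [ihg, hpos (t + 1) ht hstep] with q hq1 hq2
    refine ⟨fun s hs => ?_, hq1.2⟩
    rcases Nat.lt_or_ge s (t + 1) with h | h
    · exact hq1.1 s (by omega)
    · obtain rfl : s = t + 1 := by omega
      exact hq2

lemma tendsto_pathInt_emp (hS : ∀ N, (S N).IsFFBSi A P) (hb : A.Bounds T C)
    (hlik : H.BoundedLikelihood T)
    {t : ℕ} (ht : t ≤ T) {f : (ℕ → X) → ℝ} (hf : Measurable f) {K : ℝ}
    (hK : ∀ x, |f x| ≤ K) (y : ℕ → X) :
    Tendsto (fun q : ℕ × Ω => H.pathInt ((S q.1).emp A q.2) t f y) (inProb P)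
      (𝓝 (H.pathInt (H.unfiltUpTo T) t f y)) := by
  have hfin := hlik.isFiniteMeasure_unfiltUpTo
  induction t generalizing f K with
  | zero =>
    exact tendsto_integral_emp_zero hS hb (φ := fun z => f (update y 0 z))
      (hf.comp ((DominatedHMM.measurable_update_pair 0).comp
        (measurable_const.prodMk measurable_id))) fun x => hK _
  | succ t ih =>
    have h1 := tendsto_step_sub hS hb (t := t) (by omega)
      (good_and_tendsto_integral_emp hS hb hlik (by omega)).1
      (φ := fun N q => H.gbwd ((S N).emp A q.1) (t + 1) f (update y (t + 1) q.2))
      (fun N => measurable_gbwd_emp le_rfl le_rfl hf y) (K := K)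
      (fun _ _ => DominatedHMM.abs_gbwd_le hK _)
    simp only [DominatedHMM.integral_M_gbwd_succ hb.m_le (hb.g_le (t + 1) ht) hf hK y] at h1
    have h2 := ih (by omega) (DominatedHMM.measurable_fstep hf)
      (DominatedHMM.abs_fstep_le hK (hb.g_le (t + 1) ht))
    rw [hlik.pathInt_succ hb.m_le ht hf hK]
    have h3 := h1.add h2
    rw [zero_add] at h3
    refine h3.congr fun q => ?_
    rw [sub_add_cancel]
    rfl

lemma tendsto_normConst_succ (hS : ∀ N, (S N).IsFFBSi A P) (hb : A.Bounds T C)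
    (hlik : H.BoundedLikelihood T)
    {t : ℕ} (ht : t < T) :
    Tendsto (fun q : ℕ × Ω => (S q.1).normConst A (t + 1) q.2) (inProb P)
      (𝓝 (∫ x, A.ϑ (t + 1) x ∂(H.unfiltUpTo T t))) := by
  have := (good_and_tendsto_integral_emp hS hb hlik ht.le).2 (A.ϑ (t + 1)) C (A.measurable_ϑ _)
    fun x => by rw [abs_of_pos (A.ϑ_pos _ _)]; exact hb.ϑ_le t ht x
  simpa only [integral_emp] using! this

end LLN

end ParticleArray

section Dominated

open scoped ENNReal Topology

variable {Ω X : Type*} [MeasurableSpace Ω] [MeasurableSpace X] {P : Measure Ω}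
  [IsProbabilityMeasure P]

lemma tendsto_lintegral_ofReal_of_tendsto_inProb {R : ℕ × Ω → ℝ} {c B : ℝ}
    (hR : Tendsto R (inProb P) (𝓝 c)) (hm : ∀ N, Measurable fun ω => R (N, ω))
    (h0 : ∀ N ω, 0 ≤ R (N, ω)) (hB : ∀ N ω, R (N, ω) ≤ B) :
    Tendsto (fun N => ∫⁻ ω, ENNReal.ofReal (R (N, ω)) ∂P) atTop (𝓝 (ENNReal.ofReal c)) := by
  have hint : ∀ N, Integrable (fun ω => R (N, ω)) P := fun N =>
    Integrable.of_bound (hm N).aestronglyMeasurable B (ae_of_all _ fun ω => by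
      rw [Real.norm_eq_abs, abs_of_nonneg (h0 N ω)]; exact hB N ω)
  have h1 := tendsto_lintegral_of_tendsto_inProb hR hm (K := B + |c|) fun N ω =>
    (abs_sub _ _).trans (add_le_add (by rw [abs_of_nonneg (h0 N ω)]; exact hB N ω) le_rfl)
  have h2 := tendsto_integral_of_L1 (μ := P) (fun _ => c) aestronglyMeasurable_const
    (F := fun N ω => R (N, ω)) (l := atTop) (Eventually.of_forall hint)
    (by simpa only [Real.enorm_eq_ofReal_abs] using h1)
  rw [integral_const, probReal_univ, one_smul] at h2
  refine (ENNReal.tendsto_ofReal h2).congr fun N => ?_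
  rw [ofReal_integral_eq_lintegral_ofReal (hint N) (ae_of_all _ (h0 N))]

/-- Dominated convergence in probability for integrals of random functions, with converging
dominating functions. -/
lemma tendsto_inProb_integral_of_dominated {ν : Measure X} [SigmaFinite ν]
    {Z R : ℕ → Ω × X → ℝ} {z r : X → ℝ} {B : ℝ} (hZ : ∀ N, Measurable (Z N))
    (hR : ∀ N, Measurable (R N)) (hz : Measurable z) (hr : Measurable r)
    (hZR : ∀ N q, |Z N q| ≤ R N q) (hzr : ∀ x, |z x| ≤ r x) (hRB : ∀ N q, R N q ≤ B)
    (hRi : ∀ N ω, Integrable (fun x => R N (ω, x)) ν) (hri : Integrable r ν)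
    (hRIB : ∀ N ω, ∫ x, R N (ω, x) ∂ν ≤ B)
    (hZlim : ∀ x, Tendsto (fun q : ℕ × Ω => Z q.1 (q.2, x)) (inProb P) (𝓝 (z x)))
    (hRlim : ∀ x, Tendsto (fun q : ℕ × Ω => R q.1 (q.2, x)) (inProb P) (𝓝 (r x)))
    (hRIlim : Tendsto (fun q : ℕ × Ω => ∫ x, R q.1 (q.2, x) ∂ν) (inProb P) (𝓝 (∫ x, r x ∂ν))) :
    Tendsto (fun q : ℕ × Ω => ∫ x, Z q.1 (q.2, x) ∂ν) (inProb P) (𝓝 (∫ x, z x ∂ν)) := by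
  have hR0 : ∀ N q, 0 ≤ R N q := fun N q => (abs_nonneg _).trans (hZR N q)
  have hr0 : ∀ x, 0 ≤ r x := fun x => (abs_nonneg _).trans (hzr x)
  have hmR : ∀ N, Measurable fun ω => ∫ x, R N (ω, x) ∂ν := fun N =>
    ((hR N).stronglyMeasurable.integral_prod_right' (ν := ν)).measurable
  have hmZ : ∀ N, Measurable fun ω => ∫ x, Z N (ω, x) ∂ν := fun N =>
    ((hZ N).stronglyMeasurable.integral_prod_right' (ν := ν)).measurable
  have hmD : ∀ N, Measurable fun q : X × Ω => ENNReal.ofReal |Z N (q.2, q.1) - z q.1| := fun N =>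
    ((((hZ N).comp measurable_swap).sub (hz.comp measurable_fst)).norm).ennreal_ofReal
  have hmb : ∀ N, Measurable fun q : X × Ω => ENNReal.ofReal (R N (q.2, q.1)) := fun N =>
    ((hR N).comp measurable_swap).ennreal_ofReal
  have hsx : ∀ x : X, Measurable fun ω : Ω => (ω, x) := fun x => measurable_prodMk_right
  have main : Tendsto (fun N => ∫⁻ x, ∫⁻ ω, ENNReal.ofReal |Z N (ω, x) - z x| ∂P ∂ν) atTop
      (𝓝 0) := by
    refine tendsto_lintegral_zero_of_le_tendsto
      (b := fun N x => (∫⁻ ω, ENNReal.ofReal (R N (ω, x)) ∂P) + ENNReal.ofReal (r x))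
      (b' := fun x => ENNReal.ofReal (r x) + ENNReal.ofReal (r x))
      (fun N => (hmD N).lintegral_prod_right')
      (fun N => ((hmb N).lintegral_prod_right').add hr.ennreal_ofReal) (fun N x => ?_)
      (fun x => ?_) (fun x => ?_) ?_ ?_
    · calc ∫⁻ ω, ENNReal.ofReal |Z N (ω, x) - z x| ∂P
          ≤ ∫⁻ ω, (ENNReal.ofReal (R N (ω, x)) + ENNReal.ofReal (r x)) ∂P := by
            refine lintegral_mono fun ω => ?_
            rw [← ENNReal.ofReal_add (hR0 _ _) (hr0 _)]
            exact ENNReal.ofReal_le_ofReal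
              ((abs_sub _ _).trans (add_le_add (hZR _ _) (hzr _)))
        _ = _ := by
            rw [lintegral_add_right _ measurable_const, lintegral_const, measure_univ, mul_one]
    · exact tendsto_lintegral_of_tendsto_inProb (X := fun q => Z q.1 (q.2, x)) (hZlim x)
        (fun N => (hZ N).comp (hsx x)) (K := B + r x) fun N ω =>
          (abs_sub _ _).trans (add_le_add ((hZR _ _).trans (hRB _ _)) (hzr _))
    · exact (tendsto_lintegral_ofReal_of_tendsto_inProb (R := fun q => R q.1 (q.2, x)) (hRlim x)
        (fun N => (hR N).comp (hsx x)) (fun N ω => hR0 _ _) fun N ω => hRB _ _).add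
        tendsto_const_nhds
    · rw [lintegral_add_right _ hr.ennreal_ofReal]
      simp_rw [lintegral_add_right _ hr.ennreal_ofReal]
      refine Tendsto.add ?_ tendsto_const_nhds
      rw [← ofReal_integral_eq_lintegral_ofReal hri (ae_of_all _ hr0)]
      refine (tendsto_lintegral_ofReal_of_tendsto_inProb
        (R := fun q => ∫ x, R q.1 (q.2, x) ∂ν) hRIlim (fun N => hmR N)
        (fun N ω => integral_nonneg fun x => hR0 _ _) fun N ω => hRIB _ _).congr fun N => ?_
      rw [lintegral_lintegral_swap (hmb N).aemeasurable]
      refine lintegral_congr fun ω => ?_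
      exact ofReal_integral_eq_lintegral_ofReal (hRi N ω) (ae_of_all _ fun x => hR0 _ _)
    · rw [lintegral_add_right _ hr.ennreal_ofReal,
        ← ofReal_integral_eq_lintegral_ofReal hri (ae_of_all _ hr0)]
      simp
  refine tendsto_inProb_of_tendsto_lintegral (G := fun _ => Set.univ) (by simp) ?_
    fun N => hmZ N
  refine tendsto_of_tendsto_of_tendsto_of_le_of_le tendsto_const_nhds main (fun _ => zero_le)
    fun N => ?_
  simp only [Measure.restrict_univ]
  rw [lintegral_lintegral_swap (hmD N).aemeasurable]
  refine lintegral_mono fun ω => ?_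
  have hZi : Integrable (fun x => Z N (ω, x)) ν := (hRi N ω).mono'
    ((hZ N).comp measurable_prodMk_left).aestronglyMeasurable (ae_of_all _ fun x => hZR _ _)
  have hzi : Integrable z ν := hri.mono' hz.aestronglyMeasurable (ae_of_all _ hzr)
  simp only
  rw [← integral_sub hZi hzi, ← Real.enorm_eq_ofReal_abs]
  refine (enorm_integral_le_lintegral_enorm _).trans_eq ?_
  simp only [Real.enorm_eq_ofReal_abs]

end Dominated

namespace APF

variable {X : Type*} [MeasurableSpace X] {H : DominatedHMM X} (A : APF H)

/-- The density with respect to `ν` of the second moment of the importance weights at time `t`. -/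
noncomputable def sqDensity (t : ℕ) (μ : Measure X) (z : X) : ℝ :=
  ∫ u, H.m u z * (H.g t z * A.w t u z) ∂μ

variable {A}

lemma sqDensity_nonneg (t : ℕ) (μ : Measure X) (z : X) : 0 ≤ A.sqDensity t μ z :=
  integral_nonneg fun _ => mul_nonneg (H.m_nonneg _ _) (mul_nonneg (H.g_nonneg _ _) (w_nonneg _ _ _))

lemma g_mul_w_le {T : ℕ} {C : ℝ} (hb : A.Bounds T C) {t : ℕ} (ht : t < T) (u z : X) :
    H.g (t + 1) z * A.w (t + 1) u z ≤ C * C :=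
  mul_le_mul (hb.g_le _ ht z) (hb.w_le t ht u z) (w_nonneg _ _ _) (zero_le_one.trans hb.one_le)

lemma abs_m_mul_le {T : ℕ} {C : ℝ} (hb : A.Bounds T C) (u z : X) {b K : ℝ} (hK : |b| ≤ K) :
    |H.m u z * b| ≤ C * K := by
  rw [abs_mul, abs_of_nonneg (H.m_nonneg _ _)]
  exact mul_le_mul (hb.m_le u z) hK (abs_nonneg _) (zero_le_one.trans hb.one_le)

lemma integrable_m {T : ℕ} {C : ℝ} (hb : A.Bounds T C) (μ : Measure X) [IsFiniteMeasure μ] (z : X) :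
    Integrable (fun u => H.m u z) μ :=
  Integrable.of_bound (H.measurable_m.comp measurable_prodMk_right).aestronglyMeasurable C
    (ae_of_all _ fun u => by
      rw [Real.norm_eq_abs, abs_of_nonneg (H.m_nonneg _ _)]; exact hb.m_le u z)

lemma sqDensity_le {T : ℕ} {C : ℝ} (hb : A.Bounds T C) {t : ℕ} (ht : t < T) (μ : Measure X)
    [IsFiniteMeasure μ] (z : X) :
    A.sqDensity (t + 1) μ z ≤ C * C * ∫ u, H.m u z ∂μ := by
  rw [sqDensity, ← integral_const_mul]
  refine integral_mono_of_nonneg (ae_of_all _ fun u => mul_nonneg (H.m_nonneg _ _)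
    (mul_nonneg (H.g_nonneg _ _) (w_nonneg _ _ _))) ((integrable_m hb μ z).const_mul _)
    (ae_of_all _ fun u => ?_)
  simp only
  rw [mul_comm]
  exact mul_le_mul_of_nonneg_right (g_mul_w_le hb ht u z) (H.m_nonneg _ _)

lemma integral_integral_m (μ : Measure X) [IsFiniteMeasure μ] :
    ∫ z, ∫ u, H.m u z ∂μ ∂H.ν = ∫ _, (1 : ℝ) ∂μ := by
  have := integral_integral_densityKernel H.measurable_m H.m_nonneg H.lintegral_m μ
    (k := fun _ => 1) measurable_const (K := 1) (by simp)
  have h2 := isMarkovKernel_densityKernel H.measurable_m H.lintegral_m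
  simpa using this.symm

lemma integrable_integral_m (μ : Measure X) [IsFiniteMeasure μ] :
    Integrable (fun z => ∫ u, H.m u z ∂μ) H.ν := by
  have := (integrable_density_mul_prod H.measurable_m H.m_nonneg H.lintegral_m μ
    (k := fun _ => 1) measurable_const (K := 1) (by simp)).integral_prod_right
  simpa using this

lemma integral_ϑ_mul_integral_sq {T : ℕ} {C : ℝ} (hb : A.Bounds T C) {t : ℕ} (ht : t < T)
    (μ : Measure X) [IsFiniteMeasure μ] {k : X → ℝ} (hk : Measurable k) {K : ℝ}
    (hK : ∀ x, |k x| ≤ K) :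
    ∫ u, A.ϑ (t + 1) u * ∫ x, A.w (t + 1) u x ^ 2 * k x ∂(A.proposal (t + 1) u) ∂μ =
      ∫ z, A.sqDensity (t + 1) μ z * k z ∂H.ν := by
  have h1 : ∀ u, A.ϑ (t + 1) u * ∫ x, A.w (t + 1) u x ^ 2 * k x ∂(A.proposal (t + 1) u) =
      ∫ z, H.g (t + 1) z * (A.w (t + 1) u z * k z) ∂(H.M u) := by
    intro u
    rw [← ϑ_mul_integral_proposal]
    congr 2 with x
    ring
  simp only [h1]
  have := integral_integral_densityKernel H.measurable_m H.m_nonneg H.lintegral_m μ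
    (k := fun p => H.g (t + 1) p.2 * (A.w (t + 1) p.1 p.2 * k p.2)) ?_ (K := C * C * K) ?_
  · refine this.trans ?_
    congr 1 with z
    rw [sqDensity, ← integral_mul_const]
    congr 1 with u
    ring
  · exact ((H.measurable_g _).comp measurable_snd).mul
      ((measurable_w _).mul (hk.comp measurable_snd))
  · intro p
    rw [← mul_assoc, abs_mul, abs_of_nonneg (mul_nonneg (H.g_nonneg _ _) (w_nonneg _ _ _))]
    exact mul_le_mul (g_mul_w_le hb ht _ _) (hK _) (abs_nonneg _)
      (mul_self_nonneg C)

lemma measurable_sqDensity (t : ℕ) (μ : Measure X) [SFinite μ] : Measurable (A.sqDensity t μ) := by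
  have h1 : Measurable fun p : X × X => H.m p.2 p.1 * (H.g t p.1 * A.w t p.2 p.1) :=
    (H.measurable_m.comp measurable_swap).mul (((H.measurable_g t).comp measurable_fst).mul
      ((measurable_w t).comp measurable_swap))
  exact (h1.stronglyMeasurable.integral_prod_right' (ν := μ)).measurable

lemma measurable_integral_m (μ : Measure X) [SFinite μ] :
    Measurable (fun z => ∫ u, H.m u z ∂μ) :=
  ((H.measurable_m.comp measurable_swap).stronglyMeasurable.integral_prod_right'
    (ν := μ)).measurable

end APF

namespace ParticleArray

open scoped ENNReal Topology
open Function (update)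

lemma measurable_integral_emp_prod {Ω X : Type*} [MeasurableSpace X] [MeasurableSingletonClass X]
    {H : DominatedHMM X} {T N : ℕ} {S : ParticleArray Ω X T N} {A : APF H}
    {m : MeasurableSpace Ω} {t s : ℕ} (hm : S.past A t ≤ m) (hs : s ≤ t)
    {F : (Ω × X) × X → ℝ} (hF : Measurable F) :
    Measurable fun q : Ω × X => ∫ u, F (q, u) ∂(S.emp A q.1 s) := by
  simp only [integral_emp]
  refine ((measurable_normConst_of_past_le hm (by omega)).comp measurable_fst).mul
    ((Finset.measurable_sum _ fun k _ => ?_).const_mul _)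
  exact ((measurable_weight_of_past_le hm hs k).comp measurable_fst).mul
    (hF.comp (measurable_id.prodMk ((measurable_ξ_of_past_le hm hs k).comp measurable_fst)))

lemma integral_emp_one_le {Ω X : Type*} [MeasurableSpace X] [MeasurableSingletonClass X]
    {H : DominatedHMM X} {T N : ℕ} {S : ParticleArray Ω X T N} {A : APF H} {C : ℝ}
    (hb : A.Bounds T C) {t s : ℕ} (ht : t ≤ T) {ω : Ω} (h : ω ∈ S.good A C s) :
    ∫ _, (1 : ℝ) ∂(S.emp A ω t) ≤ (C * C) ^ t * C := by
  have hC : 0 ≤ C := zero_le_one.trans hb.one_le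
  rw [integral_emp]
  simp only [mul_one]
  exact mul_le_mul (normConst_le hb ht h) (inv_mul_sum_le hC fun i => weight_le hb ht h i)
    (mul_nonneg (by positivity) (Finset.sum_nonneg fun i _ => weight_nonneg _ _ _))
    (by positivity)

section Variance

variable {Ω X : Type*} [MeasurableSpace X] [MeasurableSingletonClass X] {H : DominatedHMM X}
  {T : ℕ} {A : APF H} {mΩ : MeasurableSpace Ω} {P : Measure Ω} [IsProbabilityMeasure P]
  {S : (N : ℕ) → ParticleArray Ω X T N} {C : ℝ}

lemma tendsto_integral_m_emp (hS : ∀ N, (S N).IsFFBSi A P) (hb : A.Bounds T C)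
    (hlik : H.BoundedLikelihood T)
    {t : ℕ} (ht : t ≤ T) (z : X) :
    Tendsto (fun q : ℕ × Ω => ∫ u, H.m u z ∂((S q.1).emp A q.2 t)) (inProb P)
      (𝓝 (∫ u, H.m u z ∂(H.unfiltUpTo T t))) :=
  (good_and_tendsto_integral_emp hS hb hlik ht).2 (fun u => H.m u z) C
    (H.measurable_m.comp measurable_prodMk_right) fun u => by
      rw [abs_of_nonneg (H.m_nonneg _ _)]; exact hb.m_le u z

lemma tendsto_sqDensity_mul_gbwd_sq (hS : ∀ N, (S N).IsFFBSi A P) (hb : A.Bounds T C)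
    (hlik : H.BoundedLikelihood T)
    {t : ℕ} (ht : t < T) {f : (ℕ → X) → ℝ} (hf : Measurable f)
    {K : ℝ} (hK : ∀ x, |f x| ≤ K) (y : ℕ → X) (z : X) :
    Tendsto (fun q : ℕ × Ω => A.sqDensity (t + 1) ((S q.1).emp A q.2 t) z *
        H.gbwd ((S q.1).emp A q.2) (t + 1) f (update y (t + 1) z) ^ 2) (inProb P)
      (𝓝 (A.sqDensity (t + 1) (H.unfiltUpTo T t) z *
        H.gbwd (H.unfiltUpTo T) (t + 1) f (update y (t + 1) z) ^ 2)) := by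
  have hC : 0 ≤ C := zero_le_one.trans hb.one_le
  have hfin := hlik.isFiniteMeasure_unfiltUpTo
  have hq : Tendsto (fun q : ℕ × Ω => A.sqDensity (t + 1) ((S q.1).emp A q.2 t) z) (inProb P)
      (𝓝 (A.sqDensity (t + 1) (H.unfiltUpTo T t) z)) := by
    refine (good_and_tendsto_integral_emp hS hb hlik ht.le).2
      (fun u => H.m u z * (H.g (t + 1) z * A.w (t + 1) u z)) (C * (C * C)) ?_ fun u => ?_
    · exact (H.measurable_m.comp measurable_prodMk_right).mul
        (((APF.measurable_w _).comp measurable_prodMk_right).const_mul _)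
    · refine APF.abs_m_mul_le hb _ _ ?_
      rw [abs_of_nonneg (mul_nonneg (H.g_nonneg _ _) (APF.w_nonneg _ _ _))]
      exact APF.g_mul_w_le hb ht u z
  by_cases h0 : ∫ u, H.m u z ∂(H.unfiltUpTo T t) = 0
  · have hq0 : A.sqDensity (t + 1) (H.unfiltUpTo T t) z = 0 := by
      refine le_antisymm ?_ (APF.sqDensity_nonneg _ _ _)
      have := APF.sqDensity_le hb ht (H.unfiltUpTo T t) z
      rwa [h0, mul_zero] at this
    rw [hq0] at hq ⊢
    rw [zero_mul]
    have h1 := hq.mul_const (K ^ 2)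
    rw [zero_mul] at h1
    refine squeeze_zero (fun q => mul_nonneg (APF.sqDensity_nonneg _ _ _) (sq_nonneg _))
      (fun q => mul_le_mul_of_nonneg_left ?_ (APF.sqDensity_nonneg _ _ _)) h1
    rw [← sq_abs]
    have := DominatedHMM.abs_gbwd_le (H := H) (η := (S q.1).emp A q.2) (t := t + 1) hK
      (update y (t + 1) z)
    gcongr
  · refine hq.mul (Tendsto.pow ?_ 2)
    simp only [DominatedHMM.gbwd_succ_eq_div, Function.update_self]
    refine Tendsto.div ?_ (tendsto_integral_m_emp hS hb hlik ht.le z) h0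
    refine tendsto_pathInt_emp hS hb hlik ht.le (K := C * K) ?_ (fun x => ?_) _
    · exact (H.measurable_m.comp ((measurable_pi_apply t).prodMk
        (measurable_pi_apply (t + 1)))).mul hf
    · exact APF.abs_m_mul_le hb _ _ (hK x)

lemma tendsto_integral_proposal_gbwd_sq (hS : ∀ N, (S N).IsFFBSi A P) (hb : A.Bounds T C)
    (hlik : H.BoundedLikelihood T)
    {t : ℕ} (ht : t < T) {f : (ℕ → X) → ℝ}
    (hf : Measurable f) {K : ℝ} (hK : ∀ x, |f x| ≤ K) (y : ℕ → X) :
    Tendsto (fun q : ℕ × Ω => ∫ u, A.ϑ (t + 1) u * ∫ x, A.w (t + 1) u x ^ 2 *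
        H.gbwd ((S q.1).emp A q.2) (t + 1) f (update y (t + 1) x) ^ 2
          ∂(A.proposal (t + 1) u) ∂((S q.1).emp A q.2 t)) (inProb P)
      (𝓝 (∫ u, A.ϑ (t + 1) u * ∫ x, A.w (t + 1) u x ^ 2 *
        H.gbwd (H.unfiltUpTo T) (t + 1) f (update y (t + 1) x) ^ 2
          ∂(A.proposal (t + 1) u) ∂(H.unfiltUpTo T t))) := by
  classical
  have hC : 0 ≤ C := zero_le_one.trans hb.one_le
  have hfin := hlik.isFiniteMeasure_unfiltUpTo
  obtain ⟨hgood, hlln⟩ := good_and_tendsto_integral_emp hS hb hlik ht.le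
  have hup : Measurable fun x => update y (t + 1) x :=
    (DominatedHMM.measurable_update_pair (t + 1)).comp (measurable_const.prodMk measurable_id)
  have hsq : ∀ (η : ℕ → Measure X) x,
      |H.gbwd η (t + 1) f (update y (t + 1) x) ^ 2| ≤ K ^ 2 := by
    intro η x
    rw [abs_pow]
    have := DominatedHMM.abs_gbwd_le (H := H) (η := η) (t := t + 1) hK (update y (t + 1) x)
    gcongr
  have hmN : ∀ N, Measurable fun q : Ω × X =>
      H.gbwd ((S N).emp A q.1) (t + 1) f (update y (t + 1) q.2) := fun N =>
    measurable_gbwd_emp ((hS N).past_le t) le_rfl hf y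
  have hmlim : Measurable fun x => H.gbwd (H.unfiltUpTo T) (t + 1) f (update y (t + 1) x) :=
    (DominatedHMM.measurable_gbwd_const hf).comp hup
  have hswap : ∀ q : ℕ × Ω, ∫ u, A.ϑ (t + 1) u * ∫ x, A.w (t + 1) u x ^ 2 *
        H.gbwd ((S q.1).emp A q.2) (t + 1) f (update y (t + 1) x) ^ 2
          ∂(A.proposal (t + 1) u) ∂((S q.1).emp A q.2 t) =
      ∫ z, A.sqDensity (t + 1) ((S q.1).emp A q.2 t) z *
        H.gbwd ((S q.1).emp A q.2) (t + 1) f (update y (t + 1) z) ^ 2 ∂H.ν := fun q =>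
    APF.integral_ϑ_mul_integral_sq hb ht _
      (((hmN q.1).comp measurable_prodMk_left).pow_const 2) (hsq _)
  simp only [hswap]
  rw [APF.integral_ϑ_mul_integral_sq hb ht _ (hmlim.pow_const 2) (hsq _)]
  set D : ℝ := C * C * K ^ 2 with hD
  have hD0 : 0 ≤ D := by positivity
  have hle : ∀ (η : ℕ → Measure X) [IsFiniteMeasure (η t)] z,
      |A.sqDensity (t + 1) (η t) z * H.gbwd η (t + 1) f (update y (t + 1) z) ^ 2| ≤
        D * ∫ u, H.m u z ∂(η t) := by
    intro η _ z
    rw [abs_mul, abs_of_nonneg (APF.sqDensity_nonneg _ _ _)]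
    calc _ ≤ (C * C * ∫ u, H.m u z ∂(η t)) * K ^ 2 := mul_le_mul (APF.sqDensity_le hb ht _ z)
          (hsq η z) (abs_nonneg _) (mul_nonneg (by positivity)
            (integral_nonneg fun u => H.m_nonneg _ _))
      _ = _ := by rw [hD]; ring
  have hmle : ∀ (μ : Measure X) [IsFiniteMeasure μ] z,
      ∫ u, H.m u z ∂μ ≤ C * ∫ _, (1 : ℝ) ∂μ := by
    intro μ _ z
    rw [← integral_const_mul]
    exact integral_mono (APF.integrable_m hb μ z) (integrable_const _)
      fun u => by simpa using hb.m_le u z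
  set b₁ : ℝ := (C * C) ^ t * C
  set b₂ : ℝ := ∫ _, (1 : ℝ) ∂(H.unfiltUpTo T t)
  have hb₁ : 0 ≤ b₁ := by positivity
  have hb₂ : 0 ≤ b₂ := integral_nonneg fun _ => zero_le_one
  have hGm : ∀ N, MeasurableSet {q : Ω × X | q.1 ∈ (S N).good A C t} := fun N =>
    measurable_fst (measurableSet_good ((hS N).past_le t) le_rfl)
  have key := tendsto_inProb_integral_of_dominated (P := P) (ν := H.ν)
    (Z := fun N q => if q.1 ∈ (S N).good A C t then
      A.sqDensity (t + 1) ((S N).emp A q.1 t) q.2 *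
        H.gbwd ((S N).emp A q.1) (t + 1) f (update y (t + 1) q.2) ^ 2 else
      A.sqDensity (t + 1) (H.unfiltUpTo T t) q.2 *
        H.gbwd (H.unfiltUpTo T) (t + 1) f (update y (t + 1) q.2) ^ 2)
    (R := fun N q => if q.1 ∈ (S N).good A C t then
      D * ∫ u, H.m u q.2 ∂((S N).emp A q.1 t) else D * ∫ u, H.m u q.2 ∂(H.unfiltUpTo T t))
    (z := fun z => A.sqDensity (t + 1) (H.unfiltUpTo T t) z *
        H.gbwd (H.unfiltUpTo T) (t + 1) f (update y (t + 1) z) ^ 2)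
    (r := fun z => D * ∫ u, H.m u z ∂(H.unfiltUpTo T t))
    (B := D * (C * (b₁ + b₂))) ?_ ?_ ?_ ?_ ?_ ?_ ?_ ?_ ?_ ?_ ?_ ?_ ?_
  · refine key.congr' ?_
    filter_upwards [hgood] with q hq
    simp only [hq, if_true]
  · intro N
    refine Measurable.ite (hGm N) ?_ ?_
    · refine Measurable.mul ?_ ((hmN N).pow_const 2)
      refine measurable_integral_emp_prod ((hS N).past_le t) le_rfl (F := fun p =>
        H.m p.2 p.1.2 * (H.g (t + 1) p.1.2 * A.w (t + 1) p.2 p.1.2)) ?_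
      have e : Measurable fun p : (Ω × X) × X => (p.2, p.1.2) :=
        measurable_snd.prodMk (measurable_snd.comp measurable_fst)
      exact (H.measurable_m.comp e).mul (((H.measurable_g _).comp
        (measurable_snd.comp measurable_fst)).mul ((APF.measurable_w _).comp e))
    · exact ((APF.measurable_sqDensity _ _).comp measurable_snd).mul
        ((hmlim.comp measurable_snd).pow_const 2)
  · intro N
    refine Measurable.ite (hGm N) (Measurable.const_mul ?_ _) (Measurable.const_mul ?_ _)
    · exact measurable_integral_emp_prod ((hS N).past_le t) le_rfl (F := fun p => H.m p.2 p.1.2)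
        (H.measurable_m.comp (measurable_snd.prodMk (measurable_snd.comp measurable_fst)))
    · exact (APF.measurable_integral_m _).comp measurable_snd
  · exact (APF.measurable_sqDensity _ _).mul (hmlim.pow_const 2)
  · exact (APF.measurable_integral_m _).const_mul _
  · intro N q
    by_cases hq : q.1 ∈ (S N).good A C t
    · simp only [hq, if_true]
      exact hle ((S N).emp A q.1) _
    · simp only [hq, if_false]
      exact hle (H.unfiltUpTo T) _
  · exact hle (H.unfiltUpTo T)
  · intro N q
    by_cases hq : q.1 ∈ (S N).good A C t
    · simp only [hq, if_true]
      have h1 := hmle ((S N).emp A q.1 t) q.2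
      have h2 : ∫ _, (1 : ℝ) ∂((S N).emp A q.1 t) ≤ b₁ := integral_emp_one_le hb ht.le hq
      gcongr
      refine h1.trans ?_
      gcongr
      linarith
    · simp only [hq, if_false]
      have h1 := hmle (H.unfiltUpTo T t) q.2
      gcongr
      refine h1.trans ?_
      gcongr
      simp only [b₂] at hb₁ ⊢
      linarith
  · intro N ω
    by_cases hq : ω ∈ (S N).good A C t
    · simp only [hq, if_true]
      exact (APF.integrable_integral_m _).const_mul _
    · simp only [hq, if_false]
      exact (APF.integrable_integral_m _).const_mul _
  · exact (APF.integrable_integral_m _).const_mul _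
  · intro N ω
    have hC1 : ∀ b : ℝ, 0 ≤ b → b ≤ C * b := fun b hb' =>
      le_mul_of_one_le_left hb' hb.one_le
    by_cases hq : ω ∈ (S N).good A C t
    · simp only [hq, if_true]
      rw [integral_const_mul, APF.integral_integral_m]
      have h2 : ∫ _, (1 : ℝ) ∂((S N).emp A ω t) ≤ b₁ := integral_emp_one_le hb ht.le hq
      gcongr
      have := hC1 (b₁ + b₂) (by positivity)
      linarith
    · simp only [hq, if_false]
      rw [integral_const_mul, APF.integral_integral_m]
      have := hC1 (b₁ + b₂) (by positivity)
      gcongr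
      simp only [b₂] at this ⊢
      linarith
  · intro x
    refine (tendsto_sqDensity_mul_gbwd_sq hS hb hlik ht hf hK y x).congr' ?_
    filter_upwards [hgood] with q hq
    simp only [hq, if_true]
  · intro x
    refine ((tendsto_integral_m_emp hS hb hlik ht.le x).const_mul D).congr' ?_
    filter_upwards [hgood] with q hq
    simp only [hq, if_true]
  · have h1 := (hlln (fun _ => 1) 1 measurable_const (by simp)).const_mul D
    rw [integral_const_mul, APF.integral_integral_m]
    refine h1.congr' ?_
    filter_upwards [hgood] with q hq
    simp only [hq, if_true]
    rw [integral_const_mul, APF.integral_integral_m]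

end Variance

end ParticleArray

namespace APF

variable {X : Type*} [MeasurableSpace X] {H : DominatedHMM X} (A : APF H)

/-- The contribution of the initial sampling to the asymptotic variance. -/
noncomputable def initVar (T : ℕ) (h : (Fin (T + 1) → X) → ℝ) : ℝ :=
  ∫ x, A.w₀ x ^ 2 * H.F T 0 x h ^ 2 ∂A.ρ₀

/-- The contribution of the sampling at time `t + 1` to the asymptotic variance. -/
noncomputable def stepVar (T : ℕ) (h : (Fin (T + 1) → X) → ℝ) (t : ℕ) : ℝ :=
  (∫ x, A.ϑ (t + 1) x ∂(H.unfiltUpTo T t)) * ∫ u, A.ϑ (t + 1) u *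
    ∫ x, A.w (t + 1) u x ^ 2 * H.F T (t + 1) x h ^ 2 ∂(A.proposal (t + 1) u) ∂(H.unfiltUpTo T t)

end APF

lemma tendsto_const_div_sqrt_nat (c : ℝ) :
    Tendsto (fun N : ℕ => c / √(N : ℝ)) atTop (nhds 0) :=
  tendsto_const_nhds.div_atTop (Real.tendsto_sqrt_atTop.comp tendsto_natCast_atTop_atTop)

lemma eventually_le_sqrt_nat (c : ℝ) : ∀ᶠ N : ℕ in atTop, 1 ≤ N ∧ c ≤ √(N : ℝ) :=
  (eventually_ge_atTop 1).and
    ((Real.tendsto_sqrt_atTop.comp tendsto_natCast_atTop_atTop).eventually_ge_atTop c)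

namespace ParticleArray

open scoped ENNReal Topology
open Function (update)

section CLT

variable {Ω X : Type*} [MeasurableSpace X] [MeasurableSingletonClass X] {H : DominatedHMM X}
  {T : ℕ} {A : APF H} {mΩ : MeasurableSpace Ω} {P : Measure Ω} [IsProbabilityMeasure P]
  {S : (N : ℕ) → ParticleArray Ω X T N} {C K : ℝ}
  {h : (Fin (T + 1) → X) → ℝ}

lemma tendsto_integral_exp_pathInt_zero (hS : ∀ N, (S N).IsFFBSi A P) (hb : A.Bounds T C)
    (hlik : H.BoundedLikelihood T)
    (hh : Measurable h) (hK : ∀ x, |h x| ≤ K) (h0 : H.unsmooth T h = 0)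
    (y : ℕ → X) (u : ℝ) :
    Tendsto (fun N : ℕ => ∫ ω, Complex.exp
      (((u * (√N * H.pathInt ((S N).emp A ω) 0 (H.L T 0 h) y) : ℝ) : ℂ) * Complex.I) ∂P) atTop
      (𝓝 ((Real.exp (-(u ^ 2 * A.initVar T h / 2)) : ℝ) : ℂ)) := by
  have hC : 0 ≤ C := zero_le_one.trans hb.one_le
  obtain ⟨K', hK'⟩ := hlik.exists_abs_L_le hK
  have hK'0 : 0 ≤ K' := (abs_nonneg _).trans (hK' 0 (Nat.zero_le _) y)
  set φ : X → ℝ := fun x => H.L T 0 h (update y 0 x) with hφ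
  have hφm : Measurable φ := (DominatedHMM.measurable_L hh).comp
    ((DominatedHMM.measurable_update_pair 0).comp (measurable_const.prodMk measurable_id))
  have hφK : ∀ x, |φ x| ≤ K' := fun x => hK' 0 (Nat.zero_le _) _
  have ha : Measurable fun x => min (A.w₀ x) C * φ x :=
    (APF.measurable_w₀.min measurable_const).mul hφm
  have hmean : ∫ x, min (A.w₀ x) C * φ x ∂A.ρ₀ = 0 := by
    rw [integral_min_w₀_mul hb, ← h0, ← hlik.pathInt_L hb.m_le hh hK (Nat.zero_le T) y]
    simp only [DominatedHMM.pathInt, DominatedHMM.unfiltUpTo, Nat.zero_min]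
    rfl
  have hsq : ∫ x, (min (A.w₀ x) C * φ x) ^ 2 ∂A.ρ₀ = A.initVar T h := by
    refine integral_congr_ae ?_
    filter_upwards [hb.w₀_le] with x hx
    rw [min_eq_left hx, mul_pow, hlik.F_eq (Nat.zero_le T) x h y]
    rfl
  have key := tendsto_integral_exp_of_step (P := P) (G := fun _ => Set.univ)
    (R := fun q => √q.1 * ((q.1 : ℝ)⁻¹ * ∑ i, min (A.w₀ ((S q.1).ξ 0 i q.2)) C *
      φ ((S q.1).ξ 0 i q.2)))
    (X := fun q => √q.1 * 0) (V := fun _ => A.initVar T h - 0 ^ 2) (u := u) (v := A.initVar T h)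
    (l := 1) (ε := fun N : ℕ => 2 * (2 * (C * K') * |u|) ^ 3 / √N)
    (by simp) (by simp) (fun N => ?_) (fun N => by simp) (fun N => measurable_const)
    (fun N ω _ => ?_) (by simpa using tendsto_const_nhds) (tendsto_const_div_sqrt_nat _) ?_ (by simp)
  · rw [one_mul] at key
    refine key.congr fun N => integral_congr_ae ?_
    filter_upwards [(hS N).weight_zero_le_ae hb] with ω hω
    rw [← integral_emp_zero hω φ]
    rfl
  · simp only
    exact Measurable.const_mul (Measurable.const_mul (Finset.measurable_sum Finset.univ
      (f := fun i ω => min (A.w₀ ((S N).ξ 0 i ω)) C * φ ((S N).ξ 0 i ω)) fun i _ =>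
        ha.comp ((hS N).measurable_ξ 0 i)) _) _
  · simp only [ne_eq, OfNat.ofNat_ne_zero, not_false_eq_true, zero_pow, sub_zero]
    exact integral_nonneg fun x => mul_nonneg (sq_nonneg _) (sq_nonneg _)
  · filter_upwards [eventually_le_sqrt_nat (2 * (C * K') * |u|)] with N hN
    have := (hS N).condIID_init.norm_setIntegral_exp_sub_le hN.1
      (a := fun q => min (A.w₀ q.2) C * φ q.2)
      (ha.comp measurable_snd) (K := C * K') (by positivity)
      (fun _ _ y => abs_min_w₀_mul_le hC _ (hφK _))
      (μ := fun _ => 0) (s := fun _ => A.initVar T h) (@measurable_const _ _ _ ⊥ _)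
      (@measurable_const _ _ _ ⊥ _)
      (fun _ _ => hmean.symm) (fun _ _ => hsq.symm) hN.2
    exact this

lemma tendsto_integral_exp_pathInt (hS : ∀ N, (S N).IsFFBSi A P) (hb : A.Bounds T C)
    (hlik : H.BoundedLikelihood T)
    (hh : Measurable h) (hK : ∀ x, |h x| ≤ K) (h0 : H.unsmooth T h = 0)
    {t : ℕ} (ht : t ≤ T) (y : ℕ → X) (u : ℝ) :
    Tendsto (fun N : ℕ => ∫ ω, Complex.exp
      (((u * (√N * H.pathInt ((S N).emp A ω) t (H.L T t h) y) : ℝ) : ℂ) * Complex.I) ∂P) atTop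
      (𝓝 ((Real.exp (-(u ^ 2 * (A.initVar T h + ∑ s ∈ Finset.range t, A.stepVar T h s) / 2)) : ℝ) :
        ℂ)) := by
  induction t with
  | zero => simpa using tendsto_integral_exp_pathInt_zero hS hb hlik hh hK h0 y u
  | succ t ih =>
  have ih := ih (by omega)
  have hC : 0 ≤ C := zero_le_one.trans hb.one_le
  have hfin := hlik.isFiniteMeasure_unfiltUpTo
  obtain ⟨K', hK'⟩ := hlik.exists_abs_L_le hK
  have hK'0 : 0 ≤ K' := (abs_nonneg _).trans (hK' 0 (Nat.zero_le _) y)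
  have hLm : Measurable (H.L T (t + 1) h) := DominatedHMM.measurable_L hh
  have hLm' : Measurable (H.L T t h) := DominatedHMM.measurable_L hh
  have hLK : ∀ x, |H.L T (t + 1) h x| ≤ K' := hK' (t + 1) ht
  have hφK : ∀ (η : ℕ → Measure X) x, |H.gbwd η (t + 1) (H.L T (t + 1) h) x| ≤ K' :=
    fun η x => DominatedHMM.abs_gbwd_le hLK x
  set V : ℕ × Ω → ℝ := fun q => (S q.1).normConst A (t + 1) q.2 * (∫ u, A.ϑ (t + 1) u *
    ∫ x, A.w (t + 1) u x ^ 2 * H.gbwd ((S q.1).emp A q.2) (t + 1) (H.L T (t + 1) h)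
      (update y (t + 1) x) ^ 2 ∂(A.proposal (t + 1) u) ∂((S q.1).emp A q.2 t)) -
    H.pathInt ((S q.1).emp A q.2) t (H.L T t h) y ^ 2 with hV
  have hmean : ∀ N ω, ∫ u, ∫ z, H.g (t + 1) z * H.gbwd ((S N).emp A ω) (t + 1)
      (H.L T (t + 1) h) (update y (t + 1) z) ∂(H.M u) ∂((S N).emp A ω t) =
      H.pathInt ((S N).emp A ω) t (H.L T t h) y := by
    intro N ω
    rw [DominatedHMM.integral_M_gbwd_succ hb.m_le (hb.g_le _ ht) hLm hLK,
      DominatedHMM.L_succ ht]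
  have hgm : ∀ N, Measurable fun q : Ω × X => H.gbwd ((S N).emp A q.1) (t + 1)
      (H.L T (t + 1) h) (update y (t + 1) q.2) := fun N =>
    measurable_gbwd_emp ((hS N).past_le t) le_rfl hLm y
  have hgp : ∀ N, Measurable[((S N).past A t).prod inferInstance] fun q : Ω × X =>
      H.gbwd ((S N).emp A q.1) (t + 1) (H.L T (t + 1) h) (update y (t + 1) q.2) := fun N =>
    measurable_gbwd_emp le_rfl le_rfl hLm y
  have key := tendsto_integral_exp_of_step (P := P) (G := fun N => (S N).good A C t)
    (R := fun q => √q.1 * H.pathInt ((S q.1).emp A q.2) (t + 1) (H.L T (t + 1) h) y)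
    (X := fun q => √q.1 * H.pathInt ((S q.1).emp A q.2) t (H.L T t h) y) (V := V) (u := u)
    (v := A.stepVar T h t)
    (ε := fun N : ℕ => 2 * (2 * ((C * C) ^ (t + 1) * (C * K')) * |u|) ^ 3 / √N)
    (good_and_tendsto_integral_emp hS hb hlik (by omega)).1
    (fun N => measurableSet_good ((hS N).past_le t) le_rfl)
    (fun N => (measurable_pathInt_emp ((hS N).past_le (t + 1)) le_rfl hLm y).const_mul √(N : ℝ))
    (fun N => (measurable_pathInt_emp ((hS N).past_le t) le_rfl hLm' y).const_mul √(N : ℝ))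
    (fun N => ?_) (fun N ω hω => ?_) ?_ (tendsto_const_div_sqrt_nat _) ?_ ih
  · rw [← Complex.ofReal_mul, ← Real.exp_add] at key
    convert key using 4
    rw [Finset.sum_range_succ]
    ring
  · have e1 := measurable_integral_proposal_emp ((hS N).past_le t) (φ := fun q =>
      H.gbwd ((S N).emp A q.1) (t + 1) (H.L T (t + 1) h) (update y (t + 1) q.2)) (hgm N)
    have e2 := measurable_normConst_of_past_le (s := t + 1) ((hS N).past_le t) le_rfl
    have e3 := measurable_pathInt_emp ((hS N).past_le t) le_rfl hLm' y
    exact (e2.mul e1).sub (e3.pow_const 2)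
  · have hp := isProbabilityMeasure_instrumental (hω.1 t le_rfl)
    have hmω : Measurable fun x => H.gbwd ((S N).emp A ω) (t + 1)
      (H.L T (t + 1) h) (update y (t + 1) x) := by
      have e := (hgm N).comp (measurable_prodMk_left (x := ω))
      simpa only [Function.comp_def] using e
    simp only [hV]
    rw [sub_nonneg, ← hmean, ← integral_instrumental_mul hb ht (hω.1 t le_rfl) hmω (fun x => hφK _ _),
      ← integral_instrumental_mul_sq hb ht (hω.1 t le_rfl) hmω (fun x => hφK _ _)]
    refine sq_integral_le_integral_sq ?_ (K := (C * C) ^ (t + 1) * (C * K'))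
      fun y => abs_normConst_mul_le hb ht hω _ _ (hφK _ _)
    refine Measurable.const_mul (Measurable.mul ?_ (hmω.comp measurable_snd)) _
    exact (APF.measurable_w (t + 1)).comp (((measurable_of_finite fun k : Fin N =>
      (S N).ξ t k ω).comp measurable_fst).prodMk measurable_snd)
  · have h1 := (tendsto_normConst_succ hS hb hlik ht).mul
      (tendsto_integral_proposal_gbwd_sq hS hb hlik ht hLm hLK y)
    have h2 := (tendsto_pathInt_emp hS hb hlik (t := t) (by omega)
      (DominatedHMM.measurable_L hh) (hK' t (by omega)) y).pow 2
    rw [hlik.pathInt_L hb.m_le hh hK (by omega), h0] at h2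
    have h3 := h1.sub h2
    simp only [← hlik.F_eq ht] at h3
    simpa [APF.stepVar] using! h3
  · filter_upwards [eventually_le_sqrt_nat (2 * ((C * C) ^ (t + 1) * (C * K')) * |u|)] with N hN
    have := (hS N).norm_setIntegral_exp_step_le hN.1 hb ht
      (φ := fun q => H.gbwd ((S N).emp A q.1) (t + 1) (H.L T (t + 1) h) (update y (t + 1) q.2))
      (hgp N) hK'0 (fun q => hφK _ _) hN.2
    simp only [hmean] at this
    exact this

end CLT

end ParticleArray

namespace ParticleArray

open scoped ENNReal Topology
open Function (update)

/-! ### Backward simulation -/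

section Backward

variable {Ω X : Type*} {T N : ℕ} {S : ParticleArray Ω X T N}

variable (S) in
/-- The path that follows the particles with indices `j` up to time `t` and `x` afterwards. -/
def overridePath (ω : Ω) (t : ℕ) (j : Fin (t + 1) → Fin N) (x : ℕ → X) : ℕ → X :=
  fun s => if hs : s < t + 1 then S.ξ s (j ⟨s, hs⟩) ω else x s

lemma overridePath_zero (ω : Ω) (j : Fin 1 → Fin N) (x : ℕ → X) :
    S.overridePath ω 0 j x = update x 0 (S.ξ 0 (j 0) ω) := by
  ext s
  rcases Nat.eq_zero_or_pos s with rfl | hs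
  · simp [overridePath]
  · simp [overridePath, hs.ne']

lemma overridePath_snoc (ω : Ω) (t : ℕ) (j : Fin (t + 1) → Fin N) (i : Fin N) (x : ℕ → X) :
    S.overridePath ω (t + 1) (Fin.snoc (α := fun _ => Fin N) j i) x =
      S.overridePath ω t j (update x (t + 1) (S.ξ (t + 1) i ω)) := by
  ext s
  rcases lt_trichotomy s (t + 1) with hs | rfl | hs
  · simp [overridePath, Fin.snoc, hs, hs.trans (Nat.lt_succ_self _)]
  · simp [overridePath, Fin.snoc]
  · have h1 : ¬ s < t + 1 := by omega
    have h2 : ¬ s < t + 1 + 1 := by omega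
    simp [overridePath, h1, h2, hs.ne']

variable [MeasurableSpace X] {H : DominatedHMM X} {A : APF H}

lemma measurable_particle_path {m : MeasurableSpace Ω} (hξ : ∀ s ≤ T, ∀ i, Measurable (S.ξ s i))
    {h : (Fin (T + 1) → X) → ℝ} (hh : Measurable h) :
    Measurable fun q : Ω × (Fin (T + 1) → Fin N) => h (fun s => S.ξ s (q.2 s) q.1) :=
  measurable_from_prod_countable_left fun j => hh.comp
    (measurable_pi_lambda _ fun s => hξ s (by omega) (j s))

lemma IsFFBSi.measurable_estimator {mΩ : MeasurableSpace Ω} {P : Measure Ω}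
    (hS : S.IsFFBSi A P) {h : (Fin (T + 1) → X) → ℝ} (hh : Measurable h) :
    Measurable (S.estimator h) := by
  refine Measurable.const_mul (Finset.measurable_sum _ fun ℓ _ => ?_) _
  exact (measurable_particle_path (fun s _ i => hS.measurable_ξ s i) hh).comp
    (measurable_id.prodMk (measurable_pi_lambda _ fun t => hS.measurable_J ℓ t))

variable [MeasurableSingletonClass X]

lemma gbwd_emp_succ {t : ℕ} {ω : Ω} (hn : ∀ s ≤ t, 0 < S.sumWeight A s ω) (f : (ℕ → X) → ℝ)
    {x : ℕ → X} {i : Fin N} (hx : x (t + 1) = S.ξ (t + 1) i ω) :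
    H.gbwd (S.emp A ω) (t + 1) f x =
      ∑ k, S.Λ A t ω i k * H.gbwd (S.emp A ω) t f (update x t (S.ξ t k ω)) := by
  have hc : S.normConst A t ω ≠ 0 := (normConst_pos fun s hs => hn s hs.le).ne'
  have hN : (N : ℝ)⁻¹ ≠ 0 := by
    refine inv_ne_zero (Nat.cast_ne_zero.2 ?_)
    rintro rfl
    exact i.elim0
  simp only [DominatedHMM.gbwd, DominatedHMM.BK, integral_emp, hx]
  rw [mul_div_mul_left _ _ hc, mul_div_mul_left _ _ hN, Finset.sum_div]
  refine Finset.sum_congr rfl fun k _ => ?_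
  rw [Λ]
  ring

lemma sum_overridePath {t : ℕ} {ω : Ω} (hn : ∀ s < t, 0 < S.sumWeight A s ω)
    (f : (ℕ → X) → ℝ) (c : Fin N → ℝ) (x : ℕ → X) :
    ∑ j : Fin (t + 1) → Fin N, c (j (Fin.last t)) *
        (∏ s : Fin t, S.Λ A s ω (j s.succ) (j s.castSucc)) * f (S.overridePath ω t j x) =
      ∑ i, c i * H.gbwd (S.emp A ω) t f (update x t (S.ξ t i ω)) := by
  induction t generalizing c x with
  | zero =>
    rw [← (Equiv.funUnique (Fin 1) (Fin N)).symm.sum_comp]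
    refine Finset.sum_congr rfl fun i _ => ?_
    rw [overridePath_zero]
    simp [DominatedHMM.gbwd]
  | succ t ih =>
    rw [← (Fin.snocEquiv fun _ => Fin N).sum_comp, Fintype.sum_prod_type]
    refine Finset.sum_congr rfl fun i _ => ?_
    rw [gbwd_emp_succ (i := i) (fun s hs => hn s (by omega)) f (by simp),
      ← ih (fun s hs => hn s (by omega)) (S.Λ A t ω i), Finset.mul_sum]
    refine Finset.sum_congr rfl fun j _ => ?_
    have h1 : (Fin.snocEquiv fun _ => Fin N) (i, j) = Fin.snoc (α := fun _ => Fin N) j i := rfl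
    rw [h1, overridePath_snoc, Fin.prod_univ_castSucc]
    simp only [Fin.snoc_last, Fin.succ_castSucc, Fin.snoc_castSucc, Fin.succ_last,
      Fin.val_castSucc, Fin.val_last]
    ring

lemma integral_emp_one_mul_sum_pathProb {ω : Ω} (hn : S.Nondegenerate A T ω)
    (h : (Fin (T + 1) → X) → ℝ) (y : ℕ → X) :
    (∫ _, (1 : ℝ) ∂(S.emp A ω T)) * ∑ j, S.pathProb A ω j * h (fun s => S.ξ s (j s) ω) =
      H.pathInt (S.emp A ω) T (DominatedHMM.pathFun h) y := by
  have hW := (hn T le_rfl).ne'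
  have h1 := sum_overridePath (t := T) (fun s hs => hn s hs.le) (DominatedHMM.pathFun h)
    (fun i => S.weight A T i ω / S.sumWeight A T ω) y
  have h2 : ∀ j : Fin (T + 1) → Fin N, DominatedHMM.pathFun h (S.overridePath ω T j y) =
      h (fun s => S.ξ s (j s) ω) := by
    intro j
    simp only [DominatedHMM.pathFun, overridePath]
    congr 1
    ext s
    simp [s.2]
  simp only [h2] at h1
  simp only [pathProb]
  rw [h1, DominatedHMM.pathInt, integral_emp, integral_emp]
  simp only [mul_one]
  rw [mul_assoc, mul_assoc]
  congr 2
  rw [← sumWeight, Finset.mul_sum]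
  refine Finset.sum_congr rfl fun i _ => ?_
  field_simp

lemma integral_emp_one_of_mem_goodBackward {C : ℝ} {ω : Ω} (hω : ω ∈ S.goodBackward A C)
    (y : ℕ → X) :
    ∫ _, (1 : ℝ) ∂(S.emp A ω T) = H.pathInt (S.emp A ω) T (H.L T T (fun _ => 1)) y := by
  have := integral_emp_one_mul_sum_pathProb hω.1.1 (fun _ => 1) y
  simp only [mul_one, hω.2] at this
  rw [this, DominatedHMM.L_eq, Nat.sub_self]
  rfl

end Backward

section CLT

variable {Ω X : Type*} [MeasurableSpace X] [MeasurableSingletonClass X] {H : DominatedHMM X}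
  {T : ℕ} {A : APF H} {mΩ : MeasurableSpace Ω} {P : Measure Ω} [IsProbabilityMeasure P]
  {S : (N : ℕ) → ParticleArray Ω X T N} {C : ℝ}

lemma eventually_mem_goodBackward (hS : ∀ N, (S N).IsFFBSi A P) (hb : A.Bounds T C)
    (hlik : H.BoundedLikelihood T)
    :
    ∀ᶠ q in inProb P, q.2 ∈ (S q.1).goodBackward A C := by
  have h1 : ∀ᶠ q in inProb P, (S q.1).Nondegenerate A T q.2 →
      ∑ j, (S q.1).pathProb A q.2 j = 1 :=
    eventually_inProb_of_ae fun N _ => (hS N).sum_pathProb_ae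
  filter_upwards [(good_and_tendsto_integral_emp hS hb hlik le_rfl).1, h1] with q hq1 hq2
  exact ⟨hq1, hq2 hq1.1⟩

lemma tendsto_integral_emp_one (hS : ∀ N, (S N).IsFFBSi A P) (hb : A.Bounds T C)
    (hlik : H.BoundedLikelihood T)
    :
    Tendsto (fun q : ℕ × Ω => ∫ _, (1 : ℝ) ∂((S q.1).emp A q.2 T)) (inProb P)
      (𝓝 (H.unsmooth T fun _ => 1)) := by
  obtain ⟨x₀⟩ : Nonempty X := A.ρ₀.nonempty_of_neZero
  have h1K : ∀ x : Fin (T + 1) → X, |(fun _ => (1 : ℝ)) x| ≤ 1 := by simp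
  obtain ⟨K', hK'⟩ := hlik.exists_abs_L_le h1K
  have h1 := tendsto_pathInt_emp hS hb hlik le_rfl (DominatedHMM.measurable_L measurable_const)
    (hK' T le_rfl) (fun _ => x₀)
  rw [hlik.pathInt_L hb.m_le measurable_const h1K le_rfl] at h1
  refine h1.congr' ?_
  filter_upwards [eventually_mem_goodBackward hS hb hlik] with q hq
  exact (integral_emp_one_of_mem_goodBackward hq _).symm

lemma tendsto_integral_exp_backward (hS : ∀ N, (S N).IsFFBSi A P) (hb : A.Bounds T C)
    (hlik : H.BoundedLikelihood T)
    {h : (Fin (T + 1) → X) → ℝ} (hh : Measurable h) {K : ℝ}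
    (hK : ∀ x, |h x| ≤ K) (h0 : H.unsmooth T h = 0) (u : ℝ) :
    Tendsto (fun N : ℕ => ∫ ω, Complex.exp
      (((u * (√N * ((∫ _, (1 : ℝ) ∂((S N).emp A ω T)) * (S N).estimator h ω)) : ℝ) : ℂ) *
        Complex.I) ∂P) atTop
      (𝓝 ((Real.exp (-(u ^ 2 * (A.initVar T h + ∑ s ∈ Finset.range T, A.stepVar T h s +
        H.unsmooth T (fun _ => 1) * H.unsmooth T (fun x => h x ^ 2)) / 2)) : ℝ) : ℂ)) := by
  have hC : 0 ≤ C := zero_le_one.trans hb.one_le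
  obtain ⟨x₀⟩ : Nonempty X := A.ρ₀.nonempty_of_neZero
  set y : ℕ → X := fun _ => x₀
  have hK0 : 0 ≤ K := (abs_nonneg _).trans (hK fun _ => x₀)
  have hh2 : Measurable fun x => h x ^ 2 := hh.pow_const 2
  have hK2 : ∀ x, |h x ^ 2| ≤ K ^ 2 := fun x => by
    rw [abs_pow]
    have := hK x
    gcongr
  have hLT : ∀ h : (Fin (T + 1) → X) → ℝ, H.L T T h = DominatedHMM.pathFun h := fun h => by
    rw [DominatedHMM.L_eq, Nat.sub_self]
    rfl
  have ih := tendsto_integral_exp_pathInt hS hb hlik hh hK h0 le_rfl y u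
  have hZm : ∀ N (m : MeasurableSpace Ω), (S N).past A T ≤ m →
      Measurable fun ω => ∫ _, (1 : ℝ) ∂((S N).emp A ω T) := fun N m hm =>
    measurable_integral_emp hm le_rfl (F := fun _ => 1) measurable_const
  have hpm : ∀ N (m : MeasurableSpace Ω), (S N).past A T ≤ m →
      ∀ {f : (Fin (T + 1) → X) → ℝ}, Measurable f →
      Measurable fun ω => H.pathInt ((S N).emp A ω) T (H.L T T f) y := fun N m hm f hf =>
    measurable_pathInt_emp hm le_rfl (DominatedHMM.measurable_L hf) y
  set b : ℝ := (C * C) ^ T * C * K with hbdef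
  have hab : ∀ N, ∀ ω ∈ (S N).goodBackward A C, ∀ j : Fin (T + 1) → Fin N,
      |(∫ _, (1 : ℝ) ∂((S N).emp A ω T)) * h (fun s => (S N).ξ s (j s) ω)| ≤ b := by
    intro N ω hω j
    rw [abs_mul, abs_of_nonneg (integral_nonneg fun _ => zero_le_one)]
    exact mul_le_mul (integral_emp_one_le hb le_rfl hω.1) (hK _) (abs_nonneg _) (by positivity)
  have hmean : ∀ N, ∀ ω ∈ (S N).goodBackward A C,
      H.pathInt ((S N).emp A ω) T (H.L T T h) y =
      ∫ j, (∫ _, (1 : ℝ) ∂((S N).emp A ω T)) * h (fun s => (S N).ξ s (j s) ω)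
        ∂((S N).pathLaw A ω) := by
    intro N ω hω
    rw [hLT, ← integral_emp_one_mul_sum_pathProb hω.1.1, integral_const_mul, integral_pathLaw]
  have hsq : ∀ N, ∀ ω ∈ (S N).goodBackward A C,
      (∫ _, (1 : ℝ) ∂((S N).emp A ω T)) *
        H.pathInt ((S N).emp A ω) T (H.L T T (fun x => h x ^ 2)) y =
      ∫ j, ((∫ _, (1 : ℝ) ∂((S N).emp A ω T)) * h (fun s => (S N).ξ s (j s) ω)) ^ 2
        ∂((S N).pathLaw A ω) := by
    intro N ω hω
    simp only [mul_pow]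
    rw [hLT, ← integral_emp_one_mul_sum_pathProb hω.1.1, integral_const_mul, integral_pathLaw]
    ring
  have key := tendsto_integral_exp_of_step (P := P) (G := fun N => (S N).goodBackward A C)
    (R := fun q => √q.1 * ((∫ _, (1 : ℝ) ∂((S q.1).emp A q.2 T)) * (S q.1).estimator h q.2))
    (X := fun q => √q.1 * H.pathInt ((S q.1).emp A q.2) T (H.L T T h) y)
    (V := fun q => (∫ _, (1 : ℝ) ∂((S q.1).emp A q.2 T)) *
        H.pathInt ((S q.1).emp A q.2) T (H.L T T (fun x => h x ^ 2)) y -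
        H.pathInt ((S q.1).emp A q.2) T (H.L T T h) y ^ 2) (u := u)
    (v := H.unsmooth T (fun _ => 1) * H.unsmooth T (fun x => h x ^ 2))
    (ε := fun N : ℕ => 2 * (2 * b * |u|) ^ 3 / √N)
    (eventually_mem_goodBackward hS hb hlik)
    (fun N => (hS N).past_le T _ (measurableSet_goodBackward C))
    (fun N => Measurable.const_mul
      ((hZm N _ ((hS N).past_le T)).mul ((hS N).measurable_estimator hh)) √(N : ℝ))
    (fun N => Measurable.const_mul (hpm N _ ((hS N).past_le T) hh) √(N : ℝ))
    (fun N => ((hZm N _ ((hS N).past_le T)).mul (hpm N _ ((hS N).past_le T) hh2)).sub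
      ((hpm N _ ((hS N).past_le T) hh).pow_const 2))
    (fun N ω hω => ?_) ?_ (tendsto_const_div_sqrt_nat _) ?_ ih
  · rw [← Complex.ofReal_mul, ← Real.exp_add] at key
    convert key using 4
    ring
  · have hp := ((hS N).condIID_backward C).isProbabilityMeasure_kernel ω hω
    simp only
    rw [sub_nonneg, hmean N ω hω, hsq N ω hω]
    exact sq_integral_le_integral_sq (measurable_of_finite _) (hab N ω hω)
  · obtain ⟨K', hK'⟩ := hlik.exists_abs_L_le hK
    obtain ⟨K'', hK''⟩ := hlik.exists_abs_L_le hK2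
    have h1 := tendsto_pathInt_emp hS hb hlik le_rfl (DominatedHMM.measurable_L hh)
      (hK' T le_rfl) y
    have h2 := tendsto_pathInt_emp hS hb hlik le_rfl (DominatedHMM.measurable_L hh2)
      (hK'' T le_rfl) y
    rw [hlik.pathInt_L hb.m_le hh hK le_rfl, h0] at h1
    rw [hlik.pathInt_L hb.m_le hh2 hK2 le_rfl] at h2
    have h3 := ((tendsto_integral_emp_one hS hb hlik).mul h2).sub (h1.pow 2)
    simpa using! h3
  · filter_upwards [eventually_le_sqrt_nat (2 * b * |u|)] with N hN
    have := ((hS N).condIID_backward C).norm_setIntegral_exp_sub_le hN.1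
      (a := fun q => (∫ _, (1 : ℝ) ∂((S N).emp A q.1 T)) * h (fun s => (S N).ξ s (q.2 s) q.1))
      (Measurable.mul ((hZm N _ le_rfl).comp measurable_fst) (measurable_particle_path
        (fun s hs i => measurable_ξ_of_past_le le_rfl hs i) hh))
      (K := b) (by positivity) (hab N)
      (μ := fun ω => H.pathInt ((S N).emp A ω) T (H.L T T h) y)
      (s := fun ω => (∫ _, (1 : ℝ) ∂((S N).emp A ω T)) *
        H.pathInt ((S N).emp A ω) T (H.L T T (fun x => h x ^ 2)) y)
      (hpm N _ le_rfl hh) ((hZm N _ le_rfl).mul (hpm N _ le_rfl hh2))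
      (hmean N) (hsq N) hN.2
    have he : ∀ ω, (N : ℝ)⁻¹ * ∑ ℓ, (∫ _, (1 : ℝ) ∂((S N).emp A ω T)) *
        h (fun s => (S N).ξ s ((S N).J ℓ s ω) ω) =
        (∫ _, (1 : ℝ) ∂((S N).emp A ω T)) * (S N).estimator h ω := fun ω => by
      rw [← Finset.mul_sum, estimator]
      ring
    simp only [Set.preimage_id, id, he] at this
    exact this

end CLT

end ParticleArray

open scoped Topology in
lemma tendstoInMeasure_of_tendsto_inProb {Ω : Type*} [MeasurableSpace Ω] {P : Measure Ω}
    {R : ℕ × Ω → ℝ} {c : ℝ} (h : Tendsto R (inProb P) (𝓝 c)) :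
    TendstoInMeasure P (fun N ω => R (N, ω)) atTop (fun _ => c) := by
  rw [tendstoInMeasure_iff_norm]
  simpa only [Real.norm_eq_abs] using tendsto_inProb_iff.1 h

open scoped Topology in
/-- Lévy's criterion for convergence in distribution to a centred Gaussian law. -/
lemma tendstoInDistribution_gaussianReal_of_tendsto_integral_exp {Ω : Type*} [MeasurableSpace Ω]
    {P : Measure Ω} [IsProbabilityMeasure P] {R : ℕ → Ω → ℝ} (hR : ∀ N, Measurable (R N)) {v : ℝ}
    (hv : 0 ≤ v) (h : ∀ u : ℝ, Tendsto (fun N => ∫ ω, Complex.exp (((u * R N ω : ℝ) : ℂ) *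
      Complex.I) ∂P) atTop (𝓝 ((Real.exp (-(u ^ 2 * v / 2)) : ℝ) : ℂ))) :
    TendstoInDistribution R atTop (id : ℝ → ℝ) (fun _ => P) (gaussianReal 0 v.toNNReal) where
  forall_aemeasurable := fun N => (hR N).aemeasurable
  aemeasurable_limit := aemeasurable_id
  tendsto := by
    refine ProbabilityMeasure.tendsto_iff_tendsto_charFun.2 fun u => ?_
    simp only [ProbabilityMeasure.coe_mk, Measure.map_id, charFun_gaussianReal]
    convert h u using 2
    · rw [charFun_apply_real, integral_map (hR _).aemeasurable (by fun_prop)]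
      push_cast
      rfl
    · rw [Complex.ofReal_exp]
      push_cast [Real.coe_toNNReal v hv]
      congr 1
      ring

namespace DominatedHMM

variable {X : Type*} [MeasurableSpace X] {H : DominatedHMM X}

lemma BoundedLikelihood.integral_F_one {T : ℕ} (hlik : H.BoundedLikelihood T) {Cm : ℝ}
    (hm : ∀ x x', H.m x x' ≤ Cm) {t : ℕ} (ht : t ≤ T) (y : ℕ → X) :
    ∫ x, H.F T t x (fun _ => 1) ∂(H.unfiltUpTo T t) = H.unsmooth T (fun _ => 1) := by
  rw [← hlik.pathInt_L hm measurable_const (K := 1) (by simp) ht y, pathInt]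
  simp only [hlik.F_eq ht _ _ y]

end DominatedHMM

namespace APF

variable {X : Type*} [MeasurableSpace X] {H : DominatedHMM X} {A : APF H}

lemma initVar_nonneg (T : ℕ) (h : (Fin (T + 1) → X) → ℝ) : 0 ≤ A.initVar T h :=
  integral_nonneg fun _ => mul_nonneg (sq_nonneg _) (sq_nonneg _)

lemma stepVar_nonneg (T : ℕ) (h : (Fin (T + 1) → X) → ℝ) (t : ℕ) : 0 ≤ A.stepVar T h t :=
  mul_nonneg (integral_nonneg fun _ => (A.ϑ_pos _ _).le) (integral_nonneg fun _ =>
    mul_nonneg (A.ϑ_pos _ _).le (integral_nonneg fun _ =>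
      mul_nonneg (sq_nonneg _) (sq_nonneg _)))

lemma asymVar_eq {T : ℕ} {C : ℝ} (hb : A.Bounds T C)
    (hlik : H.BoundedLikelihood T)
    {h : (Fin (T + 1) → X) → ℝ} (h0 : H.smooth T h = 0) :
    A.asymVar T h = (A.initVar T h + ∑ s ∈ Finset.range T, A.stepVar T h s) /
      H.unsmooth T (fun _ => 1) ^ 2 := by
  obtain ⟨x₀⟩ : Nonempty X := A.ρ₀.nonempty_of_neZero
  have hG : ∀ t x, H.G T t x h = H.F T t x h := by
    intro t x
    simp only [DominatedHMM.G, h0, sub_zero]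
  have h1 : ∫ x, A.w₀ x * H.F T 0 x (fun _ => 1) ∂A.ρ₀ = H.unsmooth T (fun _ => 1) := by
    rw [integral_w₀_mul, ← hlik.integral_F_one hb.m_le (Nat.zero_le T) (fun _ => x₀),
      DominatedHMM.unfiltUpTo, Nat.zero_min]
  rw [asymVar, h1, add_div, Finset.sum_div]
  congr 1
  · simp only [hG]
    rfl
  · rw [← Finset.Ico_succ_right_eq_Icc, Finset.sum_Ico_eq_sum_range]
    refine Finset.sum_congr (by simp) fun s hs => ?_
    have hs : s < T := by simpa using hs
    have hfin := hlik.isFiniteMeasure_unfilt hs.le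
    have hne := hlik.unfilt_univ_ne_zero hs.le
    have hc : ((H.unfilt s Set.univ)⁻¹).toReal ≠ 0 :=
      ENNReal.toReal_ne_zero.2 ⟨ENNReal.inv_ne_zero.2 (measure_ne_top _ _),
        ENNReal.inv_ne_top.2 hne⟩
    have hu : H.unfilt s = H.unfiltUpTo T s := by rw [DominatedHMM.unfiltUpTo, min_eq_left hs.le]
    rw [Nat.add_comm 1 s, Nat.add_sub_cancel]
    simp only [DominatedHMM.filt, integral_smul_measure, smul_eq_mul, upsilon, hG, stepVar]
    rw [hu, hlik.integral_F_one hb.m_le hs.le (fun _ => x₀)]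
    rw [hu] at hc
    field_simp

end APF

namespace ParticleArray

open scoped Topology

lemma estimator_sub_const {Ω X : Type*} {T N : ℕ} (S : ParticleArray Ω X T N)
    (h : (Fin (T + 1) → X) → ℝ) (c : ℝ) (ω : Ω) :
    √(N : ℝ) * S.estimator (fun x => h x - c) ω = √(N : ℝ) * (S.estimator h ω - c) := by
  rcases Nat.eq_zero_or_pos N with hN | hN
  · simp [hN]
  · have hN0 : (N : ℝ) ≠ 0 := by exact_mod_cast hN.ne'
    simp only [estimator, Finset.sum_sub_distrib, Finset.sum_const, Finset.card_univ,
      Fintype.card_fin, nsmul_eq_mul]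
    field_simp

/-- The central limit theorem for a function with vanishing smoothing expectation. -/
theorem tendstoInDistribution_estimator {Ω X : Type*} [MeasurableSpace X]
    [MeasurableSingletonClass X] {H : DominatedHMM X} {T : ℕ} {A : APF H}
    [MeasurableSpace Ω] {P : Measure Ω} [IsProbabilityMeasure P]
    {S : (N : ℕ) → ParticleArray Ω X T N} (hS : ∀ N, (S N).IsFFBSi A P) {C : ℝ}
    (hb : A.Bounds T C) (hlik : H.BoundedLikelihood T) {h : (Fin (T + 1) → X) → ℝ}
    (hh : Measurable h) {K : ℝ} (hK : ∀ x, |h x| ≤ K) (h0 : H.smooth T h = 0) :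
    TendstoInDistribution (fun (N : ℕ) (ω : Ω) => √(N : ℝ) * (S N).estimator h ω)
      atTop (id : ℝ → ℝ) (fun _ => P)
      (gaussianReal 0 (H.smooth T (fun x => h x ^ 2) + A.asymVar T h).toNNReal) := by
  set Z := H.unsmooth T (fun _ => 1) with hZ
  have hZ0 : 0 < Z := hlik.unsmooth_one_pos
  have hu0 : H.unsmooth T h = 0 := by
    rw [DominatedHMM.smooth_eq, div_eq_zero_iff] at h0
    exact h0.resolve_right hZ0.ne'
  have hsq0 : 0 ≤ H.unsmooth T (fun x => h x ^ 2) := by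
    refine integral_nonneg fun x => mul_nonneg (H.g_nonneg _ _) ?_
    rw [DominatedHMM.L_eq]
    generalize (fun _ : ℕ => x) = x'
    have : ∀ n t x', 0 ≤ H.fwd n t (DominatedHMM.pathFun fun x => h x ^ 2) x' := by
      intro n
      induction n with
      | zero => exact fun t x' => sq_nonneg _
      | succ n ih => exact fun t x' => integral_nonneg fun z => mul_nonneg (H.g_nonneg _ _) (ih _ _)
    exact this _ _ _
  set v := (A.initVar T h + ∑ s ∈ Finset.range T, A.stepVar T h s +
        Z * H.unsmooth T (fun x => h x ^ 2)) / Z ^ 2 with hv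
  have hv0 : 0 ≤ v := div_nonneg (add_nonneg (add_nonneg (APF.initVar_nonneg _ _)
    (Finset.sum_nonneg fun _ _ => APF.stepVar_nonneg _ _ _)) (mul_nonneg hZ0.le hsq0))
    (sq_nonneg _)
  have hveq : H.smooth T (fun x => h x ^ 2) + A.asymVar T h = v := by
    rw [APF.asymVar_eq hb hlik h0, DominatedHMM.smooth_eq, hv, ← hZ]
    field_simp
    ring
  rw [hveq]
  set ZN : ℕ → Ω → ℝ := fun N ω => ∫ _, (1 : ℝ) ∂((S N).emp A ω T) with hZN
  have hZNm : ∀ N, Measurable (ZN N) := fun N =>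
    measurable_integral_emp ((hS N).past_le T) le_rfl (F := fun _ => 1) measurable_const
  have hem : ∀ N, Measurable ((S N).estimator h) := fun N => (hS N).measurable_estimator hh
  have hlim := tendstoInDistribution_gaussianReal_of_tendsto_integral_exp (P := P)
    (R := fun N ω => Z⁻¹ * (√(N : ℝ) * (ZN N ω * (S N).estimator h ω)))
    (fun N => (((hZNm N).mul (hem N)).const_mul _).const_mul _) hv0 fun u => by
      have := tendsto_integral_exp_backward hS hb hlik hh hK hu0 (u * Z⁻¹)
      simp only [mul_assoc] at this ⊢
      convert this using 5
      rw [hv, ← hZ]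
      field_simp
  have hratio : Tendsto (fun q : ℕ × Ω => Z / ZN q.1 q.2) (inProb P) (𝓝 1) := by
    have := (tendsto_const_nhds (x := Z)).div (tendsto_integral_emp_one hS hb hlik) hZ0.ne'
    rwa [div_self hZ0.ne'] at this
  have hslut := hlim.continuous_comp_prodMk_of_tendstoInMeasure_const
    (g := fun p : ℝ × ℝ => p.1 * p.2) (by fun_prop)
    (tendstoInMeasure_of_tendsto_inProb hratio)
    (fun N => ((hZNm N).const_div Z).aemeasurable)
  simp only [id, mul_one] at hslut
  refine tendstoInDistribution_of_tendstoInMeasure_sub _ _ hslut ?_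
    fun N => ((hem N).const_mul _).aemeasurable
  refine tendstoInMeasure_of_tendsto_inProb (R := fun q : ℕ × Ω =>
    √(q.1 : ℝ) * (S q.1).estimator h q.2 - Z⁻¹ * (√(q.1 : ℝ) *
      (ZN q.1 q.2 * (S q.1).estimator h q.2)) * (Z / ZN q.1 q.2)) (c := 0) ?_
  refine tendsto_const_nhds.congr' ?_
  filter_upwards [(tendsto_integral_emp_one hS hb hlik).eventually_ne hZ0.ne'] with q hq
  have hq' : ZN q.1 q.2 ≠ 0 := hq
  field_simp
  ring

end ParticleArray

theorem mainTheorem6 {X : Type*} [TopologicalSpace X] [PolishSpace X] [MeasurableSpace X]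
    [BorelSpace X] (H : DominatedHMM X) (A : APF H) (T : ℕ)
    (hlik : H.BoundedLikelihood T) (hweights : A.BoundedWeights T)
    (hdens : A.BoundedDensities T)
    {Ω : Type*} [MeasurableSpace Ω] (P : Measure Ω) [IsProbabilityMeasure P]
    (S : (N : ℕ) → ParticleArray Ω X T N) (hS : ∀ N, (S N).IsFFBSi A P)
    (h : (Fin (T + 1) → X) → ℝ) (hmeas : Measurable h) (hbdd : ∃ C : ℝ, ∀ x, |h x| ≤ C) :
    TendstoInDistribution
      (fun (N : ℕ) (ω : Ω) => √(N : ℝ) * ((S N).estimator h ω - H.smooth T h))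
      atTop (id : ℝ → ℝ) (fun _ => P)
      (gaussianReal 0
        (H.smooth T (fun x => (h x - H.smooth T h) ^ 2) +
          A.asymVar T (fun x => h x - H.smooth T h)).toNNReal) := by
  obtain ⟨C, hb⟩ := APF.exists_bounds hlik hweights hdens
  obtain ⟨K, hK⟩ := hbdd
  have key := ParticleArray.tendstoInDistribution_estimator hS hb hlik
    (h := fun x => h x - H.smooth T h) (hmeas.sub_const _) (K := K + |H.smooth T h|)
    (fun x => (abs_sub _ _).trans (add_le_add (hK x) le_rfl))
    (hlik.smooth_sub_smooth hmeas hK)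
  simpa only [ParticleArray.estimator_sub_const] using key
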